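/- Let $a<b$, $T>0$, and let $m\ge 1$ be an integer. Put $\mu_l=\frac{2\pi l}{b-a}$, $\delta_l=\sqrt{1+\mu_l^2}$ and $\widehat f_l=\frac1{b-a}\int_a^b f(x)e^{-i\mu_l(x-a)}\,dx$ for $l\in\mathbb Z$. For an integer $s\ge0$ let $H^s$ be the space of $f\in L^2(a,b)$ with $\|f\|_s^2=\sum_{l\in\mathbb Z}(1+\mu_l^2)^s|\widehat f_l|^2<\infty$, and write $\|\cdot\|=\|\cdot\|_0$. For $0<\varepsilon\le1$ let $u$ be a real-valued solution on $[0,T/\varepsilon^2]$ of the cubic nonlinear Klein--Gordon equation $$\partial_{tt}u-\partial_{xx}u+u+\varepsilon^2u^3=0\quad\text{on }(a,b),\qquad u(\cdot,0)=u_0,\quad \partial_tu(\cdot,0)=u_1,$$ with periodic boundary conditions. The equation is understood weakly, tested against smooth $(b-a)$-periodic functions of $x$, and $u(\cdot,t)$, $\partial_tu(\cdot,t)$ denote the continuous representatives. Assumption (A) of order $m$ with bound $M$ is $$\|u(\cdot,t)\|_{m+1}\le M,\qquad \|\partial_tu(\cdot,t)\|_m\le M\qquad(0\le t\le T/\varepsilon^2).$$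 Time-splitting Fourier pseudospectral method. Let $N$ be a positive even integer, $h=\frac{b-a}N$, $x_j=a+jh$ $(0\le j\le N)$, $\mathcal T_N=\{-\frac N2,\dots,\frac N2-1\}$. For a grid function $w=(w_0,\dots,w_N)$ put $\widetilde w_l=\frac1N\sum_{j=0}^{N-1}w_je^{-i\mu_l(x_j-a)}$ and $I_Nw(x)=\sum_{l\in\mathcal T_N}\widetilde w_le^{i\mu_l(x-a)}$. With $G(z)=\frac18(z+\bar z)^3$ applied componentwise, time step $\tau>0$ and $t_n=n\tau$, let $$\psi^0_j=u_0(x_j)-i\sum_{l\in\mathcal T_N}\frac{\widetilde{(u_1)}_l}{\delta_l}e^{i\mu_l(x_j-a)},\qquad \psi^{(1)}_j=\sum_{l\in\mathcal T_N}e^{i\tau\delta_l/2}\,\widetilde{(\psi^n)}_l\,e^{i\mu_l(x_j-a)},$$ $$\psi^{(2)}_j=\psi^{(1)}_j+i\varepsilon^2\tau\sum_{l\in\mathcal T_N}\frac1{\delta_l}\widetilde{(G(\psi^{(1)}))}_l\,e^{i\mu_l(x_j-a)},\qquad \psi^{n+1}_j=\sum_{l\in\mathcal T_N}e^{i\tau\delta_l/2}\,\widetilde{(\psi^{(2)})}_l\,e^{i\mu_l(x_j-a)},$$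 and $u^0_j=u_0(x_j)$, $v^0_j=u_1(x_j)$, and for $n\ge0$ $$u^{n+1}_j=\tfrac12\big(\psi^{n+1}_j+\overline{\psi^{n+1}_j}\big),\qquad v^{n+1}_j=\tfrac i2\sum_{l\in\mathcal T_N}\delta_l\big[\widetilde{(\psi^{n+1})}_l-\widetilde{(\overline{\psi^{n+1}})}_l\big]e^{i\mu_l(x_j-a)}.$$ Write $E_n=\|u(\cdot,t_n)-I_Nu^n\|_1+\|\partial_tu(\cdot,t_n)-I_Nv^n\|$. 1. For every $M$ there are $h_0>0$ and $\bar\tau\in(0,1)$ such that for every $\alpha\in(0,1)$ there is $C>0$ with the following property. For all $\tau_0\in(0,\bar\tau]$, all $\varepsilon\in(0,1]$, all solutions $u$ as above satisfying (A) of order $m$ with bound $M$, all $N$ with $h\le h_0$, all $\tau$ with $$0<\tau<\alpha\,\frac{\pi(b-a)\tau_0}{2\sqrt{\tau_0^2(b-a)^2+4\pi^2(1+\tau_0^2)}},$$ and all integers $n$ with $0\le n\le\frac{T/\varepsilon^2}{\tau}$, $$E_n\le C\big(h^m+\varepsilon^2\tau^2+\tau_0^{m+1}\big).$$ 2. (Smooth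 solutions.) Let $(M_k)_{k\ge0}$ be a sequence of bounds, and consider solutions $u$ that satisfy (A) of every order $k\ge 0$ with bound $M_k$. (a) For every integer $p\ge0$ statement 1 holds for these solutions with $\tau_0^{m+1}$ replaced by $\tau_0^{p}$, with $h_0,\bar\tau$ depending only on $a,b,T,m,(M_k),p$ and $C$ on these and $\alpha$. (b) For every $\kappa>0$ there are $h_0,\tau_c,C>0$, depending only on $a,b,T,m,(M_k),\kappa$, such that for all $\varepsilon\in(0,1]$, all these solutions, all $N$ with $h\le h_0$, all $0<\tau\le\tau_c\,\varepsilon^{\kappa}$ and all $0\le n\le\frac{T/\varepsilon^2}{\tau}$, $$E_n\le C\big(h^m+\varepsilon^2\tau^2\big).$$ -/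

import Mathlib

open scoped ContDiff

noncomputable section

namespace NKGE

/-- The wave number `μ_l = 2πl/(b-a)`. -/
def mu (a b : ℝ) (l : ℤ) : ℝ := 2 * Real.pi * l / (b - a)

/-- The symbol `δ_l = √(1+μ_l²)` of the operator `⟨∇⟩ = √(1-Δ)`. -/
def delta (a b : ℝ) (l : ℤ) : ℝ := Real.sqrt (1 + mu a b l ^ 2)

/-- The Fourier mode `x ↦ e^{iμ_l(x-a)}`. -/
def mode (a b : ℝ) (l : ℤ) (x : ℝ) : ℂ :=
  Complex.exp (Complex.I * ((mu a b l * (x - a) : ℝ) : ℂ))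

/-- The Fourier coefficient `(b-a)⁻¹ ∫_a^b f(x) e^{-iμ_l(x-a)} dx`. -/
def fcoeff (a b : ℝ) (f : ℝ → ℂ) (l : ℤ) : ℂ :=
  (1 / ((b - a : ℝ) : ℂ)) *
    ∫ x in a..b, f x * Complex.exp (-(Complex.I * ((mu a b l * (x - a) : ℝ) : ℂ)))

/-- Membership in the periodic Sobolev space `H^s(a,b)` (for `s = 0` this is `L²(a,b)`). -/
def MemH (a b : ℝ) (s : ℕ) (f : ℝ → ℂ) : Prop :=
  MeasureTheory.MemLp f 2 (MeasureTheory.volume.restrict (Set.Ioo a b)) ∧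
    Summable fun l : ℤ => (1 + mu a b l ^ 2) ^ s * ‖fcoeff a b f l‖ ^ 2

/-- The norm `‖f‖_s = (∑_l (1+μ_l²)^s |f̂_l|²)^{1/2}`, meaningful for `f` with `MemH a b s f`. -/
def normH (a b : ℝ) (s : ℕ) (f : ℝ → ℂ) : ℝ :=
  Real.sqrt (∑' l : ℤ, (1 + mu a b l ^ 2) ^ s * ‖fcoeff a b f l‖ ^ 2)

/-- `u` (first argument time, second argument space) solves on `[0, S]` the problem
`∂ₜₜu - ∂ₓₓu + u + ε²u³ = 0` on `(a,b)` with periodic boundary conditions and initial data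
`u(0) = u₀`, `∂ₜu(0) = u₁`, and `v = ∂ₜu`.  Both evolution equations `∂ₜu = v` and
`∂ₜv = ∂ₓₓu - u - ε²u³` are understood weakly, i.e. after pairing with an arbitrary smooth
`(b-a)`-periodic function of `x`; the test functions being periodic, this contains the boundary
condition on `∂ₓu`.  For each time, `u` and `v` are given by their continuous representatives. -/
structure IsSolution (a b ε S : ℝ) (u₀ u₁ : ℝ → ℝ) (u v : ℝ → ℝ → ℝ) : Prop where
  continuous_u : ∀ t ∈ Set.Icc 0 S, ContinuousOn (u t) (Set.Icc a b)
  continuous_v : ∀ t ∈ Set.Icc 0 S, ContinuousOn (v t) (Set.Icc a b)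
  periodic_u : ∀ t ∈ Set.Icc 0 S, u t a = u t b
  initial_u : ∀ x ∈ Set.Icc a b, u 0 x = u₀ x
  initial_v : ∀ x ∈ Set.Icc a b, v 0 x = u₁ x
  deriv_u : ∀ φ : ℝ → ℝ, ContDiff ℝ ∞ φ → Function.Periodic φ (b - a) → ∀ t ∈ Set.Icc 0 S,
    HasDerivWithinAt (fun s => ∫ x in a..b, u s x * φ x)
      (∫ x in a..b, v t x * φ x) (Set.Icc 0 S) t
  deriv_v : ∀ φ : ℝ → ℝ, ContDiff ℝ ∞ φ → Function.Periodic φ (b - a) → ∀ t ∈ Set.Icc 0 S,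
    HasDerivWithinAt (fun s => ∫ x in a..b, v s x * φ x)
      (∫ x in a..b, (u t x * deriv (deriv φ) x - u t x * φ x - ε ^ 2 * u t x ^ 3 * φ x))
      (Set.Icc 0 S) t

/-- Assumption (A) with bound `M` on `[0, S]`: `‖u(t)‖_{m+1} ≤ M` and `‖∂ₜu(t)‖_m ≤ M`. -/
def AssumptionA (a b S : ℝ) (m : ℕ) (M : ℝ) (u v : ℝ → ℝ → ℝ) : Prop :=
  ∀ t ∈ Set.Icc 0 S,
    (MemH a b (m + 1) (fun x => (u t x : ℂ)) ∧ normH a b (m + 1) (fun x => (u t x : ℂ)) ≤ M) ∧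
    (MemH a b m (fun x => (v t x : ℂ)) ∧ normH a b m (fun x => (v t x : ℂ)) ≤ M)

/-- The mesh size `h = (b-a)/N`. -/
def mesh (a b : ℝ) (N : ℕ) : ℝ := (b - a) / N

/-- The grid points `x_j = a + jh`, `j = 0, …, N`. -/
def grid (a b : ℝ) (N : ℕ) (j : Fin (N + 1)) : ℝ := a + (j : ℕ) * mesh a b N

/-- The index set `{-N/2, …, N/2-1}` (`N` even). -/
def freqs (N : ℕ) : Finset ℤ := Finset.Ico (-((N : ℤ) / 2)) ((N : ℤ) / 2)

/-- The discrete Fourier coefficient `N⁻¹ ∑_{j=0}^{N-1} w_j e^{-iμ_l(x_j-a)}`. -/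
def dcoeff (a b : ℝ) (N : ℕ) (w : Fin (N + 1) → ℂ) (l : ℤ) : ℂ :=
  (1 / (N : ℂ)) * ∑ j : Fin N, w j.castSucc *
    Complex.exp (-(Complex.I * ((mu a b l * (grid a b N j.castSucc - a) : ℝ) : ℂ)))

/-- The trigonometric interpolation `I_N w`. -/
def interp (a b : ℝ) (N : ℕ) (w : Fin (N + 1) → ℂ) (x : ℝ) : ℂ :=
  ∑ l ∈ freqs N, dcoeff a b N w l * mode a b l x

/-- The discrete Fourier multiplier `w ↦ (∑_l c_l w̃_l e^{iμ_l(x_j-a)})_j` on grid functions. -/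
def gridMul (a b : ℝ) (N : ℕ) (c : ℤ → ℂ) (w : Fin (N + 1) → ℂ) (j : Fin (N + 1)) : ℂ :=
  ∑ l ∈ freqs N, c l * dcoeff a b N w l * mode a b l (grid a b N j)

/-- `G(z) = (z + z̄)³/8`. -/
def G (z : ℂ) : ℂ := (1 / 8) * (z + (starRingEnd ℂ) z) ^ 3

/-- The multiplier `e^{iτδ_l/2}` of the linear half step. -/
def halfPhase (a b τ : ℝ) (l : ℤ) : ℂ :=
  Complex.exp (Complex.I * ((τ * delta a b l / 2 : ℝ) : ℂ))

/-- The multiplier `1/δ_l` of `⟨∇⟩⁻¹`. -/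
def invDelta (a b : ℝ) (l : ℤ) : ℂ := 1 / ((delta a b l : ℝ) : ℂ)

/-- First stage `ψ^{(1)}` of a step (linear half step). -/
def stage1 (a b τ : ℝ) (N : ℕ) (ψ : Fin (N + 1) → ℂ) : Fin (N + 1) → ℂ :=
  gridMul a b N (halfPhase a b τ) ψ

/-- Second stage `ψ^{(2)}` of a step (nonlinear step). -/
def stage2 (a b ε τ : ℝ) (N : ℕ) (ψ : Fin (N + 1) → ℂ) (j : Fin (N + 1)) : ℂ :=
  stage1 a b τ N ψ j + ((ε ^ 2 * τ : ℝ) : ℂ) *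
    (Complex.I * gridMul a b N (invDelta a b) (fun k => G (stage1 a b τ N ψ k)) j)

/-- One time step `ψⁿ ↦ ψⁿ⁺¹` of the scheme. -/
def step (a b ε τ : ℝ) (N : ℕ) (ψ : Fin (N + 1) → ℂ) : Fin (N + 1) → ℂ :=
  gridMul a b N (halfPhase a b τ) (stage2 a b ε τ N ψ)

/-- The numerical solution `ψⁿ` of the relativistic NLSE. -/
def psi (a b ε τ : ℝ) (N : ℕ) (u₀ u₁ : ℝ → ℝ) : ℕ → Fin (N + 1) → ℂ
  | 0 => fun j => (u₀ (grid a b N j) : ℂ) -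
      Complex.I * gridMul a b N (invDelta a b) (fun k => (u₁ (grid a b N k) : ℂ)) j
  | n + 1 => step a b ε τ N (psi a b ε τ N u₀ u₁ n)

/-- The numerical approximation `uⁿ` of `u(·, tₙ)`. -/
def uNum (a b ε τ : ℝ) (N : ℕ) (u₀ u₁ : ℝ → ℝ) : ℕ → Fin (N + 1) → ℂ
  | 0 => fun j => (u₀ (grid a b N j) : ℂ)
  | n + 1 => fun j => (1 / 2) * (psi a b ε τ N u₀ u₁ (n + 1) j +
      (starRingEnd ℂ) (psi a b ε τ N u₀ u₁ (n + 1) j))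

/-- The numerical approximation `vⁿ` of `∂ₜu(·, tₙ)`. -/
def vNum (a b ε τ : ℝ) (N : ℕ) (u₀ u₁ : ℝ → ℝ) : ℕ → Fin (N + 1) → ℂ
  | 0 => fun j => (u₁ (grid a b N j) : ℂ)
  | n + 1 => fun j => (Complex.I / 2) * ∑ l ∈ freqs N, ((delta a b l : ℝ) : ℂ) *
      (dcoeff a b N (psi a b ε τ N u₀ u₁ (n + 1)) l -
        dcoeff a b N (fun k => (starRingEnd ℂ) (psi a b ε τ N u₀ u₁ (n + 1) k)) l) *
      mode a b l (grid a b N j)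

/-- The error functions belong to `H¹` and `L²`, and
`‖u(·,tₙ) - I_N uⁿ‖₁ + ‖∂ₜu(·,tₙ) - I_N vⁿ‖ ≤ B`, where `tₙ = nτ`. -/
def ErrorLE (a b ε τ : ℝ) (N : ℕ) (u₀ u₁ : ℝ → ℝ) (u v : ℝ → ℝ → ℝ) (n : ℕ) (B : ℝ) : Prop :=
  MemH a b 1 (fun x => (u (n * τ) x : ℂ) - interp a b N (uNum a b ε τ N u₀ u₁ n) x) ∧
  MemH a b 0 (fun x => (v (n * τ) x : ℂ) - interp a b N (vNum a b ε τ N u₀ u₁ n) x) ∧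
  normH a b 1 (fun x => (u (n * τ) x : ℂ) - interp a b N (uNum a b ε τ N u₀ u₁ n) x) +
    normH a b 0 (fun x => (v (n * τ) x : ℂ) - interp a b N (vNum a b ε τ N u₀ u₁ n) x) ≤ B

/-- The upper bound `α π(b-a)τ₀ / (2√(τ₀²(b-a)² + 4π²(1+τ₀²)))` for the time step. -/
def stepBound (a b α τ₀ : ℝ) : ℝ :=
  α * (Real.pi * (b - a) * τ₀ /
    (2 * Real.sqrt (τ₀ ^ 2 * (b - a) ^ 2 + 4 * Real.pi ^ 2 * (1 + τ₀ ^ 2))))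

end NKGE

end

/-! Put ψ = u - i⟨∇⟩⁻¹∂ₜu. The twisted coefficients φ_l(t) = e^{-iδ_l t} ψ̂_l(t) move slowly: their
derivative is ε² δ_l⁻¹ times a coefficient of u³, up to a unimodular factor. In the same variable
the scheme is the midpoint rule for the Duhamel integral of the cubic term. There are at most
T/(ε²τ) steps, each with a prefactor ε²τ, so a defect d in the nonlinearity contributes O(d) to the
final error. A direct analysis of the midpoint rule gives d of size τ²; the extra ε² comes from
cancellation between steps.

On each step φ is frozen at the left endpoint and cut off to a symmetric set of low frequencies
(`lowFreqs`). Freezing costs O(ε²τ²) by `norm_rfc_u_sub_frozen_le`, and the cut-off costs O(ρ^{m+1})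
with ρ = h + (b-a)τ₀. The twisted cube of the frozen solution is a finite sum of exponentials
e^{iΩs} with Ω = ±δ±δ±δ-δ_l. Its midpoint error on step k is `quadErr Ω τ` times e^{iΩkτ} times an
amplitude that changes by O(ε²τ) per step. Summation by parts reduces the accumulated error to
geometric sums bounded by 1/|sin(Ωτ/2)|. The cut-off and the step restriction give |Ωτ/2| ≤ απ,
where |sin θ| ≥ κ|θ|. The total is then O(ε²κ⁻¹τ²|Ω|), with no factor for the number of steps
(`quadErr_mul_geom_le`, `norm_sum_quad_le`). The remaining power of Ω is absorbed by the decay δ⁻²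
of the amplitudes (`sum_tripleWeight_le`).

Stability rests on the discrete Parseval identity and the pointwise Lipschitz bound for the cube
(`l2_nonlin_sub_le`). It needs a sup bound on the numerical solution, which holds while the energy
error is at most one. `le_one_of_gronwall` bootstraps this with a crude quadrature bound that does
not see α, so h₀ and τ̄ can be chosen before α. The term h^m comes from interpolating the data and
from the tails of the spectrum.

For smooth solutions the estimate is applied with a higher order. With τ₀ proportional to τ, and τ
at most a multiple of ε^κ, a high power of τ₀ is dominated by ε²τ². -/

namespace NKGE

/-! ### Frequency weights and their summability. -/

section Weights
variable {a b : ℝ}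

lemma delta_sq (a b : ℝ) (l : ℤ) : delta a b l ^ 2 = 1 + mu a b l ^ 2 :=
  Real.sq_sqrt (by positivity)

lemma one_le_delta (a b : ℝ) (l : ℤ) : 1 ≤ delta a b l :=
  Real.one_le_sqrt.2 (by nlinarith [sq_nonneg (mu a b l)])

lemma delta_pos (a b : ℝ) (l : ℤ) : 0 < delta a b l :=
  lt_of_lt_of_le one_pos (one_le_delta a b l)

lemma delta_ne_zero (a b : ℝ) (l : ℤ) : ((delta a b l : ℝ) : ℂ) ≠ 0 :=
  Complex.ofReal_ne_zero.2 (delta_pos a b l).ne'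

lemma mu_neg (a b : ℝ) (l : ℤ) : mu a b (-l) = -mu a b l := by
  simp only [mu]; push_cast; ring

lemma mu_add (a b : ℝ) (k l : ℤ) : mu a b (k + l) = mu a b k + mu a b l := by
  simp only [mu]; push_cast; ring

lemma delta_neg (a b : ℝ) (l : ℤ) : delta a b (-l) = delta a b l := by
  simp only [delta, mu_neg, neg_sq]

lemma abs_mu_le_delta (a b : ℝ) (l : ℤ) : |mu a b l| ≤ delta a b l :=
  Real.abs_le_sqrt (by linarith)

/-- After squaring, the claim reduces to μ_k μ_l ≤ δ_k δ_l. It passes the weight of an output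
frequency of a product to the input frequencies. -/
lemma delta_add_le (a b : ℝ) (k l : ℤ) : delta a b (k + l) ≤ delta a b k + delta a b l := by
  have hk := delta_pos a b k
  have hl := delta_pos a b l
  refine abs_le_of_sq_le_sq' ?_ (by positivity) |>.2
  have h1 : mu a b k * mu a b l ≤ delta a b k * delta a b l :=
    (le_abs_self _).trans (by
      rw [abs_mul]
      exact mul_le_mul (abs_mu_le_delta a b k) (abs_mu_le_delta a b l) (abs_nonneg _) hk.le)
  have h2 := delta_sq a b k
  have h3 := delta_sq a b l
  rw [delta_sq, mu_add]
  nlinarith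

lemma delta_add_three_le (a b : ℝ) (j k l : ℤ) :
    delta a b (j + k + l) ≤ delta a b j + delta a b k + delta a b l :=
  (delta_add_le a b _ _).trans (by linarith [delta_add_le a b j k])

lemma summable_inv_delta_sq (hab : a < b) : Summable fun l : ℤ => (delta a b l ^ 2)⁻¹ := by
  have hb : 0 < b - a := sub_pos.2 hab
  have hs : Summable fun l : ℤ => ((2 * Real.pi / (b - a)) ^ 2)⁻¹ * (1 / (l : ℝ) ^ 2) :=
    (Real.summable_one_div_int_pow.2 one_lt_two).mul_left _
  refine hs.of_norm_bounded_eventually ?_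
  rw [Filter.eventually_cofinite]
  refine (Set.finite_singleton (0 : ℤ)).subset fun l hl => ?_
  by_contra hne
  refine hl ?_
  have hl0 : (l : ℝ) ≠ 0 := by exact_mod_cast hne
  have hl2 : 0 < (l : ℝ) ^ 2 := by positivity
  rw [Real.norm_of_nonneg (by positivity), delta_sq, one_div, ← mul_inv]
  refine inv_anti₀ (by positivity) ?_
  have : mu a b l ^ 2 = (2 * Real.pi / (b - a)) ^ 2 * (l : ℝ) ^ 2 := by
    simp only [mu]; ring
  linarith

/-- The sum `∑_l δ_l⁻²`. -/
noncomputable def deltaSum (a b : ℝ) : ℝ := ∑' l : ℤ, (delta a b l ^ 2)⁻¹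

lemma sum_inv_delta_sq_le (hab : a < b) (s : Finset ℤ) :
    ∑ l ∈ s, (delta a b l ^ 2)⁻¹ ≤ deltaSum a b :=
  (summable_inv_delta_sq hab).sum_le_tsum s fun _ _ => by positivity

lemma deltaSum_nonneg (a b : ℝ) : 0 ≤ deltaSum a b := tsum_nonneg fun _ => by positivity

end Weights

/-! ### Fourier coefficients, Parseval and pointwise convergence of the series. -/

section Fourier
variable {a b : ℝ}

lemma norm_mode (a b : ℝ) (l : ℤ) (x : ℝ) : ‖mode a b l x‖ = 1 := by
  rw [mode, mul_comm, Complex.norm_exp_ofReal_mul_I]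

lemma mode_add (a b : ℝ) (k l : ℤ) (x : ℝ) :
    mode a b (k + l) x = mode a b k x * mode a b l x := by
  simp only [mode, ← Complex.exp_add, mu_add]; congr 1; push_cast; ring

lemma mode_zero (a b : ℝ) (x : ℝ) : mode a b 0 x = 1 := by simp [mode, mu]

lemma mode_neg (a b : ℝ) (l : ℤ) (x : ℝ) : mode a b (-l) x = (mode a b l x)⁻¹ := by
  rw [mode, mode, ← Complex.exp_neg, mu_neg]; congr 1; push_cast; ring

lemma exp_neg_eq_mode (a b : ℝ) (l : ℤ) (x : ℝ) :
    Complex.exp (-(Complex.I * ((mu a b l * (x - a) : ℝ) : ℂ))) = mode a b (-l) x := by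
  rw [mode_neg, mode, Complex.exp_neg]

lemma conj_mode (a b : ℝ) (l : ℤ) (x : ℝ) :
    (starRingEnd ℂ) (mode a b l x) = mode a b (-l) x := by
  rw [mode, ← Complex.exp_conj, ← exp_neg_eq_mode]; simp

lemma continuous_mode (a b : ℝ) (l : ℤ) : Continuous (mode a b l) := by
  unfold mode; fun_prop

lemma fcoeff_eq (a b : ℝ) (f : ℝ → ℂ) (l : ℤ) :
    fcoeff a b f l = (1 / ((b - a : ℝ) : ℂ)) * ∫ x in a..b, f x * mode a b (-l) x := by
  simp only [fcoeff, exp_neg_eq_mode]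

/-- The two normalisations differ by the unimodular factor e^{iμ_l a}, since the modes here are
centred at a. This is the bridge to Parseval for `fourierCoeffOn`. -/
lemma norm_fcoeff_eq (hab : a < b) (f : ℝ → ℂ) (l : ℤ) :
    ‖fcoeff a b f l‖ = ‖fourierCoeffOn hab f l‖ := by
  have hb : ((b - a : ℝ) : ℂ) ≠ 0 := Complex.ofReal_ne_zero.2 (sub_pos.2 hab).ne'
  have h : fcoeff a b f l = mode a b l (2 * a) * fourierCoeffOn hab f l := by
    rw [fourierCoeffOn_eq_integral, fcoeff_eq, Complex.real_smul]
    rw [mul_left_comm, ← intervalIntegral.integral_const_mul (mode a b l (2 * a))]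
    push_cast
    congr 1
    refine intervalIntegral.integral_congr fun x _ => ?_
    rw [smul_eq_mul, ← mul_assoc, mul_comm]
    congr 1
    rw [fourier_coe_apply, mode, mode, ← Complex.exp_add]
    congr 1
    simp only [mu]
    push_cast at hb ⊢
    field_simp
    ring
  rw [h, norm_mul, norm_mode, one_mul]

lemma memLp_of_continuousOn {f : ℝ → ℂ} (hf : ContinuousOn f (Set.Icc a b)) :
    MeasureTheory.MemLp f 2 (MeasureTheory.volume.restrict (Set.Ioc a b)) := by
  obtain ⟨C, hC⟩ := isCompact_Icc.exists_bound_of_continuousOn hf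
  refine MeasureTheory.MemLp.of_bound
    ((hf.mono Set.Ioc_subset_Icc_self).aestronglyMeasurable measurableSet_Ioc) C ?_
  filter_upwards [MeasureTheory.ae_restrict_mem measurableSet_Ioc] with x hx
  exact hC x (Set.Ioc_subset_Icc_self hx)

lemma memLp_Ioo_of_continuousOn {f : ℝ → ℂ} (hf : ContinuousOn f (Set.Icc a b)) :
    MeasureTheory.MemLp f 2 (MeasureTheory.volume.restrict (Set.Ioo a b)) :=
  (memLp_of_continuousOn hf).mono_measure
    (MeasureTheory.Measure.restrict_mono Set.Ioo_subset_Ioc_self le_rfl)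

lemma hasSum_sq_fcoeff (hab : a < b) {f : ℝ → ℂ} (hf : ContinuousOn f (Set.Icc a b)) :
    HasSum (fun l => ‖fcoeff a b f l‖ ^ 2) ((b - a)⁻¹ * ∫ x in a..b, ‖f x‖ ^ 2) := by
  simp only [norm_fcoeff_eq hab]
  exact hasSum_sq_fourierCoeffOn hab (memLp_of_continuousOn hf)

lemma intervalIntegrable_mul_mode (hab : a < b) {f : ℝ → ℂ} (hf : ContinuousOn f (Set.Icc a b))
    (l : ℤ) : IntervalIntegrable (fun x => f x * mode a b l x) MeasureTheory.volume a b := by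
  refine ContinuousOn.intervalIntegrable ?_
  rw [Set.uIcc_of_le hab.le]
  exact hf.mul (continuous_mode a b l).continuousOn

lemma fcoeff_sub (hab : a < b) {f g : ℝ → ℂ} (hf : ContinuousOn f (Set.Icc a b))
    (hg : ContinuousOn g (Set.Icc a b)) (l : ℤ) :
    fcoeff a b (fun x => f x - g x) l = fcoeff a b f l - fcoeff a b g l := by
  simp only [fcoeff_eq, sub_mul]
  rw [intervalIntegral.integral_sub (intervalIntegrable_mul_mode hab hf _)
    (intervalIntegrable_mul_mode hab hg _), mul_sub]

lemma fcoeff_mode (hab : a < b) (k l : ℤ) :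
    fcoeff a b (mode a b k) l = if k = l then 1 else 0 := by
  have hb0 : (b - a) ≠ 0 := (sub_pos.2 hab).ne'
  have hb : ((b - a : ℝ) : ℂ) ≠ 0 := Complex.ofReal_ne_zero.2 hb0
  simp only [fcoeff_eq, ← mode_add]
  split_ifs with h
  · simp only [h, add_neg_cancel, mode_zero, intervalIntegral.integral_const, Complex.real_smul,
      mul_one]
    field_simp
  · have hm : k + -l ≠ 0 := by omega
    set j := k + -l
    have hj : ((j : ℤ) : ℂ) ≠ 0 := by exact_mod_cast hm
    have hmu : mu a b j ≠ 0 := by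
      simp only [mu]
      have : (j : ℝ) ≠ 0 := by exact_mod_cast hm
      have := Real.pi_ne_zero
      positivity
    have hc : (Complex.I * ((mu a b j : ℝ) : ℂ)) ≠ 0 :=
      mul_ne_zero Complex.I_ne_zero (Complex.ofReal_ne_zero.2 hmu)
    have hd : ∀ x ∈ Set.uIcc a b, HasDerivAt
        (fun x : ℝ => mode a b j x / (Complex.I * ((mu a b j : ℝ) : ℂ))) (mode a b j x) x := by
      intro x _
      have h1 : HasDerivAt (fun x : ℝ => Complex.I * ((mu a b j * (x - a) : ℝ) : ℂ))
          (Complex.I * ((mu a b j * 1 : ℝ) : ℂ)) x :=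
        ((((hasDerivAt_id x).sub_const a).const_mul (mu a b j)).ofReal_comp).const_mul _
      have h2 := (h1.cexp).div_const (Complex.I * ((mu a b j : ℝ) : ℂ))
      rw [mul_one, mul_div_assoc, div_self hc, mul_one] at h2
      exact h2
    rw [intervalIntegral.integral_eq_sub_of_hasDerivAt hd
      ((continuous_mode a b j).intervalIntegrable _ _)]
    have h1 : mode a b j b = 1 := by
      rw [mode, Complex.exp_eq_one_iff]
      refine ⟨j, ?_⟩
      simp only [mu]
      push_cast at hb ⊢
      field_simp
    have h2 : mode a b j a = 1 := by simp [mode]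
    rw [h1, h2, sub_self, mul_zero]

/-- A function that is continuous on `[a,b]` and has absolutely summable Fourier coefficients is
the sum of its Fourier series at every point of `[a,b]`. -/
lemma hasSum_fourier (hab : a < b) {f : ℝ → ℂ} (hf : ContinuousOn f (Set.Icc a b))
    (hs : Summable fun l => ‖fcoeff a b f l‖) {x : ℝ} (hx : x ∈ Set.Icc a b) :
    HasSum (fun l => fcoeff a b f l * mode a b l x) (f x) := by
  have hs' : ∀ x, Summable fun l => fcoeff a b f l * mode a b l x := fun x =>
    Summable.of_norm (by simpa only [norm_mul, norm_mode, mul_one] using hs)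
  -- The series defines a continuous function with the same coefficients as f. Parseval gives
  -- equality in L², and continuity upgrades it to every point of [a,b], endpoints included.
  set g : ℝ → ℂ := fun x => ∑' l, fcoeff a b f l * mode a b l x with hg
  have hgc : Continuous g := continuous_tsum
    (fun l => continuous_const.mul (continuous_mode a b l)) hs
    (fun l x => by rw [norm_mul, norm_mode, mul_one])
  have hgf : ∀ l, fcoeff a b g l = fcoeff a b f l := by
    intro l
    have h1 : HasSum (fun k => ∫ x in a..b, fcoeff a b f k * mode a b k x * mode a b (-l) x)
        (∫ x in a..b, g x * mode a b (-l) x) := by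
      refine intervalIntegral.hasSum_integral_of_dominated_convergence
        (fun k _ => ‖fcoeff a b f k‖) (fun k => ?_) (fun k => ?_) ?_ ?_ ?_
      · exact ((continuous_const.mul (continuous_mode a b k)).mul
          (continuous_mode a b (-l))).aestronglyMeasurable
      · exact Filter.Eventually.of_forall fun x _ => by
          rw [norm_mul, norm_mul, norm_mode, norm_mode, mul_one, mul_one]
      · exact Filter.Eventually.of_forall fun x _ => hs
      · exact intervalIntegrable_const
      · exact Filter.Eventually.of_forall fun x _ => (hs' x).hasSum.mul_right _
    have h2 : ∀ k, ∫ x in a..b, fcoeff a b f k * mode a b k x * mode a b (-l) x =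
        fcoeff a b f k * ∫ x in a..b, mode a b k x * mode a b (-l) x := by
      intro k
      rw [← intervalIntegral.integral_const_mul]
      simp only [mul_assoc]
    have h3 := h1.mul_left (1 / ((b - a : ℝ) : ℂ))
    simp only [h2, mul_left_comm _ (fcoeff a b f _) _, ← fcoeff_eq, fcoeff_mode hab] at h3
    refine h3.unique ?_
    have h4 : (fun k => fcoeff a b f k * if k = l then (1 : ℂ) else 0) =
        fun k => if k = l then fcoeff a b f l else 0 := by
      ext k
      split_ifs with h <;> simp [h]
    rw [h4]
    exact hasSum_ite_eq l _
  have hfg : ContinuousOn (fun x => f x - g x) (Set.Icc a b) := hf.sub hgc.continuousOn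
  have h0 := hasSum_sq_fcoeff hab hfg
  simp only [fcoeff_sub hab hf hgc.continuousOn, hgf, sub_self, norm_zero, ne_eq,
    OfNat.ofNat_ne_zero, not_false_eq_true, zero_pow] at h0
  have hint : ∫ x in a..b, ‖f x - g x‖ ^ 2 = 0 := by
    have := h0.unique hasSum_zero
    exact (mul_eq_zero.1 this).resolve_left (inv_ne_zero (sub_pos.2 hab).ne')
  have hfx : f x = g x := by
    by_contra hne
    have : 0 < ∫ x in a..b, ‖f x - g x‖ ^ 2 := by
      refine intervalIntegral.integral_pos hab (hfg.norm.pow 2) (fun _ _ => by positivity)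
        ⟨x, hx, ?_⟩
      have := norm_pos_iff.2 (sub_ne_zero.2 hne)
      positivity
    exact this.ne' hint
  rw [hfx]
  exact (hs' x).hasSum

end Fourier

/-! ### Discrete Fourier analysis on the grid. -/

section Grid
variable {a b : ℝ} {N : ℕ}

lemma mode_grid (hab : a < b) (hN : 0 < N) (l : ℤ) (j : Fin (N + 1)) :
    mode a b l (grid a b N j) =
      Complex.exp (2 * Real.pi * Complex.I * ((l : ℂ) * ((j : ℕ) : ℂ) / N)) := by
  have hb : ((b : ℂ) - a) ≠ 0 := by exact_mod_cast (sub_pos.2 hab).ne'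
  have hN' : (N : ℂ) ≠ 0 := by exact_mod_cast hN.ne'
  rw [mode]
  congr 1
  simp only [mu, grid, mesh]
  push_cast
  field_simp
  ring

lemma sum_exp_eq_zero {N : ℕ} (hN : 0 < N) {k : ℤ} (hk : ¬ (N : ℤ) ∣ k) :
    ∑ i ∈ Finset.range N, Complex.exp (2 * Real.pi * Complex.I * ((k : ℂ) / N)) ^ i = 0 := by
  have hN' : (N : ℂ) ≠ 0 := by exact_mod_cast hN.ne'
  have h1 : Complex.exp (2 * Real.pi * Complex.I * ((k : ℂ) / N)) ≠ 1 := by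
    rw [Ne, Complex.exp_eq_one_iff]
    rintro ⟨n, hn⟩
    refine hk ⟨n, ?_⟩
    have h2 : (2 * Real.pi * Complex.I : ℂ) ≠ 0 := Complex.two_pi_I_ne_zero
    rw [mul_comm (n : ℂ)] at hn
    have h3 := mul_left_cancel₀ h2 hn
    rw [div_eq_iff hN'] at h3
    have : (k : ℂ) = ((N * n : ℤ) : ℂ) := by rw [h3]; push_cast; ring
    exact_mod_cast this
  rw [geom_sum_eq h1, ← Complex.exp_nat_mul]
  have h4 : Complex.exp (N * (2 * Real.pi * Complex.I * ((k : ℂ) / N))) = 1 := by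
    rw [Complex.exp_eq_one_iff]
    exact ⟨k, by field_simp⟩
  rw [h4, sub_self, zero_div]

lemma sum_mode_grid (hab : a < b) (hN : 0 < N) (k : ℤ) :
    ∑ j : Fin N, mode a b k (grid a b N j.castSucc) = if (N : ℤ) ∣ k then (N : ℂ) else 0 := by
  have hN' : (N : ℂ) ≠ 0 := by exact_mod_cast hN.ne'
  have h : ∀ j : Fin N, mode a b k (grid a b N j.castSucc) =
      Complex.exp (2 * Real.pi * Complex.I * ((k : ℂ) / N)) ^ (j : ℕ) := by
    intro j
    rw [mode_grid hab hN, ← Complex.exp_nat_mul, Fin.val_castSucc]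
    congr 1
    ring
  simp only [h]
  rw [Fin.sum_univ_eq_sum_range
    (fun i => Complex.exp (2 * Real.pi * Complex.I * ((k : ℂ) / N)) ^ i)]
  split_ifs with hk
  · obtain ⟨n, rfl⟩ := hk
    have : Complex.exp (2 * Real.pi * Complex.I * ((((N : ℤ) * n : ℤ) : ℂ) / N)) = 1 := by
      rw [Complex.exp_eq_one_iff]
      exact ⟨n, by push_cast; field_simp⟩
    simp only [this, one_pow, Finset.sum_const, Finset.card_range, nsmul_eq_mul, mul_one]
  · exact sum_exp_eq_zero hN hk

/-- Orthogonality in the dual variable, summing over frequencies instead of nodes; the discrete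
Parseval identity rests on it. A shift by N/2 turns the sum into a full geometric sum of N-th roots
of unity. -/
lemma sum_freqs_mode_grid (hab : a < b) (hN : 0 < N) (hN2 : Even N) (i j : Fin N) :
    ∑ l ∈ freqs N, mode a b (-l) (grid a b N i.castSucc) * mode a b l (grid a b N j.castSucc) =
      if i = j then (N : ℂ) else 0 := by
  have hN' : (N : ℂ) ≠ 0 := by exact_mod_cast hN.ne'
  obtain ⟨m, rfl⟩ := hN2
  have h2 : (((m + m : ℕ) : ℤ)) / 2 = m := by omega
  set z : ℂ := Complex.exp (2 * Real.pi * Complex.I * ((((j : ℕ) : ℤ) - ((i : ℕ) : ℤ) : ℤ) : ℂ)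
    / ((m + m : ℕ) : ℂ)) with hz
  have hz0 : z ≠ 0 := Complex.exp_ne_zero _
  have h : ∀ l : ℤ, mode a b (-l) (grid a b (m + m) i.castSucc) *
      mode a b l (grid a b (m + m) j.castSucc) = z ^ l := by
    intro l
    rw [mode_grid hab hN, mode_grid hab hN, ← Complex.exp_add, hz, ← Complex.exp_int_mul,
      Fin.val_castSucc, Fin.val_castSucc]
    congr 1
    push_cast
    ring
  have h3 : ∑ l ∈ freqs (m + m), z ^ l = ∑ n ∈ Finset.range (m + m), z ^ ((n : ℤ) - m) := by
    refine Finset.sum_bij' (fun l _ => (l + m).toNat) (fun n _ => (n : ℤ) - m) ?_ ?_ ?_ ?_ ?_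
    all_goals simp only [freqs, h2, Finset.mem_Ico, Finset.mem_range]
    · intro l hl; omega
    · intro n hn; omega
    · intro l hl; omega
    · intro n hn; omega
    · intro l hl
      congr 1
      omega
  simp only [h]
  rw [h3]
  simp only [zpow_sub₀ hz0, zpow_natCast, ← Finset.sum_div]
  split_ifs with hij
  · subst hij
    have : z = 1 := by simp [hz]
    simp [this]
  · have hk : ¬ ((m + m : ℕ) : ℤ) ∣ (((j : ℕ) : ℤ) - ((i : ℕ) : ℤ)) := by
      intro hd
      have h5 : (((j : ℕ) : ℤ) - ((i : ℕ) : ℤ)) = 0 := by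
        refine Int.eq_zero_of_abs_lt_dvd hd ?_
        have := i.2
        have := j.2
        rw [abs_lt]
        omega
      exact hij (Fin.ext (by omega))
    have := sum_exp_eq_zero hN hk
    rw [hz, mul_div_assoc, this, zero_div]

lemma dcoeff_eq (a b : ℝ) (N : ℕ) (w : Fin (N + 1) → ℂ) (l : ℤ) :
    dcoeff a b N w l =
      (1 / (N : ℂ)) * ∑ j : Fin N, w j.castSucc * mode a b (-l) (grid a b N j.castSucc) := by
  simp only [dcoeff, exp_neg_eq_mode]

lemma dcoeff_sub (w z : Fin (N + 1) → ℂ) (l : ℤ) :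
    dcoeff a b N (fun j => w j - z j) l = dcoeff a b N w l - dcoeff a b N z l := by
  simp only [dcoeff_eq, sub_mul, Finset.sum_sub_distrib, mul_sub]

lemma dcoeff_add (w z : Fin (N + 1) → ℂ) (l : ℤ) :
    dcoeff a b N (fun j => w j + z j) l = dcoeff a b N w l + dcoeff a b N z l := by
  simp only [dcoeff_eq, add_mul, Finset.sum_add_distrib, mul_add]

lemma dcoeff_const_mul (c : ℂ) (w : Fin (N + 1) → ℂ) (l : ℤ) :
    dcoeff a b N (fun j => c * w j) l = c * dcoeff a b N w l := by
  simp only [dcoeff_eq, mul_assoc, ← Finset.mul_sum]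
  ring

lemma dcoeff_conj (w : Fin (N + 1) → ℂ) (l : ℤ) :
    dcoeff a b N (fun j => (starRingEnd ℂ) (w j)) l = (starRingEnd ℂ) (dcoeff a b N w (-l)) := by
  simp only [dcoeff_eq, map_mul, map_sum, conj_mode, neg_neg, map_div₀, map_one, Complex.conj_natCast]

lemma dcoeff_mode (hab : a < b) (hN : 0 < N) (k l : ℤ) :
    dcoeff a b N (fun j => mode a b k (grid a b N j)) l = if (N : ℤ) ∣ k - l then 1 else 0 := by
  have hN' : (N : ℂ) ≠ 0 := by exact_mod_cast hN.ne'
  simp only [dcoeff_eq, ← mode_add, sum_mode_grid hab hN, ← sub_eq_add_neg]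
  split_ifs <;> simp [hN']

lemma dcoeff_sum_mode {ι : Type*} (hab : a < b) (hN : 0 < N) (s : Finset ι) (c : ι → ℂ)
    (f : ι → ℤ) (l : ℤ) :
    dcoeff a b N (fun j => ∑ i ∈ s, c i * mode a b (f i) (grid a b N j)) l =
      ∑ i ∈ s, if (N : ℤ) ∣ f i - l then c i else 0 := by
  have h : dcoeff a b N (fun j => ∑ i ∈ s, c i * mode a b (f i) (grid a b N j)) l =
      ∑ i ∈ s, c i * dcoeff a b N (fun j => mode a b (f i) (grid a b N j)) l := by
    simp only [dcoeff_eq, Finset.sum_mul, Finset.mul_sum]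
    rw [Finset.sum_comm]
    refine Finset.sum_congr rfl fun i _ => Finset.sum_congr rfl fun j _ => ?_
    ring
  rw [h]
  refine Finset.sum_congr rfl fun i _ => ?_
  rw [dcoeff_mode hab hN]
  split_ifs <;> simp

lemma fcoeff_sum_mode {ι : Type*} (hab : a < b) (s : Finset ι) (c : ι → ℂ)
    (f : ι → ℤ) (l : ℤ) :
    fcoeff a b (fun x => ∑ i ∈ s, c i * mode a b (f i) x) l =
      ∑ i ∈ s, if f i = l then c i else 0 := by
  have h : fcoeff a b (fun x => ∑ i ∈ s, c i * mode a b (f i) x) l =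
      ∑ i ∈ s, c i * fcoeff a b (mode a b (f i)) l := by
    simp only [fcoeff_eq, Finset.sum_mul]
    rw [intervalIntegral.integral_finsetSum, Finset.mul_sum]
    · refine Finset.sum_congr rfl fun i _ => ?_
      simp only [mul_assoc]
      rw [intervalIntegral.integral_const_mul]
      ring
    · intro i _
      exact ((continuous_const.mul (continuous_mode a b _)).mul
        (continuous_mode a b _)).intervalIntegrable _ _
  rw [h]
  refine Finset.sum_congr rfl fun i _ => ?_
  rw [fcoeff_mode hab]
  split_ifs <;> simp

lemma dvd_sub_iff_of_mem_freqs {k l : ℤ} (hN2 : Even N) (hk : k ∈ freqs N) (hl : l ∈ freqs N) :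
    (N : ℤ) ∣ k - l ↔ k = l := by
  constructor
  · intro h
    have : k - l = 0 := by
      refine Int.eq_zero_of_abs_lt_dvd h ?_
      simp only [freqs, Finset.mem_Ico] at hk hl
      obtain ⟨m, rfl⟩ := hN2
      rw [abs_lt]
      omega
    omega
  · rintro rfl
    simp

lemma dcoeff_sum_freqs (hab : a < b) (hN : 0 < N) (hN2 : Even N) (c : ℤ → ℂ) {l : ℤ}
    (hl : l ∈ freqs N) :
    dcoeff a b N (fun j => ∑ k ∈ freqs N, c k * mode a b k (grid a b N j)) l = c l := by
  rw [dcoeff_sum_mode hab hN (freqs N) c (fun k => k)]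
  rw [Finset.sum_congr rfl fun k hk => by rw [if_congr (dvd_sub_iff_of_mem_freqs hN2 hk hl) rfl rfl]]
  rw [Finset.sum_ite_eq' (freqs N) l c, if_pos hl]

lemma dcoeff_gridMul (hab : a < b) (hN : 0 < N) (hN2 : Even N) (c : ℤ → ℂ) (w : Fin (N + 1) → ℂ)
    {l : ℤ} (hl : l ∈ freqs N) :
    dcoeff a b N (gridMul a b N c w) l = c l * dcoeff a b N w l :=
  dcoeff_sum_freqs hab hN hN2 (fun k => c k * dcoeff a b N w k) hl

/-- Modes whose indices differ by a multiple of N agree at the nodes. This is needed for the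
frequency -N/2, whose mirror image N/2 is not in `freqs N`. -/
lemma dcoeff_eq_of_dvd (hab : a < b) (hN : 0 < N) (w : Fin (N + 1) → ℂ) {k l : ℤ}
    (h : (N : ℤ) ∣ k - l) : dcoeff a b N w k = dcoeff a b N w l := by
  have hN' : (N : ℂ) ≠ 0 := by exact_mod_cast hN.ne'
  obtain ⟨n, hn⟩ := h
  have hk : k = l + N * n := by omega
  simp only [dcoeff_eq]
  congr 1
  refine Finset.sum_congr rfl fun j _ => ?_
  congr 1
  rw [mode_grid hab hN, mode_grid hab hN, Complex.exp_eq_exp_iff_exists_int]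
  refine ⟨-n * (j : ℕ), ?_⟩
  rw [hk, Fin.val_castSucc]
  push_cast
  field_simp
  ring

/-- The discrete Parseval identity. -/
lemma sum_sq_dcoeff (hab : a < b) (hN : 0 < N) (hN2 : Even N) (w : Fin (N + 1) → ℂ) :
    ∑ l ∈ freqs N, ‖dcoeff a b N w l‖ ^ 2 = (N : ℝ)⁻¹ * ∑ j : Fin N, ‖w j.castSucc‖ ^ 2 := by
  have hN' : (N : ℂ) ≠ 0 := by exact_mod_cast hN.ne'
  have h : ∑ l ∈ freqs N, dcoeff a b N w l * (starRingEnd ℂ) (dcoeff a b N w l) =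
      (N : ℂ)⁻¹ * ∑ j : Fin N, w j.castSucc * (starRingEnd ℂ) (w j.castSucc) := by
    have h1 : ∀ l, dcoeff a b N w l * (starRingEnd ℂ) (dcoeff a b N w l) =
        ∑ i : Fin N, ∑ j : Fin N, (1 / (N : ℂ)) ^ 2 * w i.castSucc *
          (starRingEnd ℂ) (w j.castSucc) * (mode a b (-l) (grid a b N i.castSucc) *
            mode a b l (grid a b N j.castSucc)) := by
      intro l
      simp only [dcoeff_eq, map_mul, map_sum, conj_mode, neg_neg, map_div₀, map_one,
        Complex.conj_natCast]
      rw [mul_mul_mul_comm, Finset.sum_mul_sum, Finset.mul_sum]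
      refine Finset.sum_congr rfl fun i _ => ?_
      rw [Finset.mul_sum]
      refine Finset.sum_congr rfl fun j _ => ?_
      ring
    simp only [h1]
    rw [Finset.sum_comm, Finset.mul_sum]
    refine Finset.sum_congr rfl fun i _ => ?_
    rw [Finset.sum_comm]
    simp only [← Finset.mul_sum, sum_freqs_mode_grid hab hN hN2]
    simp only [mul_ite, mul_zero, Finset.sum_ite_eq, Finset.mem_univ, if_true]
    field_simp
  simp only [Complex.mul_conj, Complex.normSq_eq_norm_sq] at h
  apply Complex.ofReal_injective
  push_cast at h ⊢
  exact h

end Grid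

/-! ### Norms on finitely many frequencies. -/

section FiniteL2

/-- The `ℓ²` norm of a sequence over a finite set of frequencies. -/
noncomputable def l2 (s : Finset ℤ) (f : ℤ → ℂ) : ℝ := Real.sqrt (∑ l ∈ s, ‖f l‖ ^ 2)

lemma l2_nonneg (s : Finset ℤ) (f : ℤ → ℂ) : 0 ≤ l2 s f := Real.sqrt_nonneg _

lemma l2_sq (s : Finset ℤ) (f : ℤ → ℂ) : l2 s f ^ 2 = ∑ l ∈ s, ‖f l‖ ^ 2 :=
  Real.sq_sqrt (Finset.sum_nonneg fun _ _ => by positivity)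

/-- The restriction of a sequence to a finite set, as a vector of a Euclidean space. -/
noncomputable def toE (s : Finset ℤ) (f : ℤ → ℂ) : EuclideanSpace ℂ s := WithLp.toLp 2 fun l => f l

lemma norm_toE (s : Finset ℤ) (f : ℤ → ℂ) : ‖toE s f‖ = l2 s f := by
  rw [EuclideanSpace.norm_eq, l2]
  congr 1
  exact Finset.sum_coe_sort s fun l => ‖f l‖ ^ 2

lemma l2_add_le (s : Finset ℤ) (f g : ℤ → ℂ) : l2 s (fun l => f l + g l) ≤ l2 s f + l2 s g := by
  simp only [← norm_toE]
  exact norm_add_le (toE s f) (toE s g)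

lemma l2_sum_le {ι : Type*} (s : Finset ℤ) (t : Finset ι) (f : ι → ℤ → ℂ) :
    l2 s (fun l => ∑ i ∈ t, f i l) ≤ ∑ i ∈ t, l2 s (f i) := by
  classical
  induction t using Finset.induction_on with
  | empty => simp [l2]
  | insert i t hi ih =>
    simp only [Finset.sum_insert hi]
    exact (l2_add_le s _ _).trans (by gcongr)

lemma l2_mono {s : Finset ℤ} {f g : ℤ → ℂ} (h : ∀ l ∈ s, ‖f l‖ ≤ ‖g l‖) : l2 s f ≤ l2 s g := by
  refine Real.sqrt_le_sqrt (Finset.sum_le_sum fun l hl => ?_)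
  have := h l hl
  gcongr

lemma l2_congr {s : Finset ℤ} {f g : ℤ → ℂ} (h : ∀ l ∈ s, ‖f l‖ = ‖g l‖) : l2 s f = l2 s g :=
  le_antisymm (l2_mono fun l hl => (h l hl).le) (l2_mono fun l hl => (h l hl).ge)

lemma l2_const_mul (s : Finset ℤ) (c : ℂ) (f : ℤ → ℂ) :
    l2 s (fun l => c * f l) = ‖c‖ * l2 s f := by
  simp only [l2, norm_mul, mul_pow, ← Finset.mul_sum]
  rw [Real.sqrt_mul (by positivity), Real.sqrt_sq (norm_nonneg c)]

lemma l2_le_of_sq_le {s : Finset ℤ} {f : ℤ → ℂ} {X : ℝ} (hX : 0 ≤ X)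
    (h : ∑ l ∈ s, ‖f l‖ ^ 2 ≤ X ^ 2) : l2 s f ≤ X :=
  Real.sqrt_le_iff.2 ⟨hX, h⟩

lemma l2_le_of_le_inv_delta {a b : ℝ} (hab : a < b) {s : Finset ℤ} {f : ℤ → ℂ} {X : ℝ} (hX : 0 ≤ X)
    (h : ∀ l ∈ s, ‖f l‖ ≤ X * (delta a b l)⁻¹) : l2 s f ≤ X * Real.sqrt (deltaSum a b) := by
  refine l2_le_of_sq_le (by positivity) ?_
  rw [mul_pow, Real.sq_sqrt (deltaSum_nonneg a b)]
  calc ∑ l ∈ s, ‖f l‖ ^ 2 ≤ ∑ l ∈ s, X ^ 2 * (delta a b l ^ 2)⁻¹ := by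
        refine Finset.sum_le_sum fun l hl => ?_
        rw [← inv_pow, ← mul_pow]
        have := h l hl
        gcongr
    _ ≤ _ := by
        rw [← Finset.mul_sum]
        exact mul_le_mul_of_nonneg_left (sum_inv_delta_sq_le hab s) (by positivity)

/-- Cauchy--Schwarz: `∑ |f_l| ≤ (∑ δ_l⁻²)^{1/2} (∑ δ_l² |f_l|²)^{1/2}`. -/
lemma sum_norm_le {a b : ℝ} (hab : a < b) (s : Finset ℤ) (f : ℤ → ℂ) :
    ∑ l ∈ s, ‖f l‖ ≤
      Real.sqrt (deltaSum a b) * l2 s (fun l => ((delta a b l : ℝ) : ℂ) * f l) := by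
  have h := Finset.sum_mul_sq_le_sq_mul_sq s (fun l => (delta a b l)⁻¹)
    (fun l => delta a b l * ‖f l‖)
  refine abs_le_of_sq_le_sq' ?_ (mul_nonneg (Real.sqrt_nonneg _) (l2_nonneg _ _)) |>.2
  rw [mul_pow, Real.sq_sqrt (deltaSum_nonneg a b), l2_sq]
  have h1 : ∀ l, (delta a b l)⁻¹ * (delta a b l * ‖f l‖) = ‖f l‖ := fun l => by
    rw [← mul_assoc, inv_mul_cancel₀ (delta_pos a b l).ne', one_mul]
  simp only [h1] at h
  refine h.trans (mul_le_mul ?_ (le_of_eq ?_) (by positivity) (deltaSum_nonneg a b))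
  · simp only [inv_pow]
    exact sum_inv_delta_sq_le hab s
  · refine Finset.sum_congr rfl fun l _ => ?_
    rw [norm_mul, Complex.norm_of_nonneg (delta_pos a b l).le]

end FiniteL2

/-! ### The cubic nonlinearity in Fourier space. -/

section Cubic
variable {a b : ℝ}

lemma norm_cube_sub_le {x y : ℂ} {A : ℝ} (hx : ‖x‖ ≤ A) (hy : ‖y‖ ≤ A) :
    ‖x ^ 3 - y ^ 3‖ ≤ 3 * A ^ 2 * ‖x - y‖ := by
  have hA : 0 ≤ A := (norm_nonneg x).trans hx
  have h : x ^ 3 - y ^ 3 = (x * x + x * y + y * y) * (x - y) := by ring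
  rw [h, norm_mul]
  refine mul_le_mul_of_nonneg_right ?_ (norm_nonneg _)
  refine (norm_add₃_le).trans ?_
  simp only [norm_mul]
  have h1 := mul_le_mul hx hx (norm_nonneg _) hA
  have h2 := mul_le_mul hx hy (norm_nonneg _) hA
  have h3 := mul_le_mul hy hy (norm_nonneg _) hA
  nlinarith

/-- Parseval moves the difference to L²(a,b), where the pointwise Lipschitz bound for the cube
applies; no convolution estimate is needed. -/
lemma l2_fcoeff_cube_sub_le (hab : a < b) {u w : ℝ → ℂ} (hu : ContinuousOn u (Set.Icc a b))
    (hw : ContinuousOn w (Set.Icc a b)) {A X : ℝ} (hX : 0 ≤ X)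
    (huA : ∀ x ∈ Set.Icc a b, ‖u x‖ ≤ A) (hwA : ∀ x ∈ Set.Icc a b, ‖w x‖ ≤ A)
    (h : ∑' l, ‖fcoeff a b u l - fcoeff a b w l‖ ^ 2 ≤ X ^ 2) (s : Finset ℤ) :
    l2 s (fun l => fcoeff a b (fun x => u x ^ 3) l - fcoeff a b (fun x => w x ^ 3) l) ≤
      3 * A ^ 2 * X := by
  refine l2_le_of_sq_le (by positivity) ?_
  have hu3 : ContinuousOn (fun x => u x ^ 3) (Set.Icc a b) := hu.pow 3
  have hw3 : ContinuousOn (fun x => w x ^ 3) (Set.Icc a b) := hw.pow 3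
  have h1 := hasSum_sq_fcoeff hab (f := fun x => u x ^ 3 - w x ^ 3) (hu3.sub hw3)
  have h2 := hasSum_sq_fcoeff hab (f := fun x => u x - w x) (hu.sub hw)
  simp only [fcoeff_sub hab hu3 hw3] at h1
  simp only [fcoeff_sub hab hu hw] at h2
  refine (sum_le_hasSum s (fun _ _ => by positivity) h1).trans ?_
  rw [h2.tsum_eq] at h
  have hb : 0 < b - a := sub_pos.2 hab
  rw [mul_pow]
  refine le_trans ?_ (mul_le_mul_of_nonneg_left h (sq_nonneg (3 * A ^ 2)))
  rw [mul_left_comm, ← intervalIntegral.integral_const_mul ((3 * A ^ 2) ^ 2)]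
  refine mul_le_mul_of_nonneg_left ?_ (by positivity)
  refine intervalIntegral.integral_mono_on hab.le ?_ ?_ fun x hx => ?_
  · refine ContinuousOn.intervalIntegrable ?_
    rw [Set.uIcc_of_le hab.le]
    exact (hu3.sub hw3).norm.pow 2
  · refine ContinuousOn.intervalIntegrable ?_
    rw [Set.uIcc_of_le hab.le]
    exact continuousOn_const.mul ((hu.sub hw).norm.pow 2)
  · rw [← mul_pow]
    have := norm_cube_sub_le (huA x hx) (hwA x hx)
    gcongr

variable {ι : Type*}

lemma cube_sum_mode (s : Finset ι) (c : ι → ℂ) (f : ι → ℤ) (x : ℝ) :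
    (∑ i ∈ s, c i * mode a b (f i) x) ^ 3 =
      ∑ r ∈ s ×ˢ s ×ˢ s, c r.1 * c r.2.1 * c r.2.2 *
        mode a b (f r.1 + f r.2.1 + f r.2.2) x := by
  rw [pow_three, Finset.sum_mul_sum, ← Finset.sum_product', Finset.sum_mul_sum,
    ← Finset.sum_product']
  refine Finset.sum_congr rfl fun r _ => ?_
  rw [mode_add, mode_add]
  ring

lemma fcoeff_cube_sum_mode (hab : a < b) (s : Finset ι) (c : ι → ℂ) (f : ι → ℤ) (l : ℤ) :
    fcoeff a b (fun x => (∑ i ∈ s, c i * mode a b (f i) x) ^ 3) l =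
      ∑ r ∈ s ×ˢ s ×ˢ s, if f r.1 + f r.2.1 + f r.2.2 = l then c r.1 * c r.2.1 * c r.2.2 else 0 := by
  simp only [cube_sum_mode]
  exact fcoeff_sum_mode hab (s ×ˢ s ×ˢ s) (fun r => c r.1 * c r.2.1 * c r.2.2)
    (fun r => f r.1 + f r.2.1 + f r.2.2) l

/-- There is no aliasing: three frequencies below N/6 in modulus add up to one below N/2, which is a
grid frequency. -/
lemma dcoeff_cube_sum_mode {N : ℕ} (hab : a < b) (hN : 0 < N) (hN2 : Even N) (s : Finset ι)
    (c : ι → ℂ) (f : ι → ℤ) (hf : ∀ i ∈ s, 6 * |f i| < N) {l : ℤ} (hl : l ∈ freqs N) :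
    dcoeff a b N (fun j => (∑ i ∈ s, c i * mode a b (f i) (grid a b N j)) ^ 3) l =
      fcoeff a b (fun x => (∑ i ∈ s, c i * mode a b (f i) x) ^ 3) l := by
  rw [fcoeff_cube_sum_mode hab]
  simp only [cube_sum_mode]
  rw [dcoeff_sum_mode hab hN (s ×ˢ s ×ˢ s) (fun r => c r.1 * c r.2.1 * c r.2.2)
    (fun r => f r.1 + f r.2.1 + f r.2.2) l]
  refine Finset.sum_congr rfl fun r hr => if_congr (dvd_sub_iff_of_mem_freqs hN2 ?_ hl) rfl rfl
  simp only [Finset.mem_product] at hr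
  have h1 := hf _ hr.1
  have h2 := hf _ hr.2.1
  have h3 := hf _ hr.2.2
  obtain ⟨m, rfl⟩ := hN2
  have h4 := abs_lt.1 (show |f r.1| < (m : ℤ) from by push_cast at h1; omega)
  rw [freqs, Finset.mem_Ico]
  have e1 := le_abs_self (f r.1)
  have e2 := le_abs_self (f r.2.1)
  have e3 := le_abs_self (f r.2.2)
  have e4 := neg_abs_le (f r.1)
  have e5 := neg_abs_le (f r.2.1)
  have e6 := neg_abs_le (f r.2.2)
  push_cast at h1 h2 h3 ⊢
  omega

lemma sum_comp_le (hab : a < b) {s : Finset ι} {f : ι → ℤ} {n : ℕ}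
    (hc : ∀ k, (s.filter fun i => f i = k).card ≤ n) :
    ∑ i ∈ s, (delta a b (f i) ^ 2)⁻¹ ≤ n * deltaSum a b := by
  rw [Finset.sum_comp (fun k => (delta a b k ^ 2)⁻¹) f]
  calc _ ≤ ∑ k ∈ s.image f, (n : ℝ) * (delta a b k ^ 2)⁻¹ := by
        refine Finset.sum_le_sum fun k _ => ?_
        rw [nsmul_eq_mul]
        have : ((s.filter fun i => f i = k).card : ℝ) ≤ n := by exact_mod_cast hc k
        exact mul_le_mul_of_nonneg_right this (by positivity)
    _ ≤ _ := by
        rw [← Finset.mul_sum]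
        exact mul_le_mul_of_nonneg_left (sum_inv_delta_sq_le hab _) (by positivity)

/-- Two of the frequencies and the sum determine the third, so at most n indices remain for the free
summation. -/
lemma sum_sum_sum_ite_le {s : Finset ι} {f : ι → ℤ} {n : ℕ}
    (hc : ∀ k, (s.filter fun i => f i = k).card ≤ n) {g : ι → ℝ} (hg : ∀ i, 0 ≤ g i) (l : ℤ) :
    ∑ i ∈ s, ∑ j ∈ s, ∑ k ∈ s, (if f i + f j + f k = l then g i * g j else 0) ≤
      n * (∑ i ∈ s, g i) ^ 2 := by
  rw [sq, Finset.sum_mul_sum, Finset.mul_sum]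
  refine Finset.sum_le_sum fun i _ => ?_
  rw [Finset.mul_sum]
  refine Finset.sum_le_sum fun j _ => ?_
  rw [← Finset.sum_filter, Finset.sum_const, nsmul_eq_mul]
  refine mul_le_mul_of_nonneg_right ?_ (mul_nonneg (hg i) (hg j))
  have h := hc (l - f i - f j)
  have h2 : (s.filter fun k => f i + f j + f k = l) = s.filter fun k => f k = l - f i - f j := by
    ext k
    simp only [Finset.mem_filter]
    constructor <;> rintro ⟨h1, h2⟩ <;> exact ⟨h1, by omega⟩
  rw [h2]
  exact_mod_cast h

/-- The weight `(δ_i+δ_j+δ_k)² / (δ_i δ_j δ_k)²` of a triple of frequencies. -/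
noncomputable def tripleWeight (a b : ℝ) (i j k : ℤ) : ℝ :=
  (delta a b i + delta a b j + delta a b k) ^ 2 *
    ((delta a b i ^ 2)⁻¹ * (delta a b j ^ 2)⁻¹ * (delta a b k ^ 2)⁻¹)

/-- The square of the sum is at most three times the sum of squares, and each square cancels one of
the three decay factors. -/
lemma tripleWeight_le (a b : ℝ) (i j k : ℤ) :
    tripleWeight a b i j k ≤ 3 * ((delta a b i ^ 2)⁻¹ * (delta a b j ^ 2)⁻¹ +
      (delta a b i ^ 2)⁻¹ * (delta a b k ^ 2)⁻¹ + (delta a b j ^ 2)⁻¹ * (delta a b k ^ 2)⁻¹) := by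
  have hi := delta_pos a b i
  have hj := delta_pos a b j
  have hk := delta_pos a b k
  rw [tripleWeight]
  calc _ ≤ 3 * (delta a b i ^ 2 + delta a b j ^ 2 + delta a b k ^ 2) *
        ((delta a b i ^ 2)⁻¹ * (delta a b j ^ 2)⁻¹ * (delta a b k ^ 2)⁻¹) := by
        refine mul_le_mul_of_nonneg_right ?_ (by positivity)
        nlinarith [sq_nonneg (delta a b i - delta a b j), sq_nonneg (delta a b i - delta a b k),
          sq_nonneg (delta a b j - delta a b k)]
    _ = _ := by field_simp; ring

/-- The factor 9 is 3 from `tripleWeight_le` times 3 pairs, which contribute equally by symmetry.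
The number n bounds the multiplicity of a frequency: 1 for a Fourier sum, 2 for waves with both
signs of the time frequency. -/
lemma sum_tripleWeight_le (hab : a < b) {s : Finset ι} {f : ι → ℤ} {n : ℕ}
    (hc : ∀ k, (s.filter fun i => f i = k).card ≤ n) (l : ℤ) :
    ∑ r ∈ s ×ˢ s ×ˢ s, (if f r.1 + f r.2.1 + f r.2.2 = l then
      tripleWeight a b (f r.1) (f r.2.1) (f r.2.2) else 0) ≤ 9 * n ^ 3 * deltaSum a b ^ 2 := by
  set g : ι → ℝ := fun i => (delta a b (f i) ^ 2)⁻¹ with hg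
  have hg0 : ∀ i, 0 ≤ g i := fun i => by positivity
  have hS : (n : ℝ) * (∑ i ∈ s, g i) ^ 2 ≤ n ^ 3 * deltaSum a b ^ 2 := by
    have h1 := sum_comp_le hab hc
    have h2 : 0 ≤ ∑ i ∈ s, g i := Finset.sum_nonneg fun i _ => hg0 i
    calc (n : ℝ) * (∑ i ∈ s, g i) ^ 2 ≤ n * (n * deltaSum a b) ^ 2 := by gcongr
      _ = _ := by ring
  have h12 := sum_sum_sum_ite_le hc hg0 l
  have h13 : ∑ i ∈ s, ∑ j ∈ s, ∑ k ∈ s, (if f i + f j + f k = l then g i * g k else 0) ≤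
      n * (∑ i ∈ s, g i) ^ 2 := by
    refine le_trans (le_of_eq ?_) h12
    refine Finset.sum_congr rfl fun i _ => ?_
    rw [Finset.sum_comm]
    refine Finset.sum_congr rfl fun j _ => Finset.sum_congr rfl fun k _ => if_congr ?_ rfl rfl
    constructor <;> intro h <;> omega
  have h23 : ∑ i ∈ s, ∑ j ∈ s, ∑ k ∈ s, (if f i + f j + f k = l then g j * g k else 0) ≤
      n * (∑ i ∈ s, g i) ^ 2 := by
    refine le_trans (le_of_eq ?_) h12
    rw [Finset.sum_comm]
    refine Finset.sum_congr rfl fun i _ => ?_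
    rw [Finset.sum_comm]
    refine Finset.sum_congr rfl fun j _ => Finset.sum_congr rfl fun k _ => if_congr ?_ rfl rfl
    constructor <;> intro h <;> omega
  rw [Finset.sum_product]
  simp only [Finset.sum_product]
  calc _ ≤ ∑ i ∈ s, ∑ j ∈ s, ∑ k ∈ s, 3 * ((if f i + f j + f k = l then g i * g j else 0) +
        (if f i + f j + f k = l then g i * g k else 0) +
        (if f i + f j + f k = l then g j * g k else 0)) := by
        refine Finset.sum_le_sum fun i _ => Finset.sum_le_sum fun j _ =>
          Finset.sum_le_sum fun k _ => ?_
        split_ifs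
        · exact tripleWeight_le a b _ _ _
        · simp
    _ ≤ _ := by
        simp only [← Finset.mul_sum, Finset.sum_add_distrib]
        linarith

/-- The sum of the three input weights dominates δ_l. Inserting the square of this ratio, which is
at least one, extracts δ_l⁻² and leaves `tripleWeight`. So cubing preserves the decay δ⁻². -/
lemma norm_fcoeff_cube_sum_mode_le (hab : a < b) {s : Finset ι} {f : ι → ℤ} {n : ℕ}
    (hc : ∀ k, (s.filter fun i => f i = k).card ≤ n) {c : ι → ℂ} {A : ℝ}
    (hA : ∀ i ∈ s, ‖c i‖ ≤ A * (delta a b (f i) ^ 2)⁻¹) (hA0 : 0 ≤ A) (l : ℤ) :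
    ‖fcoeff a b (fun x => (∑ i ∈ s, c i * mode a b (f i) x) ^ 3) l‖ ≤
      9 * n ^ 3 * deltaSum a b ^ 2 * A ^ 3 * (delta a b l ^ 2)⁻¹ := by
  rw [fcoeff_cube_sum_mode hab]
  have hl := delta_pos a b l
  calc _ ≤ ∑ r ∈ s ×ˢ s ×ˢ s, ‖if f r.1 + f r.2.1 + f r.2.2 = l then
          c r.1 * c r.2.1 * c r.2.2 else 0‖ := norm_sum_le _ _
    _ ≤ ∑ r ∈ s ×ˢ s ×ˢ s, A ^ 3 * (delta a b l ^ 2)⁻¹ *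
        (if f r.1 + f r.2.1 + f r.2.2 = l then
          tripleWeight a b (f r.1) (f r.2.1) (f r.2.2) else 0) := by
        refine Finset.sum_le_sum fun r hr => ?_
        simp only [Finset.mem_product] at hr
        split_ifs with h
        · have h1 := hA _ hr.1
          have h2 := hA _ hr.2.1
          have h3 := hA _ hr.2.2
          have h4 := delta_add_three_le a b (f r.1) (f r.2.1) (f r.2.2)
          rw [h] at h4
          rw [norm_mul, norm_mul, tripleWeight]
          have h5 : 1 ≤ (delta a b l ^ 2)⁻¹ *
              (delta a b (f r.1) + delta a b (f r.2.1) + delta a b (f r.2.2)) ^ 2 := by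
            rw [inv_mul_eq_div, one_le_div (by positivity)]
            gcongr
          calc _ ≤ (A * (delta a b (f r.1) ^ 2)⁻¹) * (A * (delta a b (f r.2.1) ^ 2)⁻¹) *
                (A * (delta a b (f r.2.2) ^ 2)⁻¹) := by gcongr
            _ = 1 * (A ^ 3 * ((delta a b (f r.1) ^ 2)⁻¹ * (delta a b (f r.2.1) ^ 2)⁻¹ *
                (delta a b (f r.2.2) ^ 2)⁻¹)) := by ring
            _ ≤ _ := mul_le_mul_of_nonneg_right h5 (by positivity)
            _ = _ := by ring
        · simp
    _ ≤ _ := by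
        rw [← Finset.mul_sum]
        refine (mul_le_mul_of_nonneg_left (sum_tripleWeight_le hab hc l) (by positivity)).trans
          (le_of_eq (by ring))

end Cubic

/-! ### Midpoint quadrature of exponentials and its cancellation over many steps. -/

section Oscillation

/-- The unimodular number `e^{ix}`. -/
noncomputable def cis (x : ℝ) : ℂ := Complex.exp (Complex.I * (x : ℂ))

lemma norm_cis (x : ℝ) : ‖cis x‖ = 1 := by
  rw [cis, mul_comm, Complex.norm_exp_ofReal_mul_I]

lemma cis_add (x y : ℝ) : cis (x + y) = cis x * cis y := by
  rw [cis, cis, cis, ← Complex.exp_add]; congr 1; push_cast; ring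

lemma cis_zero : cis 0 = 1 := by simp [cis]

lemma cis_neg_mul_cis (x : ℝ) : cis (-x) * cis x = 1 := by
  rw [← cis_add, neg_add_cancel, cis_zero]

lemma conj_cis (x : ℝ) : (starRingEnd ℂ) (cis x) = cis (-x) := by
  rw [cis, cis, ← Complex.exp_conj]; simp

lemma cis_nat_mul (n : ℕ) (x : ℝ) : cis (n * x) = cis x ^ n := by
  rw [cis, cis, ← Complex.exp_nat_mul]; congr 1; push_cast; ring

lemma continuous_cis : Continuous cis := by unfold cis; fun_prop

lemma hasDerivAt_cis_mul (c t : ℝ) :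
    HasDerivAt (fun t : ℝ => cis (c * t)) (Complex.I * c * cis (c * t)) t := by
  have h := ((((hasDerivAt_id t).const_mul c).ofReal_comp).const_mul Complex.I).cexp
  simp only [id, mul_one] at h
  rw [mul_comm] at h
  exact h

/-- The integral `∫₀ˢ e^{iΩr} dr`. -/
noncomputable def oscInt (Ω s : ℝ) : ℂ := ∫ r in (0 : ℝ)..s, cis (Ω * r)

lemma hasDerivAt_oscInt (Ω s : ℝ) : HasDerivAt (oscInt Ω) (cis (Ω * s)) s := by
  have hc : Continuous fun r : ℝ => cis (Ω * r) := continuous_cis.comp (by fun_prop)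
  exact intervalIntegral.integral_hasDerivAt_right (hc.intervalIntegrable _ _)
    (hc.stronglyMeasurableAtFilter _ _) hc.continuousAt

lemma oscInt_zero (Ω : ℝ) : oscInt Ω 0 = 0 := by simp [oscInt]

/-- The error of the midpoint rule on `[0,τ]` for the function `e^{iΩr}`. -/
noncomputable def quadErr (Ω τ : ℝ) : ℂ := oscInt Ω τ - τ * cis (Ω * (τ / 2))

lemma cis_sub_cis_neg (x : ℝ) : cis x - cis (-x) = 2 * Complex.I * (Real.sin x : ℂ) := by
  rw [cis, cis, Complex.ofReal_neg, mul_comm Complex.I, mul_comm Complex.I, Complex.exp_mul_I,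
    Complex.exp_mul_I, Complex.cos_neg, Complex.sin_neg, Complex.ofReal_sin]
  ring

lemma I_mul_oscInt (Ω s : ℝ) : Complex.I * Ω * oscInt Ω s = cis (Ω * s) - 1 := by
  have hc : Continuous fun r : ℝ => Complex.I * Ω * cis (Ω * r) :=
    continuous_const.mul (continuous_cis.comp (by fun_prop))
  rw [oscInt, ← intervalIntegral.integral_const_mul,
    intervalIntegral.integral_eq_sub_of_hasDerivAt (fun t _ => hasDerivAt_cis_mul Ω t)
      (hc.intervalIntegrable _ _), mul_zero, cis_zero]

/-- With θ = Ωτ/2 the exact integral is τ e^{iθ} sin θ / θ and the midpoint value is τ e^{iθ}. The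
product form avoids dividing by θ = 0. -/
lemma norm_quadErr_mul (Ω : ℝ) {τ : ℝ} (hτ : 0 ≤ τ) :
    ‖quadErr Ω τ‖ * |Ω * τ / 2| = τ * |Real.sin (Ω * τ / 2) - Ω * τ / 2| := by
  set θ := Ω * τ / 2 with hθ
  have h1 : Complex.I * Ω * quadErr Ω τ = cis θ * (2 * Complex.I * ((Real.sin θ - θ : ℝ) : ℂ)) := by
    rw [quadErr, mul_sub, I_mul_oscInt]
    have e1 : cis (Ω * τ) = cis θ * cis θ := by rw [← cis_add, hθ]; congr 1; ring
    have e2 : cis (Ω * (τ / 2)) = cis θ := by rw [hθ]; congr 1; ring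
    have e3 : (1 : ℂ) = cis θ * cis (-θ) := by rw [mul_comm, cis_neg_mul_cis]
    have e4 := cis_sub_cis_neg θ
    have e5 : (2 : ℂ) * θ = Ω * τ := by rw [hθ]; push_cast; ring
    rw [e1, e2]
    push_cast at e4 ⊢
    linear_combination cis θ * e4 + cis θ * Complex.I * e5 - e3
  have h2 := congrArg norm h1
  simp only [norm_mul, Complex.norm_I, norm_cis, Complex.norm_real, one_mul, Complex.norm_ofNat,
    mul_one, Real.norm_eq_abs] at h2
  have h3 : |θ| = |Ω| * τ / 2 := by rw [hθ, abs_div, abs_mul, abs_of_nonneg hτ, abs_two]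
  rw [h3]
  linear_combination τ / 2 * h2

lemma abs_sin_sub_le_cube (x : ℝ) : |Real.sin x - x| ≤ 2 * |x| ^ 3 := by
  rcases le_or_gt |x| 1 with h | h
  · have h1 := Real.sin_bound h
    have h2 : |Real.sin x - x| ≤ |Real.sin x - (x - x ^ 3 / 6)| + |x ^ 3 / 6| := by
      have := abs_add_le (Real.sin x - (x - x ^ 3 / 6)) (-(x ^ 3 / 6))
      rw [abs_neg] at this
      rwa [show Real.sin x - (x - x ^ 3 / 6) + -(x ^ 3 / 6) = Real.sin x - x by ring] at this
    rw [abs_div, abs_pow, abs_of_pos (by norm_num : (0 : ℝ) < 6)] at h2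
    have h3 : |x| ^ 5 ≤ |x| ^ 3 := pow_le_pow_of_le_one (abs_nonneg x) h (by norm_num)
    have h4 : 0 ≤ |x| ^ 3 := by positivity
    linarith
  · have h1 : |Real.sin x - x| ≤ |Real.sin x| + |x| := abs_sub _ _
    have h2 : |Real.sin x| ≤ |x| := Real.abs_sin_le_abs
    have h3 : |x| ^ 1 ≤ |x| ^ 3 := pow_le_pow_right₀ h.le (by norm_num)
    rw [pow_one] at h3
    linarith

lemma abs_sin_sub_le_sq (x : ℝ) : |Real.sin x - x| ≤ 2 * |x| ^ 2 := by
  rcases le_or_gt |x| 1 with h | h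
  · have h3 : |x| ^ 3 ≤ |x| ^ 2 := pow_le_pow_of_le_one (abs_nonneg x) h (by norm_num)
    linarith [abs_sin_sub_le_cube x]
  · have h1 : |Real.sin x - x| ≤ |Real.sin x| + |x| := abs_sub _ _
    have h2 : |Real.sin x| ≤ |x| := Real.abs_sin_le_abs
    have h3 : |x| ^ 1 ≤ |x| ^ 2 := pow_le_pow_right₀ h.le (by norm_num)
    rw [pow_one] at h3
    linarith

/-- Only one power of Ω is spent, at the price of one order in τ, because the available decay of the
amplitudes pays for a single |Ω|. -/
lemma norm_quadErr_le (Ω : ℝ) {τ : ℝ} (hτ : 0 ≤ τ) : ‖quadErr Ω τ‖ ≤ τ ^ 2 * |Ω| := by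
  have h3 : |Ω * τ / 2| = |Ω| * τ / 2 := by rw [abs_div, abs_mul, abs_of_nonneg hτ, abs_two]
  rcases (abs_nonneg (Ω * τ / 2)).eq_or_lt with h | h
  · rw [h3] at h
    rcases mul_eq_zero.1 (by linarith : |Ω| * τ = 0) with h0 | h0
    · have h0' : Ω = 0 := abs_eq_zero.1 h0
      subst h0'
      simp [quadErr, oscInt, cis_zero]
    · subst h0
      simp [quadErr, oscInt_zero]
  · refine le_of_mul_le_mul_right ?_ h
    rw [norm_quadErr_mul Ω hτ]
    refine (mul_le_mul_of_nonneg_left (abs_sin_sub_le_sq _) hτ).trans (le_of_eq ?_)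
    rw [h3]
    ring

/-- The geometric sum has numerator at most 2 and denominator |e^{2iθ} - 1| = 2|sin θ|. -/
lemma norm_geom_cis_mul_abs_sin_le (θ : ℝ) (k : ℕ) :
    ‖∑ j ∈ Finset.range k, cis (2 * θ) ^ j‖ * |Real.sin θ| ≤ 1 := by
  have h1 := geom_sum_mul (cis (2 * θ)) k
  have h2 : cis (2 * θ) - 1 = cis θ * (2 * Complex.I * (Real.sin θ : ℂ)) := by
    rw [← cis_sub_cis_neg, mul_sub, ← cis_add, ← cis_add, add_neg_cancel, cis_zero, two_mul]
  have h3 := congrArg norm h1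
  rw [h2, norm_mul, norm_mul, norm_mul, norm_mul, norm_cis, Complex.norm_I, Complex.norm_real,
    Complex.norm_ofNat, Real.norm_eq_abs] at h3
  have h4 : ‖cis (2 * θ) ^ k - 1‖ ≤ 2 := by
    refine (norm_sub_le _ _).trans ?_
    rw [norm_pow, norm_cis, one_pow, norm_one]
    norm_num
  linarith

/-- By concavity, sine lies above its chord from 0 to απ, whose slope sin(απ)/(απ) is the witness.
It tends to 0 as α → 1, and it is through this κ that the final constant depends on α. -/
lemma exists_mul_abs_le_abs_sin {α : ℝ} (h0 : 0 < α) (h1 : α < 1) :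
    ∃ κ > 0, ∀ θ : ℝ, |θ| ≤ α * Real.pi → κ * |θ| ≤ |Real.sin θ| := by
  have hp := Real.pi_pos
  have hap : 0 < α * Real.pi := by positivity
  have hap2 : α * Real.pi < Real.pi := by nlinarith
  refine ⟨Real.sin (α * Real.pi) / (α * Real.pi),
    div_pos (Real.sin_pos_of_pos_of_lt_pi hap hap2) hap, fun θ hθ => ?_⟩
  have h2 : Real.sin (α * Real.pi) / (α * Real.pi) * |θ| ≤ Real.sin |θ| := by
    have ha : 0 ≤ 1 - |θ| / (α * Real.pi) := by rw [sub_nonneg, div_le_one hap]; exact hθ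
    have hb : 0 ≤ |θ| / (α * Real.pi) := by positivity
    have hc := strictConcaveOn_sin_Icc.concaveOn.2 (Set.left_mem_Icc.2 hp.le)
      (Set.mem_Icc.2 ⟨hap.le, hap2.le⟩) ha hb (by ring)
    simp only [smul_eq_mul, mul_zero, zero_add, Real.sin_zero, div_mul_cancel₀ _ hap.ne'] at hc
    refine le_trans (le_of_eq ?_) hc
    ring
  refine h2.trans ?_
  rcases abs_choice θ with h | h <;> rw [h]
  · exact le_abs_self _
  · rw [Real.sin_neg]; exact neg_le_abs _

/-- The bound without cancellation. It needs no condition on Ωτ and serves the bootstrap only. -/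
lemma quadErr_mul_geom_le_crude (Ω : ℝ) {τ : ℝ} (hτ : 0 ≤ τ) {k n : ℕ} (hk : k ≤ n) :
    ‖quadErr Ω τ‖ * ‖∑ j ∈ Finset.range k, cis (Ω * τ) ^ j‖ ≤ n * τ ^ 2 * |Ω| := by
  have h1 : ‖∑ j ∈ Finset.range k, cis (Ω * τ) ^ j‖ ≤ n := by
    refine (norm_sum_le _ _).trans ?_
    simp only [norm_pow, norm_cis, one_pow, Finset.sum_const, Finset.card_range, nsmul_eq_mul,
      mul_one]
    exact_mod_cast hk
  have h2 := norm_quadErr_le Ω hτ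
  calc _ ≤ τ ^ 2 * |Ω| * n := by gcongr
    _ = _ := by ring

/-- The quadrature error is at most 2τθ² and the geometric sum at most 1/(κ|θ|). The product 2τ|θ|/κ
is independent of the number of steps and linear in Ω. -/
lemma quadErr_mul_geom_le {κ : ℝ} (hκ : 0 < κ) (Ω : ℝ) {τ : ℝ} (hτ : 0 ≤ τ)
    (h : κ * |Ω * τ / 2| ≤ |Real.sin (Ω * τ / 2)|) (k : ℕ) :
    ‖quadErr Ω τ‖ * ‖∑ j ∈ Finset.range k, cis (Ω * τ) ^ j‖ ≤ κ⁻¹ * τ ^ 2 * |Ω| := by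
  set θ := Ω * τ / 2 with hθ
  have h2 : Ω * τ = 2 * θ := by rw [hθ]; ring
  have h3 : |θ| = |Ω| * τ / 2 := by rw [hθ, abs_div, abs_mul, abs_of_nonneg hτ, abs_two]
  rcases (abs_nonneg θ).eq_or_lt with h0 | h0
  · have h5 := norm_quadErr_le Ω hτ
    have h6 : τ ^ 2 * |Ω| = 0 := by
      have : |Ω| * τ = 0 := by linarith
      rw [sq, mul_assoc, mul_comm τ |Ω|, this, mul_zero]
    have h7 : ‖quadErr Ω τ‖ = 0 := le_antisymm (by linarith) (norm_nonneg _)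
    rw [h7, zero_mul]
    positivity
  · have h4 := norm_geom_cis_mul_abs_sin_le θ k
    rw [h2]
    set Z := ‖∑ j ∈ Finset.range k, cis (2 * θ) ^ j‖
    have hZ : 0 ≤ Z := norm_nonneg _
    have h5 : Z * (κ * |θ|) ≤ 1 := (mul_le_mul_of_nonneg_left h hZ).trans h4
    have h6 := norm_quadErr_mul Ω hτ
    rw [← hθ] at h6
    have h7 : ‖quadErr Ω τ‖ * |θ| ≤ τ * (2 * |θ| ^ 3) := by
      rw [h6]; exact mul_le_mul_of_nonneg_left (abs_sin_sub_le_cube θ) hτ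
    refine le_of_mul_le_mul_right ?_ (show 0 < κ * |θ| * |θ| by positivity)
    calc ‖quadErr Ω τ‖ * Z * (κ * |θ| * |θ|) = (‖quadErr Ω τ‖ * |θ|) * (Z * (κ * |θ|)) := by ring
      _ ≤ τ * (2 * |θ| ^ 3) * 1 := by gcongr
      _ = κ⁻¹ * τ ^ 2 * |Ω| * (κ * |θ| * |θ|) := by
        rw [h3]; field_simp

/-- Summation by parts. -/
lemma norm_sum_mul_le_of_partial {z P : ℕ → ℂ} {B A d : ℝ} {n : ℕ} (hB0 : 0 ≤ B)
    (hB : ∀ k ≤ n, ‖∑ j ∈ Finset.range k, z j‖ ≤ B) (hA : ‖P n‖ ≤ A)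
    (hd : ∀ k < n, ‖P (k + 1) - P k‖ ≤ d) :
    ‖∑ k ∈ Finset.range n, z k * P k‖ ≤ B * (A + n * d) := by
  have h : ∀ n, ∑ k ∈ Finset.range n, z k * P k = (∑ k ∈ Finset.range n, z k) * P n -
      ∑ k ∈ Finset.range n, (∑ j ∈ Finset.range (k + 1), z j) * (P (k + 1) - P k) := by
    intro n
    induction n with
    | zero => simp
    | succ n ih =>
      rw [Finset.sum_range_succ, ih, Finset.sum_range_succ _ n, Finset.sum_range_succ _ n]
      simp only [Finset.sum_range_succ]
      ring
  rw [h]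
  refine (norm_sub_le _ _).trans ?_
  rw [mul_add]
  refine add_le_add ?_ ?_
  · rw [norm_mul]
    exact mul_le_mul (hB n le_rfl) hA (norm_nonneg _) hB0
  · refine (norm_sum_le _ _).trans ?_
    calc _ ≤ ∑ k ∈ Finset.range n, B * d := by
          refine Finset.sum_le_sum fun k hk => ?_
          have hk' := Finset.mem_range.1 hk
          rw [norm_mul]
          exact mul_le_mul (hB _ hk') (hd k hk') (norm_nonneg _) hB0
      _ = _ := by rw [Finset.sum_const, Finset.card_range, nsmul_eq_mul]; ring

lemma norm_quadErr_mul_sum_le {Ω τ B A d : ℝ} {n : ℕ} {P : ℕ → ℂ} (hB0 : 0 ≤ B)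
    (hB : ∀ k ≤ n, ‖quadErr Ω τ‖ * ‖∑ j ∈ Finset.range k, cis (Ω * τ) ^ j‖ ≤ B)
    (hA : ‖P n‖ ≤ A) (hd : ∀ k < n, ‖P (k + 1) - P k‖ ≤ d) :
    ‖∑ k ∈ Finset.range n, quadErr Ω τ * cis (Ω * τ) ^ k * P k‖ ≤ B * (A + n * d) := by
  refine norm_sum_mul_le_of_partial hB0 (fun k hk => ?_) hA hd
  rw [← Finset.mul_sum, norm_mul]
  exact hB k hk

end Oscillation

/-! ### Fourier coefficients of real functions. -/

section RealFourier
variable {a b : ℝ}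

/-- The Fourier coefficients of a real function. -/
noncomputable def rfc (a b : ℝ) (f : ℝ → ℝ) (l : ℤ) : ℂ := fcoeff a b (fun x => (f x : ℂ)) l

lemma rfc_neg (f : ℝ → ℝ) (l : ℤ) : rfc a b f (-l) = (starRingEnd ℂ) (rfc a b f l) := by
  simp only [rfc, fcoeff_eq, map_mul, map_div₀, map_one, Complex.conj_ofReal, neg_neg]
  congr 1
  rw [intervalIntegral, intervalIntegral, map_sub, ← integral_conj, ← integral_conj]
  simp only [map_mul, Complex.conj_ofReal, conj_mode, neg_neg]

lemma mode_neg_eq (l : ℤ) (x : ℝ) : mode a b (-l) x =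
    (Real.cos (mu a b l * (x - a)) : ℂ) - Complex.I * (Real.sin (mu a b l * (x - a)) : ℂ) := by
  rw [mode, mu_neg, mul_comm Complex.I, Complex.exp_mul_I, neg_mul, Complex.ofReal_neg,
    Complex.cos_neg, Complex.sin_neg, Complex.ofReal_cos, Complex.ofReal_sin]
  ring

/-- The weak equation admits real test functions only, so the coefficients are recovered from their
cosine and sine integrals. -/
lemma rfc_eq (hab : a < b) {f : ℝ → ℝ} (hf : ContinuousOn f (Set.Icc a b)) (l : ℤ) :
    rfc a b f l = (1 / ((b - a : ℝ) : ℂ)) *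
      (((∫ x in a..b, f x * Real.cos (mu a b l * (x - a)) : ℝ) : ℂ) -
        Complex.I * ((∫ x in a..b, f x * Real.sin (mu a b l * (x - a)) : ℝ) : ℂ)) := by
  have hc : ∀ g : ℝ → ℝ, Continuous g →
      IntervalIntegrable (fun x => ((f x * g x : ℝ) : ℂ)) MeasureTheory.volume a b := by
    intro g hg
    refine ContinuousOn.intervalIntegrable ?_
    rw [Set.uIcc_of_le hab.le]
    exact Complex.continuous_ofReal.comp_continuousOn (hf.mul hg.continuousOn)
  rw [rfc, fcoeff_eq]
  congr 1
  rw [← intervalIntegral.integral_ofReal, ← intervalIntegral.integral_ofReal,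
    ← intervalIntegral.integral_const_mul, ← intervalIntegral.integral_sub]
  · refine intervalIntegral.integral_congr fun x _ => ?_
    simp only [mode_neg_eq]
    push_cast
    ring
  · exact hc _ (by fun_prop)
  · exact (hc _ (by fun_prop)).const_mul _

lemma continuousOn_ofReal {f : ℝ → ℝ} {s : Set ℝ} (hf : ContinuousOn f s) :
    ContinuousOn (fun x => (f x : ℂ)) s := Complex.continuous_ofReal.comp_continuousOn hf

end RealFourier

/-! ### Sobolev bounds on coefficients, sup bounds and the cube of a function. -/

section Sobolev
variable {a b : ℝ}

lemma normH_nonneg (s : ℕ) (f : ℝ → ℂ) : 0 ≤ normH a b s f := Real.sqrt_nonneg _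

lemma sobolev_term_eq (s : ℕ) (f : ℝ → ℂ) (l : ℤ) :
    (1 + mu a b l ^ 2) ^ s * ‖fcoeff a b f l‖ ^ 2 =
      ‖((delta a b l ^ s : ℝ) : ℂ) * fcoeff a b f l‖ ^ 2 := by
  rw [norm_mul, mul_pow, Complex.norm_of_nonneg (pow_nonneg (delta_pos a b l).le s), ← pow_mul,
    mul_comm s, pow_mul, delta_sq]

lemma tsum_le_of_normH_le {s : ℕ} {f : ℝ → ℂ} {M : ℝ} (hM : normH a b s f ≤ M) :
    ∑' l : ℤ, (1 + mu a b l ^ 2) ^ s * ‖fcoeff a b f l‖ ^ 2 ≤ M ^ 2 :=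
  (Real.sqrt_le_iff.1 hM).2

lemma l2_fcoeff_le {s : ℕ} {f : ℝ → ℂ} {M : ℝ} (h : MemH a b s f) (hM : normH a b s f ≤ M)
    (t : Finset ℤ) : l2 t (fun l => ((delta a b l ^ s : ℝ) : ℂ) * fcoeff a b f l) ≤ M := by
  refine l2_le_of_sq_le ((normH_nonneg s f).trans hM) ?_
  refine le_trans ?_ (tsum_le_of_normH_le hM)
  simp only [← sobolev_term_eq]
  exact h.2.sum_le_tsum t fun _ _ => by positivity

lemma delta_pow_mul_norm_fcoeff_le {s : ℕ} {f : ℝ → ℂ} {M : ℝ} (h : MemH a b s f)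
    (hM : normH a b s f ≤ M) (l : ℤ) : delta a b l ^ s * ‖fcoeff a b f l‖ ≤ M := by
  have h1 := l2_fcoeff_le h hM {l}
  simp only [l2, Finset.sum_singleton, Real.sqrt_sq (norm_nonneg _)] at h1
  rwa [norm_mul, Complex.norm_of_nonneg (pow_nonneg (delta_pos a b l).le s)] at h1

/-- By the arithmetic-geometric mean inequality, |f̂_l| ≤ δ_l⁻² + δ_l²|f̂_l|², and both terms are
summable when s ≥ 1. -/
lemma summable_norm_fcoeff (hab : a < b) {s : ℕ} (hs : 1 ≤ s) {f : ℝ → ℂ} (h : MemH a b s f) :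
    Summable fun l => ‖fcoeff a b f l‖ := by
  refine Summable.of_nonneg_of_le (fun _ => norm_nonneg _) (fun l => ?_)
    ((summable_inv_delta_sq hab).add h.2)
  have h1 := one_le_delta a b l
  rw [sobolev_term_eq, norm_mul, Complex.norm_of_nonneg (pow_nonneg (delta_pos a b l).le s),
    mul_pow]
  have h2 : delta a b l ^ 2 ≤ (delta a b l ^ s) ^ 2 := by
    have : delta a b l ≤ delta a b l ^ s := le_self_pow₀ h1 (by omega)
    have := delta_pos a b l
    gcongr
  have h3 : ‖fcoeff a b f l‖ ≤ (delta a b l ^ 2)⁻¹ + delta a b l ^ 2 * ‖fcoeff a b f l‖ ^ 2 := by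
    have h4 := delta_pos a b l
    have h5 : 0 ≤ ((delta a b l)⁻¹ - delta a b l * ‖fcoeff a b f l‖) ^ 2 := sq_nonneg _
    have h6 : ((delta a b l)⁻¹ - delta a b l * ‖fcoeff a b f l‖) ^ 2 =
        (delta a b l ^ 2)⁻¹ + delta a b l ^ 2 * ‖fcoeff a b f l‖ ^ 2 - 2 * ‖fcoeff a b f l‖ := by
      field_simp
      ring
    have := norm_nonneg (fcoeff a b f l)
    linarith
  have := norm_nonneg (fcoeff a b f l)
  nlinarith [sq_nonneg (‖fcoeff a b f l‖)]

lemma norm_le_of_norm_fcoeff_le (hab : a < b) {f : ℝ → ℂ} (hf : ContinuousOn f (Set.Icc a b))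
    {M : ℝ} (hM : ∀ l, ‖fcoeff a b f l‖ ≤ M * (delta a b l ^ 2)⁻¹) {x : ℝ}
    (hx : x ∈ Set.Icc a b) : ‖f x‖ ≤ M * deltaSum a b := by
  have hs : Summable fun l => M * (delta a b l ^ 2)⁻¹ := (summable_inv_delta_sq hab).mul_left M
  have hs2 : Summable fun l => ‖fcoeff a b f l‖ :=
    Summable.of_nonneg_of_le (fun _ => norm_nonneg _) hM hs
  rw [← (hasSum_fourier hab hf hs2 hx).tsum_eq, deltaSum, ← tsum_mul_left]
  refine (tsum_of_norm_bounded hs.hasSum fun l => ?_)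
  rw [norm_mul, norm_mode, mul_one]
  exact hM l

/-- If `|f̂_l| ≤ M δ_l⁻²`, then `f³` has Fourier coefficients of size `O(δ_l⁻²)` too. -/
lemma norm_fcoeff_cube_le (hab : a < b) {f : ℝ → ℂ} (hf : ContinuousOn f (Set.Icc a b))
    {M : ℝ} (hM0 : 0 ≤ M) (hM : ∀ l, ‖fcoeff a b f l‖ ≤ M * (delta a b l ^ 2)⁻¹) (l : ℤ) :
    ‖fcoeff a b (fun x => f x ^ 3) l‖ ≤ 9 * deltaSum a b ^ 2 * M ^ 3 * (delta a b l ^ 2)⁻¹ := by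
  set A := M * deltaSum a b with hA
  have hb := hasSum_sq_fcoeff hab hf
  have key : ∀ s : Finset ℤ, ‖fcoeff a b (fun x => f x ^ 3) l‖ ≤
      9 * deltaSum a b ^ 2 * M ^ 3 * (delta a b l ^ 2)⁻¹ + 3 * A ^ 2 * Real.sqrt
        (∑' k, ‖fcoeff a b f k‖ ^ 2 - ∑ k ∈ s, ‖fcoeff a b f k‖ ^ 2) := by
    intro s
    -- Replace f by its truncation to s. The finite estimate applies to w³, with bounds uniform in
    -- s, and the Lipschitz bound controls the difference by the ℓ² tail, which vanishes as s
    -- exhausts ℤ.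
    set w : ℝ → ℂ := fun x => ∑ k ∈ s, fcoeff a b f k * mode a b k x with hw
    have hwc : ContinuousOn w (Set.Icc a b) :=
      (continuous_finsetSum s fun k _ => continuous_const.mul (continuous_mode a b k)).continuousOn
    have hwA : ∀ x ∈ Set.Icc a b, ‖w x‖ ≤ A := by
      intro x _
      refine (norm_sum_le _ _).trans ?_
      calc _ ≤ ∑ k ∈ s, M * (delta a b k ^ 2)⁻¹ := by
            refine Finset.sum_le_sum fun k _ => ?_
            rw [norm_mul, norm_mode, mul_one]
            exact hM k
        _ ≤ _ := by
            rw [← Finset.mul_sum]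
            exact mul_le_mul_of_nonneg_left (sum_inv_delta_sq_le hab s) hM0
    have hwf : ∀ k, fcoeff a b w k = if k ∈ s then fcoeff a b f k else 0 := by
      intro k
      rw [hw, fcoeff_sum_mode hab s (fcoeff a b f) (fun k => k) k, Finset.sum_ite_eq' s k]
    have hX : ∑' k, ‖fcoeff a b f k - fcoeff a b w k‖ ^ 2 =
        ∑' k, ‖fcoeff a b f k‖ ^ 2 - ∑ k ∈ s, ‖fcoeff a b f k‖ ^ 2 := by
      rw [eq_sub_iff_add_eq, sum_eq_tsum_indicator, ← Summable.tsum_add]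
      · refine tsum_congr fun k => ?_
        rw [hwf]
        by_cases hk : k ∈ s <;> simp [hk]
      · refine Summable.of_nonneg_of_le (fun _ => by positivity) (fun k => ?_) hb.summable
        rw [hwf]
        split_ifs
        · rw [sub_self, norm_zero, zero_pow two_ne_zero]; positivity
        · rw [sub_zero]
      · exact hb.summable.indicator _
    have hX0 : 0 ≤ ∑' k, ‖fcoeff a b f k - fcoeff a b w k‖ ^ 2 :=
      tsum_nonneg fun _ => by positivity
    have h1 := l2_fcoeff_cube_sub_le hab hf hwc (Real.sqrt_nonneg _)
      (fun x hx => norm_le_of_norm_fcoeff_le hab hf hM hx) hwA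
      (Real.sq_sqrt hX0).ge {l}
    simp only [l2, Finset.sum_singleton, Real.sqrt_sq (norm_nonneg _)] at h1
    have h2 := norm_fcoeff_cube_sum_mode_le hab (s := s) (f := fun k => k) (n := 1)
      (c := fcoeff a b f) (A := M) (fun k => by
        rw [Finset.filter_eq' s k]
        split_ifs <;> simp) (fun k _ => hM k) hM0 l
    rw [hX] at h1
    simp only [Nat.cast_one, one_pow, mul_one] at h2
    have h3 := norm_sub_norm_le (fcoeff a b (fun x => f x ^ 3) l) (fcoeff a b (fun x => w x ^ 3) l)
    linarith
  have hlim : Filter.Tendsto (fun s : Finset ℤ =>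
      9 * deltaSum a b ^ 2 * M ^ 3 * (delta a b l ^ 2)⁻¹ + 3 * A ^ 2 * Real.sqrt
        (∑' k, ‖fcoeff a b f k‖ ^ 2 - ∑ k ∈ s, ‖fcoeff a b f k‖ ^ 2)) Filter.atTop
      (nhds (9 * deltaSum a b ^ 2 * M ^ 3 * (delta a b l ^ 2)⁻¹ + 3 * A ^ 2 * Real.sqrt
        (∑' k, ‖fcoeff a b f k‖ ^ 2 - ∑' k, ‖fcoeff a b f k‖ ^ 2))) :=
    ((hb.summable.hasSum.const_sub _).sqrt.const_mul _).const_add _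
  rw [sub_self, Real.sqrt_zero, mul_zero, add_zero] at hlim
  exact ge_of_tendsto' hlim key

end Sobolev

/-! ### The exact solution in twisted variables. -/

section Solution
variable {a b ε S M : ℝ} {m : ℕ} {u₀ u₁ : ℝ → ℝ} {u v : ℝ → ℝ → ℝ}

/-- The Fourier coefficients of `ψ = u - i⟨∇⟩⁻¹v`. -/
noncomputable def psiHat (a b : ℝ) (u v : ℝ → ℝ → ℝ) (t : ℝ) (l : ℤ) : ℂ :=
  rfc a b (u t) l - Complex.I * rfc a b (v t) l / ((delta a b l : ℝ) : ℂ)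

/-- The Fourier coefficients of the twisted variable `e^{-it⟨∇⟩}ψ(t)`. -/
noncomputable def phi (a b : ℝ) (u v : ℝ → ℝ → ℝ) (t : ℝ) (l : ℤ) : ℂ :=
  cis (-(delta a b l * t)) * psiHat a b u v t l

/-- The Fourier coefficients of `u³`. -/
noncomputable def cubeHat (a b : ℝ) (u : ℝ → ℝ → ℝ) (t : ℝ) (l : ℤ) : ℂ :=
  rfc a b (fun x => u t x ^ 3) l

lemma psiHat_eq (t : ℝ) (l : ℤ) :
    psiHat a b u v t l = cis (delta a b l * t) * phi a b u v t l := by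
  rw [phi, ← mul_assoc, ← cis_add, add_neg_cancel, cis_zero, one_mul]

lemma norm_phi (t : ℝ) (l : ℤ) : ‖phi a b u v t l‖ = ‖psiHat a b u v t l‖ := by
  rw [phi, norm_mul, norm_cis, one_mul]

lemma rfc_u_eq_psiHat (t : ℝ) (l : ℤ) : rfc a b (u t) l =
    (1 / 2) * (psiHat a b u v t l + (starRingEnd ℂ) (psiHat a b u v t (-l))) := by
  have h := delta_ne_zero a b l
  simp only [psiHat, map_sub, map_mul, map_div₀, rfc_neg, delta_neg, Complex.conj_I,
    Complex.conj_ofReal, Complex.conj_conj]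
  ring

lemma rfc_v_eq_psiHat (t : ℝ) (l : ℤ) : rfc a b (v t) l =
    (Complex.I / 2) * (((delta a b l : ℝ) : ℂ) *
      (psiHat a b u v t l - (starRingEnd ℂ) (psiHat a b u v t (-l)))) := by
  have h := delta_ne_zero a b l
  simp only [psiHat, map_sub, map_mul, map_div₀, rfc_neg, delta_neg, Complex.conj_I,
    Complex.conj_ofReal, Complex.conj_conj]
  field_simp
  linear_combination 2 * rfc a b (v t) l * Complex.I_sq

lemma rfc_u_eq_phi (t : ℝ) (l : ℤ) : rfc a b (u t) l =
    (1 / 2) * (cis (delta a b l * t) * phi a b u v t l +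
      cis (-(delta a b l * t)) * (starRingEnd ℂ) (phi a b u v t (-l))) := by
  rw [rfc_u_eq_psiHat (v := v), psiHat_eq, psiHat_eq, map_mul, conj_cis, delta_neg]

lemma continuousOn_cube {t : ℝ} (hu : ContinuousOn (u t) (Set.Icc a b)) :
    ContinuousOn (fun x => u t x ^ 3) (Set.Icc a b) := hu.pow 3

lemma contDiff_cos_test (l : ℤ) : ContDiff ℝ ∞ fun x => Real.cos (mu a b l * (x - a)) := by
  fun_prop

lemma contDiff_sin_test (l : ℤ) : ContDiff ℝ ∞ fun x => Real.sin (mu a b l * (x - a)) := by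
  fun_prop

lemma periodic_cos_test (hab : a < b) (l : ℤ) :
    Function.Periodic (fun x => Real.cos (mu a b l * (x - a))) (b - a) := by
  intro x
  have hb : b - a ≠ 0 := (sub_pos.2 hab).ne'
  have : mu a b l * (x + (b - a) - a) = mu a b l * (x - a) + l * (2 * Real.pi) := by
    simp only [mu]; field_simp; ring
  simp only [this]
  exact Real.cos_add_int_mul_two_pi _ _

lemma periodic_sin_test (hab : a < b) (l : ℤ) :
    Function.Periodic (fun x => Real.sin (mu a b l * (x - a))) (b - a) := by
  intro x
  have hb : b - a ≠ 0 := (sub_pos.2 hab).ne'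
  have : mu a b l * (x + (b - a) - a) = mu a b l * (x - a) + l * (2 * Real.pi) := by
    simp only [mu]; field_simp; ring
  simp only [this]
  exact Real.sin_add_int_mul_two_pi _ _

lemma deriv_deriv_cos_test (c a x : ℝ) :
    deriv (deriv fun x => Real.cos (c * (x - a))) x = -(c ^ 2 * Real.cos (c * (x - a))) := by
  have h1 : deriv (fun x => Real.cos (c * (x - a))) = fun x => -(c * Real.sin (c * (x - a))) := by
    ext x
    have := (((hasDerivAt_id x).sub_const a).const_mul c).cos
    simp only [id, mul_one] at this
    rw [this.deriv]; ring
  rw [h1]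
  have := (((((hasDerivAt_id x).sub_const a).const_mul c).sin).const_mul c).neg
  simp only [id, mul_one] at this
  exact this.deriv.trans (by ring)

lemma deriv_deriv_sin_test (c a x : ℝ) :
    deriv (deriv fun x => Real.sin (c * (x - a))) x = -(c ^ 2 * Real.sin (c * (x - a))) := by
  have h1 : deriv (fun x => Real.sin (c * (x - a))) = fun x => c * Real.cos (c * (x - a)) := by
    ext x
    have := (((hasDerivAt_id x).sub_const a).const_mul c).sin
    simp only [id, mul_one] at this
    rw [this.deriv]; ring
  rw [h1]
  have := ((((hasDerivAt_id x).sub_const a).const_mul c).cos).const_mul c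
  simp only [id, mul_one] at this
  exact this.deriv.trans (by ring)

lemma hasDerivWithinAt_rfc (hab : a < b) {w : ℝ → ℝ → ℝ} {s : Set ℝ} {l : ℤ} {C D t : ℝ}
    (ht : t ∈ s) (hw : ∀ t ∈ s, ContinuousOn (w t) (Set.Icc a b))
    (hC : HasDerivWithinAt (fun t => ∫ x in a..b, w t x * Real.cos (mu a b l * (x - a))) C s t)
    (hD : HasDerivWithinAt (fun t => ∫ x in a..b, w t x * Real.sin (mu a b l * (x - a))) D s t) :
    HasDerivWithinAt (fun t => rfc a b (w t) l)
      ((1 / ((b - a : ℝ) : ℂ)) * ((C : ℂ) - Complex.I * (D : ℂ))) s t := by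
  have h := (hC.ofReal_comp.sub (hD.ofReal_comp.const_mul Complex.I)).const_mul
    (1 / ((b - a : ℝ) : ℂ))
  exact h.congr (fun t ht => rfc_eq hab (hw t ht) l) (rfc_eq hab (hw t ht) l)

lemma hasDerivWithinAt_rfc_u (hab : a < b) (hsol : IsSolution a b ε S u₀ u₁ u v) {t : ℝ}
    (ht : t ∈ Set.Icc 0 S) (l : ℤ) :
    HasDerivWithinAt (fun t => rfc a b (u t) l) (rfc a b (v t) l) (Set.Icc 0 S) t := by
  have h := hasDerivWithinAt_rfc hab ht hsol.continuous_u
    (hsol.deriv_u _ (contDiff_cos_test l) (periodic_cos_test hab l) t ht)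
    (hsol.deriv_u _ (contDiff_sin_test l) (periodic_sin_test hab l) t ht)
  rwa [← rfc_eq hab (hsol.continuous_v t ht)] at h

lemma integral_test_eq (hab : a < b) {f g φ : ℝ → ℝ} {c e : ℝ} (hf : ContinuousOn f (Set.Icc a b))
    (hg : ContinuousOn g (Set.Icc a b)) (hφ : Continuous φ)
    (h : ∀ x, deriv (deriv φ) x = -(c ^ 2 * φ x)) :
    ∫ x in a..b, (f x * deriv (deriv φ) x - f x * φ x - e * g x * φ x) =
      -(1 + c ^ 2) * (∫ x in a..b, f x * φ x) - e * ∫ x in a..b, g x * φ x := by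
  have hi : ∀ f : ℝ → ℝ, ContinuousOn f (Set.Icc a b) →
      IntervalIntegrable (fun x => f x * φ x) MeasureTheory.volume a b := by
    intro f hf
    refine ContinuousOn.intervalIntegrable ?_
    rw [Set.uIcc_of_le hab.le]
    exact hf.mul hφ.continuousOn
  rw [← intervalIntegral.integral_const_mul, ← intervalIntegral.integral_const_mul,
    ← intervalIntegral.integral_sub ((hi f hf).const_mul _) ((hi g hg).const_mul _)]
  refine intervalIntegral.integral_congr fun x _ => ?_
  simp only [h]
  ring

/-- The tests are eigenfunctions of the second derivative with eigenvalue -μ_l², so the weak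
equation closes to an ordinary differential equation for each coefficient, with 1 + μ_l² = δ_l². -/
lemma hasDerivWithinAt_rfc_v (hab : a < b) (hsol : IsSolution a b ε S u₀ u₁ u v) {t : ℝ}
    (ht : t ∈ Set.Icc 0 S) (l : ℤ) :
    HasDerivWithinAt (fun t => rfc a b (v t) l)
      (-((delta a b l : ℝ) : ℂ) ^ 2 * rfc a b (u t) l - (ε : ℂ) ^ 2 * cubeHat a b u t l)
      (Set.Icc 0 S) t := by
  have hu := hsol.continuous_u t ht
  have hu3 := continuousOn_cube hu
  have h1 := hsol.deriv_v _ (contDiff_cos_test l) (periodic_cos_test hab l) t ht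
  have h2 := hsol.deriv_v _ (contDiff_sin_test l) (periodic_sin_test hab l) t ht
  rw [integral_test_eq hab hu hu3 (contDiff_cos_test l).continuous
    (deriv_deriv_cos_test (mu a b l) a)] at h1
  rw [integral_test_eq hab hu hu3 (contDiff_sin_test l).continuous
    (deriv_deriv_sin_test (mu a b l) a)] at h2
  have h := hasDerivWithinAt_rfc hab ht hsol.continuous_v h1 h2
  convert h using 1
  rw [rfc_eq hab hu, cubeHat, rfc_eq hab hu3]
  have hd : ((delta a b l : ℝ) : ℂ) ^ 2 = 1 + (mu a b l : ℂ) ^ 2 := by exact_mod_cast delta_sq a b l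
  rw [hd]
  push_cast
  ring

/-- The twist removes the linear flow. What remains is of size ε² and has gained a factor δ_l⁻¹. -/
lemma hasDerivWithinAt_phi (hab : a < b) (hsol : IsSolution a b ε S u₀ u₁ u v) {t : ℝ}
    (ht : t ∈ Set.Icc 0 S) (l : ℤ) :
    HasDerivWithinAt (fun t => phi a b u v t l)
      (Complex.I * (ε : ℂ) ^ 2 / ((delta a b l : ℝ) : ℂ) *
        (cis (-(delta a b l * t)) * cubeHat a b u t l)) (Set.Icc 0 S) t := by
  have hd := delta_ne_zero a b l
  have h1 := hasDerivWithinAt_rfc_u hab hsol ht l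
  have h2 := hasDerivWithinAt_rfc_v hab hsol ht l
  have h3 : HasDerivWithinAt (fun t => cis (-(delta a b l * t)))
      (Complex.I * (-delta a b l : ℝ) * cis (-(delta a b l * t))) (Set.Icc 0 S) t := by
    have := (hasDerivAt_cis_mul (-delta a b l) t).hasDerivWithinAt (s := Set.Icc 0 S)
    simpa only [neg_mul] using this
  have h := h3.mul (h1.sub ((h2.const_mul Complex.I).div_const ((delta a b l : ℝ) : ℂ)))
  refine h.congr_deriv ?_
  simp only [Pi.sub_apply, Complex.ofReal_neg]
  field_simp
  linear_combination (((delta a b l : ℝ) : ℂ) * cis (-(delta a b l * t)) * rfc a b (v t) l) *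
    Complex.I_sq

lemma AssumptionA.nonneg (hA : AssumptionA a b S m M u v) (hS : 0 ≤ S) : 0 ≤ M :=
  (normH_nonneg _ _).trans (hA 0 ⟨le_rfl, hS⟩).1.2

lemma norm_rfc_u_le (hm : 1 ≤ m) (hA : AssumptionA a b S m M u v) {t : ℝ}
    (ht : t ∈ Set.Icc 0 S) (l : ℤ) : ‖rfc a b (u t) l‖ ≤ M * (delta a b l ^ 2)⁻¹ := by
  have h1 := delta_pow_mul_norm_fcoeff_le (hA t ht).1.1 (hA t ht).1.2 l
  have hd := delta_pos a b l
  rw [← div_eq_mul_inv, le_div_iff₀ (by positivity), mul_comm]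
  refine le_trans (mul_le_mul_of_nonneg_right ?_ (norm_nonneg _)) h1
  exact pow_le_pow_right₀ (one_le_delta a b l) (by omega)

lemma norm_psiHat_le_of_pow (t : ℝ) (l : ℤ) :
    ‖((delta a b l ^ (m + 1) : ℝ) : ℂ) * psiHat a b u v t l‖ ≤
      ‖((delta a b l ^ (m + 1) : ℝ) : ℂ) * rfc a b (u t) l‖ +
        ‖((delta a b l ^ m : ℝ) : ℂ) * rfc a b (v t) l‖ := by
  have hd := delta_ne_zero a b l
  have h : ((delta a b l ^ (m + 1) : ℝ) : ℂ) * psiHat a b u v t l =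
      ((delta a b l ^ (m + 1) : ℝ) : ℂ) * rfc a b (u t) l -
        Complex.I * (((delta a b l ^ m : ℝ) : ℂ) * rfc a b (v t) l) := by
    rw [psiHat]
    push_cast
    field_simp
    ring
  rw [h]
  refine (norm_sub_le _ _).trans ?_
  rw [norm_mul Complex.I, Complex.norm_I, one_mul]

lemma l2_psiHat_le (hA : AssumptionA a b S m M u v) {t : ℝ} (ht : t ∈ Set.Icc 0 S)
    (s : Finset ℤ) :
    l2 s (fun l => ((delta a b l ^ (m + 1) : ℝ) : ℂ) * psiHat a b u v t l) ≤ 2 * M := by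
  have h1 := l2_fcoeff_le (hA t ht).1.1 (hA t ht).1.2 s
  have h2 := l2_fcoeff_le (hA t ht).2.1 (hA t ht).2.2 s
  have h3 := l2_add_le s
    (fun l => ((‖((delta a b l ^ (m + 1) : ℝ) : ℂ) * rfc a b (u t) l‖ : ℝ) : ℂ))
    (fun l => ((‖((delta a b l ^ m : ℝ) : ℂ) * rfc a b (v t) l‖ : ℝ) : ℂ))
  have h4 : ∀ f : ℤ → ℂ, l2 s (fun l => ((‖f l‖ : ℝ) : ℂ)) = l2 s f := fun f =>
    l2_congr fun l _ => by rw [Complex.norm_real, norm_norm]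
  rw [h4, h4] at h3
  refine le_trans (l2_mono fun l _ => ?_) (h3.trans (by simp only [rfc]; linarith))
  rw [← Complex.ofReal_add, Complex.norm_of_nonneg (by positivity)]
  exact norm_psiHat_le_of_pow t l

lemma norm_psiHat_le (hm : 1 ≤ m) (hA : AssumptionA a b S m M u v) {t : ℝ}
    (ht : t ∈ Set.Icc 0 S) (l : ℤ) : ‖psiHat a b u v t l‖ ≤ 2 * M * (delta a b l ^ 2)⁻¹ := by
  have h1 := l2_psiHat_le hA ht {l}
  have hd := delta_pos a b l
  simp only [l2, Finset.sum_singleton, Real.sqrt_sq (norm_nonneg _)] at h1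
  rw [norm_mul, Complex.norm_of_nonneg (by positivity)] at h1
  rw [← div_eq_mul_inv, le_div_iff₀ (by positivity), mul_comm]
  refine le_trans (mul_le_mul_of_nonneg_right ?_ (norm_nonneg _)) h1
  exact pow_le_pow_right₀ (one_le_delta a b l) (by omega)

/-- The constant in the bound for the Fourier coefficients of `u³`. -/
noncomputable def cubeConst (a b M : ℝ) : ℝ := 9 * deltaSum a b ^ 2 * M ^ 3

lemma cubeConst_nonneg (hM : 0 ≤ M) : 0 ≤ cubeConst a b M := by
  rw [cubeConst]; positivity

lemma norm_cubeHat_le (hab : a < b) (hm : 1 ≤ m) (hsol : IsSolution a b ε S u₀ u₁ u v)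
    (hA : AssumptionA a b S m M u v) {t : ℝ} (ht : t ∈ Set.Icc 0 S) (l : ℤ) :
    ‖cubeHat a b u t l‖ ≤ cubeConst a b M * (delta a b l ^ 2)⁻¹ := by
  have hM := hA.nonneg (ht.1.trans ht.2)
  have h := norm_fcoeff_cube_le hab (continuousOn_ofReal (hsol.continuous_u t ht)) hM
    (norm_rfc_u_le hm hA ht) l
  simpa only [cubeHat, rfc, Complex.ofReal_pow, cubeConst] using h

/-- The mean value inequality with δ⁻¹ from ⟨∇⟩⁻¹ and δ⁻² from the cube. The total decay δ⁻³ leaves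
one power to spare in the freezing estimate. -/
lemma norm_phi_sub_le (hab : a < b) (hm : 1 ≤ m) (hsol : IsSolution a b ε S u₀ u₁ u v)
    (hA : AssumptionA a b S m M u v) {t s : ℝ} (ht : t ∈ Set.Icc 0 S) (hs : s ∈ Set.Icc 0 S)
    (hts : t ≤ s) (l : ℤ) :
    ‖phi a b u v s l - phi a b u v t l‖ ≤
      ε ^ 2 * cubeConst a b M * ((delta a b l)⁻¹ * (delta a b l ^ 2)⁻¹) * (s - t) := by
  have hsub : Set.Icc t s ⊆ Set.Icc 0 S := Set.Icc_subset_Icc ht.1 hs.2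
  refine norm_image_sub_le_of_norm_deriv_le_segment' (f := fun t => phi a b u v t l)
    (fun r hr => (hasDerivWithinAt_phi hab hsol (hsub hr) l).mono hsub) (fun r hr => ?_)
    s ⟨hts, le_rfl⟩
  have hd := delta_pos a b l
  rw [norm_mul, norm_mul, norm_cis, one_mul, norm_div, norm_mul, Complex.norm_I, one_mul,
    norm_pow, Complex.norm_real, Complex.norm_of_nonneg hd.le, Real.norm_eq_abs, sq_abs]
  have := norm_cubeHat_le hab hm hsol hA (hsub ⟨hr.1, hr.2.le⟩) l
  calc ε ^ 2 / delta a b l * ‖cubeHat a b u r l‖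
      ≤ ε ^ 2 / delta a b l * (cubeConst a b M * (delta a b l ^ 2)⁻¹) := by gcongr
    _ = _ := by rw [div_eq_mul_inv]; ring

/-- Freezing the twisted variable at time `t` for the time `s - t` changes `u` by `O(ε²(s-t)²)`. -/
lemma norm_rfc_u_sub_frozen_le (hab : a < b) (hm : 1 ≤ m) (hsol : IsSolution a b ε S u₀ u₁ u v)
    (hA : AssumptionA a b S m M u v) {t s : ℝ} (ht : t ∈ Set.Icc 0 S) (hs : s ∈ Set.Icc 0 S)
    (hts : t ≤ s) (l : ℤ) :
    ‖rfc a b (u s) l - (1 / 2) * (cis (delta a b l * s) * phi a b u v t l +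
      cis (-(delta a b l * s)) * (starRingEnd ℂ) (phi a b u v t (-l)))‖ ≤
      ε ^ 2 * cubeConst a b M * (s - t) ^ 2 * (delta a b l ^ 2)⁻¹ := by
  have hsub : Set.Icc t s ⊆ Set.Icc 0 S := Set.Icc_subset_Icc ht.1 hs.2
  have hd := delta_pos a b l
  have hd0 := delta_ne_zero a b l
  have hK := cubeConst_nonneg (a := a) (b := b) (hA.nonneg (ht.1.trans ht.2))
  set F : ℝ → ℂ := fun r => (1 / 2) *
    (cis (delta a b l * r) * (phi a b u v r l - phi a b u v t l) +
      cis (-(delta a b l * r)) * (starRingEnd ℂ) (phi a b u v r (-l) - phi a b u v t (-l))) with hF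
  have hFs : rfc a b (u s) l - (1 / 2) * (cis (delta a b l * s) * phi a b u v t l +
      cis (-(delta a b l * s)) * (starRingEnd ℂ) (phi a b u v t (-l))) = F s - F t := by
    rw [rfc_u_eq_phi (v := v)]
    simp only [hF, map_sub]
    ring
  -- The two nonlinear contributions to F′ cancel, reflecting that ∂ₜu = v contains no cubic term.
  -- Only δ_l times the drift of φ remains, which is itself O(ε²(r-t)), so the freezing error is
  -- quadratic in time.
  have hder : ∀ r ∈ Set.Icc t s, HasDerivWithinAt F ((1 / 2) * (Complex.I * delta a b l *
      (cis (delta a b l * r) * (phi a b u v r l - phi a b u v t l) -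
      cis (-(delta a b l * r)) * (starRingEnd ℂ) (phi a b u v r (-l) - phi a b u v t (-l)))))
      (Set.Icc t s) r := by
    intro r hr
    have h1 := ((hasDerivWithinAt_phi hab hsol (hsub hr) l).mono hsub).sub_const (phi a b u v t l)
    have h2 := (((hasDerivWithinAt_phi hab hsol (hsub hr) (-l)).mono hsub).sub_const
      (phi a b u v t (-l))).star
    have h3 := (hasDerivAt_cis_mul (delta a b l) r).hasDerivWithinAt (s := Set.Icc t s)
    have h4 : HasDerivWithinAt (fun t => cis (-(delta a b l * t)))
        (Complex.I * (-delta a b l : ℝ) * cis (-(delta a b l * r))) (Set.Icc t s) r := by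
      have := (hasDerivAt_cis_mul (-delta a b l) r).hasDerivWithinAt (s := Set.Icc t s)
      simpa only [neg_mul] using this
    refine (((h3.mul h1).add (h4.mul h2)).const_mul (1 / 2 : ℂ)).congr_deriv ?_
    simp only [← starRingEnd_apply, map_mul, map_div₀, map_sub, map_pow, conj_cis, delta_neg,
      Complex.conj_I, Complex.conj_ofReal, cubeHat, rfc_neg, Complex.conj_conj, neg_neg,
      Complex.ofReal_neg]
    have e1 := cis_neg_mul_cis (delta a b l * r)
    field_simp
    ring
  have hbound : ∀ r ∈ Set.Ico t s, ‖(1 / 2 : ℂ) * (Complex.I * delta a b l *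
      (cis (delta a b l * r) * (phi a b u v r l - phi a b u v t l) -
      cis (-(delta a b l * r)) * (starRingEnd ℂ) (phi a b u v r (-l) - phi a b u v t (-l))))‖ ≤
      ε ^ 2 * cubeConst a b M * (s - t) * (delta a b l ^ 2)⁻¹ := by
    intro r hr
    have hr' : r ∈ Set.Icc 0 S := hsub ⟨hr.1, hr.2.le⟩
    have h1 := norm_phi_sub_le hab hm hsol hA ht hr' hr.1 l
    have h2 := norm_phi_sub_le hab hm hsol hA ht hr' hr.1 (-l)
    rw [delta_neg] at h2
    rw [norm_mul, norm_mul, norm_mul, Complex.norm_I, Complex.norm_of_nonneg hd.le]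
    have h3 : ‖cis (delta a b l * r) * (phi a b u v r l - phi a b u v t l) -
      cis (-(delta a b l * r)) * (starRingEnd ℂ) (phi a b u v r (-l) - phi a b u v t (-l))‖ ≤
        2 * (ε ^ 2 * cubeConst a b M * ((delta a b l)⁻¹ * (delta a b l ^ 2)⁻¹) * (s - t)) := by
      refine (norm_sub_le _ _).trans ?_
      rw [norm_mul, norm_mul, norm_cis, norm_cis, Complex.norm_conj, one_mul, one_mul]
      have h4 : ε ^ 2 * cubeConst a b M * ((delta a b l)⁻¹ * (delta a b l ^ 2)⁻¹) * (r - t) ≤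
          ε ^ 2 * cubeConst a b M * ((delta a b l)⁻¹ * (delta a b l ^ 2)⁻¹) * (s - t) := by
        have := hr.2.le
        gcongr
      linarith
    calc _ ≤ ‖(1 / 2 : ℂ)‖ * (1 * delta a b l * (2 * (ε ^ 2 * cubeConst a b M *
          ((delta a b l)⁻¹ * (delta a b l ^ 2)⁻¹) * (s - t)))) := by gcongr
      _ = _ := by
        norm_num
        field_simp
  have h := norm_image_sub_le_of_norm_deriv_le_segment' hder hbound s ⟨hts, le_rfl⟩
  rw [hFs]
  refine h.trans (le_of_eq ?_)
  ring

end Solution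

/-! ### The frozen low-frequency solution and the local error of freezing. -/

section Frozen
variable {a b ε S M : ℝ} {m : ℕ} {u₀ u₁ : ℝ → ℝ} {u v : ℝ → ℝ → ℝ}

/-- The signed time frequency `±δ_l` of a wave. -/
noncomputable def waveFreq (a b : ℝ) (q : ℤ × Bool) : ℝ :=
  if q.2 then delta a b q.1 else -delta a b q.1

/-- The amplitude of the wave `q` in the solution frozen at time `t`. -/
noncomputable def amp (a b : ℝ) (u v : ℝ → ℝ → ℝ) (t : ℝ) (q : ℤ × Bool) : ℂ :=
  (1 / 2) * if q.2 then phi a b u v t q.1 else (starRingEnd ℂ) (phi a b u v t (-q.1))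

/-- The set of waves with frequency in `Λ`. -/
def waves (Λ : Finset ℤ) : Finset (ℤ × Bool) := Λ ×ˢ Finset.univ

/-- The real part at time `r` of the free evolution of `ψ(t)`, truncated to the frequencies `Λ`. -/
noncomputable def frozen (a b : ℝ) (u v : ℝ → ℝ → ℝ) (Λ : Finset ℤ) (t r x : ℝ) : ℂ :=
  ∑ q ∈ waves Λ, amp a b u v t q * cis (waveFreq a b q * r) * mode a b q.1 x

/-- The Fourier coefficients of the frozen solution. -/
noncomputable def frozenCoeff (a b : ℝ) (u v : ℝ → ℝ → ℝ) (t r : ℝ) (l : ℤ) : ℂ :=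
  (1 / 2) * (cis (delta a b l * r) * phi a b u v t l +
      cis (-(delta a b l * r)) * (starRingEnd ℂ) (phi a b u v t (-l)))

lemma frozen_eq (Λ : Finset ℤ) (t r x : ℝ) :
    frozen a b u v Λ t r x = ∑ l ∈ Λ, frozenCoeff a b u v t r l * mode a b l x := by
  rw [frozen, waves, Finset.sum_product]
  refine Finset.sum_congr rfl fun l _ => ?_
  simp only [Fintype.sum_bool, amp, waveFreq, frozenCoeff, if_true, Bool.false_eq_true, if_false,
    neg_mul]
  ring

lemma card_waves_filter_le (Λ : Finset ℤ) (k : ℤ) :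
    ((waves Λ).filter fun q => q.1 = k).card ≤ 2 := by
  have h : (waves Λ).filter (fun q => q.1 = k) ⊆ ({k} : Finset ℤ) ×ˢ Finset.univ := by
    intro q hq
    simp only [Finset.mem_filter] at hq
    exact Finset.mem_product.2 ⟨Finset.mem_singleton.2 hq.2, Finset.mem_univ _⟩
  refine (Finset.card_le_card h).trans ?_
  simp

lemma abs_waveFreq (q : ℤ × Bool) : |waveFreq a b q| = delta a b q.1 := by
  rw [waveFreq]
  split_ifs
  · exact abs_of_pos (delta_pos a b _)
  · rw [abs_neg]; exact abs_of_pos (delta_pos a b _)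

lemma norm_amp_le (hm : 1 ≤ m) (hA : AssumptionA a b S m M u v) {t : ℝ}
    (ht : t ∈ Set.Icc 0 S) (q : ℤ × Bool) : ‖amp a b u v t q‖ ≤ M * (delta a b q.1 ^ 2)⁻¹ := by
  have h1 := norm_psiHat_le hm hA ht q.1
  have h2 := norm_psiHat_le hm hA ht (-q.1)
  rw [delta_neg] at h2
  rw [amp, norm_mul]
  split_ifs
  · rw [norm_phi]; norm_num; linarith
  · rw [Complex.norm_conj, norm_phi]; norm_num; linarith

lemma norm_amp_sub_le (hab : a < b) (hm : 1 ≤ m) (hsol : IsSolution a b ε S u₀ u₁ u v)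
    (hA : AssumptionA a b S m M u v) {t s : ℝ} (ht : t ∈ Set.Icc 0 S) (hs : s ∈ Set.Icc 0 S)
    (hts : t ≤ s) (q : ℤ × Bool) :
    ‖amp a b u v s q - amp a b u v t q‖ ≤
      ε ^ 2 * cubeConst a b M * (s - t) * (delta a b q.1 ^ 2)⁻¹ := by
  have hd := one_le_delta a b q.1
  have hK := cubeConst_nonneg (a := a) (b := b) (hA.nonneg (ht.1.trans ht.2))
  have hst : 0 ≤ s - t := sub_nonneg.2 hts
  have h3 : ε ^ 2 * cubeConst a b M * ((delta a b q.1)⁻¹ * (delta a b q.1 ^ 2)⁻¹) * (s - t) ≤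
      ε ^ 2 * cubeConst a b M * (s - t) * (delta a b q.1 ^ 2)⁻¹ := by
    have h4 : (delta a b q.1)⁻¹ ≤ 1 := inv_le_one_of_one_le₀ hd
    calc _ ≤ ε ^ 2 * cubeConst a b M * (1 * (delta a b q.1 ^ 2)⁻¹) * (s - t) := by gcongr
      _ = _ := by ring
  have h1 := norm_phi_sub_le hab hm hsol hA ht hs hts q.1
  have h2 := norm_phi_sub_le hab hm hsol hA ht hs hts (-q.1)
  rw [delta_neg] at h2
  rw [amp, amp, ← mul_sub, norm_mul]
  have h5 : ‖(1 / 2 : ℂ)‖ = 1 / 2 := by norm_num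
  rw [h5]
  split_ifs
  · linarith [norm_nonneg (phi a b u v s q.1 - phi a b u v t q.1)]
  · rw [← map_sub, Complex.norm_conj]
    linarith [norm_nonneg (phi a b u v s (-q.1) - phi a b u v t (-q.1))]

lemma continuous_frozen (Λ : Finset ℤ) (t r : ℝ) : Continuous (frozen a b u v Λ t r) :=
  continuous_finsetSum _ fun q _ => continuous_const.mul (continuous_mode a b q.1)

lemma fcoeff_frozen (hab : a < b) (Λ : Finset ℤ) (t r : ℝ) (l : ℤ) :
    fcoeff a b (frozen a b u v Λ t r) l = if l ∈ Λ then frozenCoeff a b u v t r l else 0 := by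
  have : frozen a b u v Λ t r = fun x => ∑ l ∈ Λ, frozenCoeff a b u v t r l * mode a b l x :=
    funext fun x => frozen_eq Λ t r x
  rw [this, fcoeff_sum_mode hab Λ (frozenCoeff a b u v t r) (fun k => k) l, Finset.sum_ite_eq' Λ l]

lemma norm_frozen_le (hab : a < b) (hm : 1 ≤ m) (hA : AssumptionA a b S m M u v) {t : ℝ}
    (ht : t ∈ Set.Icc 0 S) (Λ : Finset ℤ) (r x : ℝ) :
    ‖frozen a b u v Λ t r x‖ ≤ 2 * M * deltaSum a b := by
  have hM := hA.nonneg (ht.1.trans ht.2)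
  refine (norm_sum_le _ _).trans ?_
  calc _ ≤ ∑ q ∈ waves Λ, M * (delta a b q.1 ^ 2)⁻¹ := by
        refine Finset.sum_le_sum fun q _ => ?_
        rw [norm_mul, norm_mul, norm_cis, norm_mode, mul_one, mul_one]
        exact norm_amp_le hm hA ht q
    _ ≤ M * ((2 : ℕ) * deltaSum a b) := by
        rw [← Finset.mul_sum]
        exact mul_le_mul_of_nonneg_left (sum_comp_le hab (card_waves_filter_le Λ)) hM
    _ = _ := by push_cast; ring

/-- Off Λ one has 1 ≤ (ρδ_l)^k, so k derivatives are traded for the factor ρ^k. -/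
lemma l2_high_le {Λ : Finset ℤ} {ρ : ℝ} (hρ : ∀ l ∉ Λ, (delta a b l)⁻¹ ≤ ρ) (hρ0 : 0 ≤ ρ) {k : ℕ}
    {f : ℤ → ℂ} {X : ℝ} {t : Finset ℤ}
    (hf : l2 t (fun l => ((delta a b l ^ k : ℝ) : ℂ) * f l) ≤ X) :
    l2 t (fun l => if l ∈ Λ then 0 else f l) ≤ ρ ^ k * X := by
  have h1 := l2_const_mul t ((ρ ^ k : ℝ) : ℂ) (fun l => ((delta a b l ^ k : ℝ) : ℂ) * f l)
  rw [Complex.norm_of_nonneg (pow_nonneg hρ0 k)] at h1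
  refine (l2_mono fun l _ => ?_).trans (h1.le.trans (mul_le_mul_of_nonneg_left hf (by positivity)))
  split_ifs with hl
  · rw [norm_zero]; exact norm_nonneg _
  · have hd := delta_pos a b l
    rw [norm_mul, norm_mul, Complex.norm_of_nonneg (pow_nonneg hρ0 k),
      Complex.norm_of_nonneg (pow_nonneg hd.le k), ← mul_assoc, ← mul_pow]
    refine le_mul_of_one_le_left (norm_nonneg _) (one_le_pow₀ ?_)
    have := hρ l hl
    rwa [inv_le_iff_one_le_mul₀ hd] at this

/-- The bound for the distance of the solution and the frozen solution after time `s`. -/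
noncomputable def frozenErr (a b ε M ρ : ℝ) (m : ℕ) (s : ℝ) : ℝ :=
  ε ^ 2 * cubeConst a b M * s ^ 2 * Real.sqrt (deltaSum a b) + ρ ^ (m + 1) * M

/-- Frequencies in Λ contribute the freezing error, the others the high-frequency tail of u(s)
itself. These are the two terms of `frozenErr`. -/
lemma tsum_sq_sub_frozen_le (hab : a < b) (hm : 1 ≤ m) (hsol : IsSolution a b ε S u₀ u₁ u v)
    (hA : AssumptionA a b S m M u v) {t s : ℝ} (ht : t ∈ Set.Icc 0 S) (hs : s ∈ Set.Icc 0 S)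
    (hts : t ≤ s) {Λ : Finset ℤ} {ρ : ℝ} (hρ : ∀ l ∉ Λ, (delta a b l)⁻¹ ≤ ρ) (hρ0 : 0 ≤ ρ) :
    ∑' l, ‖fcoeff a b (fun x => (u s x : ℂ)) l - fcoeff a b (frozen a b u v Λ t s) l‖ ^ 2 ≤
      frozenErr a b ε M ρ m (s - t) ^ 2 := by
  have hM := hA.nonneg (ht.1.trans ht.2)
  have hK := cubeConst_nonneg (a := a) (b := b) hM
  refine Real.tsum_le_of_sum_le (fun _ => by positivity) fun T => ?_
  rw [← l2_sq]
  have h0 : 0 ≤ frozenErr a b ε M ρ m (s - t) := by rw [frozenErr]; positivity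
  refine pow_le_pow_left₀ (l2_nonneg _ _) ?_ 2
  have h1 := l2_high_le (Λ := Λ) hρ hρ0 (l2_fcoeff_le (hA s hs).1.1 (hA s hs).1.2 T)
  have h2 : l2 T (fun l => if l ∈ Λ then rfc a b (u s) l - frozenCoeff a b u v t s l else 0) ≤
      ε ^ 2 * cubeConst a b M * (s - t) ^ 2 * Real.sqrt (deltaSum a b) := by
    refine l2_le_of_le_inv_delta hab (by positivity) fun l _ => ?_
    have hd := one_le_delta a b l
    split_ifs
    · refine (norm_rfc_u_sub_frozen_le hab hm hsol hA ht hs hts l).trans ?_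
      have : (delta a b l ^ 2)⁻¹ ≤ (delta a b l)⁻¹ :=
        inv_anti₀ (by positivity) (le_self_pow₀ hd two_ne_zero)
      gcongr
    · rw [norm_zero]; positivity
  have h3 := l2_add_le T
    (fun l => if l ∈ Λ then rfc a b (u s) l - frozenCoeff a b u v t s l else 0)
    (fun l => if l ∈ Λ then 0 else fcoeff a b (fun x => (u s x : ℂ)) l)
  refine (l2_congr fun l _ => ?_).le.trans (h3.trans (add_le_add h2 h1))
  rw [fcoeff_frozen hab]
  split_ifs <;> simp [rfc]

lemma l2_cube_sub_frozen_le (hab : a < b) (hm : 1 ≤ m) (hsol : IsSolution a b ε S u₀ u₁ u v)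
    (hA : AssumptionA a b S m M u v) {t s : ℝ} (ht : t ∈ Set.Icc 0 S) (hs : s ∈ Set.Icc 0 S)
    (hts : t ≤ s) {Λ : Finset ℤ} {ρ : ℝ} (hρ : ∀ l ∉ Λ, (delta a b l)⁻¹ ≤ ρ) (hρ0 : 0 ≤ ρ)
    (T : Finset ℤ) :
    l2 T (fun l => cubeHat a b u s l - fcoeff a b (fun x => frozen a b u v Λ t s x ^ 3) l) ≤
      3 * (2 * M * deltaSum a b) ^ 2 * frozenErr a b ε M ρ m (s - t) := by
  have hM := hA.nonneg (ht.1.trans ht.2)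
  have hK := cubeConst_nonneg (a := a) (b := b) hM
  have hD := deltaSum_nonneg a b
  have h0 : 0 ≤ frozenErr a b ε M ρ m (s - t) := by rw [frozenErr]; positivity
  have h := l2_fcoeff_cube_sub_le hab (continuousOn_ofReal (hsol.continuous_u s hs))
    (continuous_frozen Λ t s).continuousOn h0 (A := 2 * M * deltaSum a b)
    (fun x hx => (norm_le_of_norm_fcoeff_le hab (continuousOn_ofReal (hsol.continuous_u s hs))
      (norm_rfc_u_le hm hA hs) hx).trans (by nlinarith [mul_nonneg hM hD]))
    (fun x _ => norm_frozen_le hab hm hA ht Λ s x)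
    (tsum_sq_sub_frozen_le hab hm hsol hA ht hs hts hρ hρ0) T
  simpa only [cubeHat, rfc, Complex.ofReal_pow] using h

/-- The resonance function of three waves producing the frequency `l`. -/
noncomputable def resonance (a b : ℝ) (r : (ℤ × Bool) × (ℤ × Bool) × (ℤ × Bool)) (l : ℤ) : ℝ :=
  waveFreq a b r.1 + waveFreq a b r.2.1 + waveFreq a b r.2.2 - delta a b l

/-- The product of the amplitudes of three waves. -/
noncomputable def ampProd (a b : ℝ) (u v : ℝ → ℝ → ℝ) (t : ℝ)
    (r : (ℤ × Bool) × (ℤ × Bool) × (ℤ × Bool)) : ℂ :=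
  amp a b u v t r.1 * amp a b u v t r.2.1 * amp a b u v t r.2.2

/-- All time dependence of the twisted frozen cube sits in pure exponentials of the resonance
function. Splitting off the factor at t separates the step from the position inside the step. -/
lemma cis_mul_fcoeff_frozen_cube (hab : a < b) (Λ : Finset ℤ) (t s : ℝ) (l : ℤ) :
    cis (-(delta a b l * (t + s))) *
        fcoeff a b (fun x => frozen a b u v Λ t (t + s) x ^ 3) l =
      ∑ r ∈ waves Λ ×ˢ waves Λ ×ˢ waves Λ, if r.1.1 + r.2.1.1 + r.2.2.1 = l then
        cis (resonance a b r l * t) * ampProd a b u v t r * cis (resonance a b r l * s) else 0 := by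
  have h := fcoeff_cube_sum_mode hab (waves Λ)
    (fun q => amp a b u v t q * cis (waveFreq a b q * (t + s))) (fun q => q.1) l
  simp only [frozen]
  rw [h, Finset.mul_sum]
  refine Finset.sum_congr rfl fun r _ => ?_
  split_ifs
  · have e : cis (resonance a b r l * t) * cis (resonance a b r l * s) =
        cis (-(delta a b l * (t + s))) * (cis (waveFreq a b r.1 * (t + s)) *
          cis (waveFreq a b r.2.1 * (t + s)) * cis (waveFreq a b r.2.2 * (t + s))) := by
      rw [← cis_add, ← cis_add, ← cis_add, ← cis_add, resonance]
      congr 1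
      ring
    rw [ampProd]
    linear_combination (-(amp a b u v t r.1 * amp a b u v t r.2.1 * amp a b u v t r.2.2)) * e
  · rw [mul_zero]

/-- The integral over `[t, t+s]` of the twisted cubic nonlinearity of the frozen solution. -/
noncomputable def frozenInt (a b : ℝ) (u v : ℝ → ℝ → ℝ) (Λ : Finset ℤ) (t s : ℝ) (l : ℤ) : ℂ :=
  ∑ r ∈ waves Λ ×ˢ waves Λ ×ˢ waves Λ, if r.1.1 + r.2.1.1 + r.2.2.1 = l then
    cis (resonance a b r l * t) * ampProd a b u v t r * oscInt (resonance a b r l) s else 0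

lemma hasDerivAt_frozenInt (hab : a < b) (Λ : Finset ℤ) (t s : ℝ) (l : ℤ) :
    HasDerivAt (fun s => frozenInt a b u v Λ t s l)
      (cis (-(delta a b l * (t + s))) *
        fcoeff a b (fun x => frozen a b u v Λ t (t + s) x ^ 3) l) s := by
  rw [cis_mul_fcoeff_frozen_cube hab]
  refine HasDerivAt.fun_sum fun r _ => ?_
  split_ifs
  · exact (hasDerivAt_oscInt _ s).const_mul _
  · exact hasDerivAt_const _ _

lemma frozenInt_zero (Λ : Finset ℤ) (t : ℝ) (l : ℤ) : frozenInt a b u v Λ t 0 l = 0 := by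
  simp [frozenInt, oscInt_zero]

lemma hasDerivWithinAt_toE {T : Finset ℤ} {f : ℝ → ℤ → ℂ} {f' : ℤ → ℂ} {s : Set ℝ} {t : ℝ}
    (h : ∀ l ∈ T, HasDerivWithinAt (fun t => f t l) (f' l) s t) :
    HasDerivWithinAt (fun t => toE T (f t)) (toE T f') s t := by
  have h1 : HasDerivWithinAt (fun t => fun l : T => f t l) (fun l : T => f' l) s t :=
    hasDerivWithinAt_pi.2 fun l => h l l.2
  let L : (T → ℂ) →L[ℝ] EuclideanSpace ℂ T :=
    (EuclideanSpace.equiv T ℂ).symm.toContinuousLinearMap.restrictScalars ℝ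
  have h2 : HasFDerivAt L L (fun l : T => f t l) := L.hasFDerivAt
  exact h2.comp_hasDerivWithinAt t h1

/-- One step of the exact flow, up to a local error that is small in `ℓ²`. -/
lemma l2_local_error_le (hab : a < b) (hm : 1 ≤ m) (hsol : IsSolution a b ε S u₀ u₁ u v)
    (hA : AssumptionA a b S m M u v) {t τ : ℝ} (ht : 0 ≤ t) (hτ : 0 ≤ τ) (htτ : t + τ ≤ S)
    {Λ : Finset ℤ} {ρ : ℝ} (hρ : ∀ l ∉ Λ, (delta a b l)⁻¹ ≤ ρ) (hρ0 : 0 ≤ ρ) (T : Finset ℤ) :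
    l2 T (fun l => ((delta a b l : ℝ) : ℂ) * (phi a b u v (t + τ) l - phi a b u v t l) -
      Complex.I * (ε : ℂ) ^ 2 * frozenInt a b u v Λ t τ l) ≤
      ε ^ 2 * (3 * (2 * M * deltaSum a b) ^ 2 * frozenErr a b ε M ρ m τ) * τ := by
  have htS : t ∈ Set.Icc 0 S := ⟨ht, by linarith⟩
  have hM := hA.nonneg (htS.1.trans htS.2)
  have hK := cubeConst_nonneg (a := a) (b := b) hM
  set f : ℝ → ℤ → ℂ := fun s l => ((delta a b l : ℝ) : ℂ) *
    (phi a b u v (t + s) l - phi a b u v t l) -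
      Complex.I * (ε : ℂ) ^ 2 * frozenInt a b u v Λ t s l with hf
  set f' : ℝ → ℤ → ℂ := fun s l => Complex.I * (ε : ℂ) ^ 2 * (cis (-(delta a b l * (t + s))) *
    (cubeHat a b u (t + s) l - fcoeff a b (fun x => frozen a b u v Λ t (t + s) x ^ 3) l)) with hf'
  have hmap : ∀ s ∈ Set.Icc 0 τ, t + s ∈ Set.Icc 0 S := fun s hs =>
    ⟨by linarith [hs.1], by linarith [hs.2]⟩
  -- The mean value inequality is applied to the whole vector of coefficients, since the difference
  -- of the cubes is controlled in ℓ² through Parseval.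
  have hder : ∀ s ∈ Set.Icc 0 τ, HasDerivWithinAt (fun s => toE T (f s)) (toE T (f' s))
      (Set.Icc 0 τ) s := by
    intro s hs
    refine hasDerivWithinAt_toE fun l _ => ?_
    have hd := delta_ne_zero a b l
    have h1 : HasDerivWithinAt (fun s => phi a b u v (t + s) l) _ (Set.Icc 0 τ) s :=
      HasDerivWithinAt.scomp (h := fun s => t + s) (h' := (1 : ℝ)) s
        (hasDerivWithinAt_phi hab hsol (hmap s hs) l)
        ((hasDerivAt_id s).const_add t).hasDerivWithinAt hmap
    have h2 := (hasDerivAt_frozenInt (u := u) (v := v) hab Λ t s l).hasDerivWithinAt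
      (s := Set.Icc 0 τ)
    refine (((h1.sub_const (phi a b u v t l)).const_mul ((delta a b l : ℝ) : ℂ)).sub
      (h2.const_mul (Complex.I * (ε : ℂ) ^ 2))).congr_deriv ?_
    simp only [hf', one_smul]
    field_simp
  have hbound : ∀ s ∈ Set.Ico 0 τ, ‖toE T (f' s)‖ ≤
      ε ^ 2 * (3 * (2 * M * deltaSum a b) ^ 2 * frozenErr a b ε M ρ m τ) := by
    intro s hs
    rw [norm_toE, hf', l2_const_mul]
    have h1 := l2_cube_sub_frozen_le hab hm hsol hA htS (hmap s ⟨hs.1, hs.2.le⟩)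
      (by linarith [hs.1]) hρ hρ0 T
    rw [add_sub_cancel_left] at h1
    have h2 : frozenErr a b ε M ρ m s ≤ frozenErr a b ε M ρ m τ := by
      rw [frozenErr, frozenErr]
      have := hs.1
      have := hs.2.le
      gcongr
    have h3 : ‖Complex.I * (ε : ℂ) ^ 2‖ = ε ^ 2 := by
      rw [norm_mul, Complex.norm_I, one_mul, norm_pow, Complex.norm_real, Real.norm_eq_abs, sq_abs]
    rw [h3]
    refine mul_le_mul_of_nonneg_left ?_ (sq_nonneg _)
    refine (l2_congr fun l _ => ?_).le.trans (h1.trans (by gcongr))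
    rw [norm_mul, norm_cis, one_mul]
  have h := norm_image_sub_le_of_norm_deriv_le_segment' hder hbound τ ⟨hτ, le_rfl⟩
  have h0 : toE T (f 0) = 0 := by
    ext l
    simp [toE, hf, frozenInt_zero]
  rw [h0, sub_zero, sub_zero, norm_toE] at h
  exact h

end Frozen

/-! ### Accumulation of the quadrature errors. -/

section Resonance
variable {a b ε S M : ℝ} {m : ℕ} {u₀ u₁ : ℝ → ℝ} {u v : ℝ → ℝ → ℝ}

lemma norm_mul_three_le {x y z : ℂ} {p q r : ℝ} (hx : ‖x‖ ≤ p) (hy : ‖y‖ ≤ q) (hz : ‖z‖ ≤ r) :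
    ‖x * y * z‖ ≤ p * q * r := by
  have hp := (norm_nonneg x).trans hx
  have hq := (norm_nonneg y).trans hy
  rw [norm_mul, norm_mul]
  gcongr

lemma norm_ampProd_le (hm : 1 ≤ m) (hA : AssumptionA a b S m M u v) {t : ℝ}
    (ht : t ∈ Set.Icc 0 S) (r : (ℤ × Bool) × (ℤ × Bool) × (ℤ × Bool)) :
    ‖ampProd a b u v t r‖ ≤ M ^ 3 * ((delta a b r.1.1 ^ 2)⁻¹ * (delta a b r.2.1.1 ^ 2)⁻¹ *
      (delta a b r.2.2.1 ^ 2)⁻¹) :=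
  (norm_mul_three_le (norm_amp_le hm hA ht _) (norm_amp_le hm hA ht _)
    (norm_amp_le hm hA ht _)).trans (le_of_eq (by ring))

lemma norm_ampProd_sub_le (hab : a < b) (hm : 1 ≤ m) (hsol : IsSolution a b ε S u₀ u₁ u v)
    (hA : AssumptionA a b S m M u v) {t s : ℝ} (ht : t ∈ Set.Icc 0 S) (hs : s ∈ Set.Icc 0 S)
    (hts : t ≤ s) (r : (ℤ × Bool) × (ℤ × Bool) × (ℤ × Bool)) :
    ‖ampProd a b u v s r - ampProd a b u v t r‖ ≤
      3 * M ^ 2 * (ε ^ 2 * cubeConst a b M * (s - t)) * ((delta a b r.1.1 ^ 2)⁻¹ *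
        (delta a b r.2.1.1 ^ 2)⁻¹ * (delta a b r.2.2.1 ^ 2)⁻¹) := by
  have h : ampProd a b u v s r - ampProd a b u v t r =
      (amp a b u v s r.1 - amp a b u v t r.1) * amp a b u v s r.2.1 * amp a b u v s r.2.2 +
      amp a b u v t r.1 * (amp a b u v s r.2.1 - amp a b u v t r.2.1) * amp a b u v s r.2.2 +
      amp a b u v t r.1 * amp a b u v t r.2.1 * (amp a b u v s r.2.2 - amp a b u v t r.2.2) := by
    rw [ampProd, ampProd]; ring
  rw [h]
  have e : ∀ {t : ℝ}, t ∈ Set.Icc 0 S → ∀ q : ℤ × Bool,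
      ‖amp a b u v t q‖ ≤ M * (delta a b q.1 ^ 2)⁻¹ := fun ht q => norm_amp_le hm hA ht q
  have e' := norm_amp_sub_le hab hm hsol hA ht hs hts
  refine norm_add₃_le.trans ((add_le_add (add_le_add
    (norm_mul_three_le (e' r.1) (e hs r.2.1) (e hs r.2.2))
    (norm_mul_three_le (e ht r.1) (e' r.2.1) (e hs r.2.2)))
    (norm_mul_three_le (e ht r.1) (e ht r.2.1) (e' r.2.2))).trans (le_of_eq ?_))
  ring

lemma abs_resonance_le (r : (ℤ × Bool) × (ℤ × Bool) × (ℤ × Bool)) (l : ℤ) :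
    |resonance a b r l| ≤
      delta a b r.1.1 + delta a b r.2.1.1 + delta a b r.2.2.1 + delta a b l := by
  rw [resonance, ← abs_waveFreq, ← abs_waveFreq, ← abs_waveFreq]
  have h4 := abs_of_pos (delta_pos a b l)
  have h1 := abs_sub (waveFreq a b r.1 + waveFreq a b r.2.1 + waveFreq a b r.2.2) (delta a b l)
  have h2 := abs_add_three (waveFreq a b r.1) (waveFreq a b r.2.1) (waveFreq a b r.2.2)
  linarith

/-- The constant in the bound for the accumulated quadrature errors, where `E = ε²S`. -/
noncomputable def quadConst (a b M E : ℝ) : ℝ :=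
  144 * deltaSum a b ^ 2 * (M ^ 3 + 3 * M ^ 2 * cubeConst a b M * E)

lemma quadConst_nonneg (hM : 0 ≤ M) {E : ℝ} (hE : 0 ≤ E) : 0 ≤ quadConst a b M E := by
  have := cubeConst_nonneg (a := a) (b := b) hM
  rw [quadConst]; positivity

/-- The quadrature errors of the frozen problems cancel over many steps. -/
lemma norm_sum_quad_le (hab : a < b) (hm : 1 ≤ m) (hsol : IsSolution a b ε S u₀ u₁ u v)
    (hA : AssumptionA a b S m M u v) {τ B : ℝ} {n : ℕ} (hτ : 0 ≤ τ) (hn : n * τ ≤ S) (hB0 : 0 ≤ B)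
    (Λ : Finset ℤ) (l : ℤ)
    (hB : ∀ r ∈ waves Λ ×ˢ waves Λ ×ˢ waves Λ, r.1.1 + r.2.1.1 + r.2.2.1 = l → ∀ k ≤ n,
      ‖quadErr (resonance a b r l) τ‖ *
        ‖∑ j ∈ Finset.range k, cis (resonance a b r l * τ) ^ j‖ ≤ B * |resonance a b r l|) :
    ‖∑ k ∈ Finset.range n, (frozenInt a b u v Λ (k * τ) τ l -
      τ * (cis (-(delta a b l * (k * τ + τ / 2))) *
        fcoeff a b (fun x => frozen a b u v Λ (k * τ) (k * τ + τ / 2) x ^ 3) l))‖ ≤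
      B * quadConst a b M (ε ^ 2 * S) * (delta a b l)⁻¹ := by
  have hS : 0 ≤ S := (by positivity : (0 : ℝ) ≤ n * τ).trans hn
  have hM := hA.nonneg hS
  have hK := cubeConst_nonneg (a := a) (b := b) hM
  have hk : ∀ k ≤ n, (k : ℝ) * τ ∈ Set.Icc 0 S := fun k hk => by
    have : (k : ℝ) ≤ n := by exact_mod_cast hk
    exact ⟨by positivity, (by gcongr : (k : ℝ) * τ ≤ n * τ).trans hn⟩
  have hl := delta_pos a b l
  -- The step index k enters each term through a power of a fixed unimodular number and through the
  -- slowly varying amplitudes, which is the form required for summation by parts.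
  have h1 : ∀ k : ℕ, frozenInt a b u v Λ (k * τ) τ l -
      τ * (cis (-(delta a b l * (k * τ + τ / 2))) *
        fcoeff a b (fun x => frozen a b u v Λ (k * τ) (k * τ + τ / 2) x ^ 3) l) =
      ∑ r ∈ waves Λ ×ˢ waves Λ ×ˢ waves Λ, if r.1.1 + r.2.1.1 + r.2.2.1 = l then
        quadErr (resonance a b r l) τ * cis (resonance a b r l * τ) ^ k *
          ampProd a b u v (k * τ) r else 0 := by
    intro k
    rw [cis_mul_fcoeff_frozen_cube hab, frozenInt, Finset.mul_sum, ← Finset.sum_sub_distrib]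
    refine Finset.sum_congr rfl fun r _ => ?_
    split_ifs
    · rw [quadErr, ← cis_nat_mul]
      have : resonance a b r l * (k * τ) = k * (resonance a b r l * τ) := by ring
      rw [this]
      ring
    · rw [mul_zero, sub_zero]
  simp only [h1]
  rw [Finset.sum_comm]
  have h2 : ∀ r ∈ waves Λ ×ˢ waves Λ ×ˢ waves Λ, ‖∑ k ∈ Finset.range n,
      (if r.1.1 + r.2.1.1 + r.2.2.1 = l then
        quadErr (resonance a b r l) τ * cis (resonance a b r l * τ) ^ k *
          ampProd a b u v (k * τ) r else 0)‖ ≤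
      B * (2 * (M ^ 3 + 3 * M ^ 2 * cubeConst a b M * (ε ^ 2 * S))) * (delta a b l)⁻¹ *
        (if r.1.1 + r.2.1.1 + r.2.2.1 = l then
          tripleWeight a b r.1.1 r.2.1.1 r.2.2.1 else 0) := by
    intro r hr
    split_ifs with hrl
    · set w := (delta a b r.1.1 ^ 2)⁻¹ * (delta a b r.2.1.1 ^ 2)⁻¹ * (delta a b r.2.2.1 ^ 2)⁻¹
        with hw
      set σ := delta a b r.1.1 + delta a b r.2.1.1 + delta a b r.2.2.1 with hσ
      have hw0 : 0 ≤ w := by positivity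
      have hσ0 : 0 ≤ σ := by
        linarith [delta_pos a b r.1.1, delta_pos a b r.2.1.1, delta_pos a b r.2.2.1]
      have h3 := norm_quadErr_mul_sum_le (P := fun k : ℕ => ampProd a b u v (k * τ) r)
        (d := 3 * M ^ 2 * (ε ^ 2 * cubeConst a b M * τ) * w)
        (mul_nonneg hB0 (abs_nonneg _)) (hB r hr hrl)
        (norm_ampProd_le hm hA (hk n le_rfl) r) (fun k hkn => by
          have h := norm_ampProd_sub_le hab hm hsol hA (hk k hkn.le) (hk (k + 1) hkn)
            (by push_cast; nlinarith) r
          have e : ((k + 1 : ℕ) : ℝ) * τ - k * τ = τ := by push_cast; ring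
          rwa [e] at h)
      refine h3.trans ?_
      -- Since δ_l ≤ σ, one has |Ω| ≤ 2σ ≤ 2σ²/δ_l. The σ² completes `tripleWeight`, and δ_l⁻¹ makes
      -- the result square summable in l.
      have h4 : |resonance a b r l| ≤ 2 * (σ * σ * (delta a b l)⁻¹) := by
        have e1 := delta_add_three_le a b r.1.1 r.2.1.1 r.2.2.1
        rw [hrl, ← hσ] at e1
        have e2 := abs_resonance_le (a := a) (b := b) r l
        rw [← hσ] at e2
        have e3 : σ ≤ σ * σ * (delta a b l)⁻¹ := by
          rw [← div_eq_mul_inv, le_div_iff₀ hl]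
          exact mul_le_mul_of_nonneg_left e1 (hl.le.trans e1)
        linarith
      -- The amplitudes drift by O(ε²τ) per step, hence by O(ε²S) over all n steps, which stays
      -- bounded on the long time interval.
      have h5 : M ^ 3 * w + n * (3 * M ^ 2 * (ε ^ 2 * cubeConst a b M * τ) * w) ≤
          (M ^ 3 + 3 * M ^ 2 * cubeConst a b M * (ε ^ 2 * S)) * w := by
        have : (n * τ) * (3 * M ^ 2 * cubeConst a b M * ε ^ 2 * w) ≤
            S * (3 * M ^ 2 * cubeConst a b M * ε ^ 2 * w) := by gcongr
        linarith
      calc _ ≤ B * (2 * (σ * σ * (delta a b l)⁻¹)) *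
            ((M ^ 3 + 3 * M ^ 2 * cubeConst a b M * (ε ^ 2 * S)) * w) := by gcongr
        _ = _ := by rw [tripleWeight, ← hw, ← hσ]; ring
    · simp
  refine (norm_sum_le _ _).trans ((Finset.sum_le_sum h2).trans ?_)
  rw [← Finset.mul_sum]
  refine (mul_le_mul_of_nonneg_left (sum_tripleWeight_le hab (card_waves_filter_le Λ) l)
    (by positivity)).trans (le_of_eq ?_)
  -- The constant is 144 = 2 · 9 · 2³: the 2 from bounding |Ω|, the 9 from `sum_tripleWeight_le`,
  -- and multiplicity two of each wave frequency.
  rw [quadConst]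
  push_cast
  ring

end Resonance

/-! ### The numerical scheme in Fourier space and its stability. -/

section Scheme
variable {a b ε S M τ : ℝ} {m N : ℕ} {u₀ u₁ : ℝ → ℝ} {u v : ℝ → ℝ → ℝ}

lemma norm_half_add_conj_le (z : ℂ) : ‖(1 / 2) * (z + (starRingEnd ℂ) z)‖ ≤ ‖z‖ := by
  have h1 := norm_add_le z ((starRingEnd ℂ) z)
  rw [Complex.norm_conj] at h1
  rw [norm_mul]
  norm_num
  linarith

lemma G_eq (z : ℂ) : G z = ((1 / 2) * (z + (starRingEnd ℂ) z)) ^ 3 := by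
  rw [G]; ring

lemma halfPhase_eq (l : ℤ) : halfPhase a b τ l = cis (τ * delta a b l / 2) := rfl

/-- The error of the twisted numerical solution in Fourier space. -/
noncomputable def err (a b ε τ : ℝ) (N : ℕ) (u₀ u₁ : ℝ → ℝ) (u v : ℝ → ℝ → ℝ) (n : ℕ) (l : ℤ) : ℂ :=
  phi a b u v (n * τ) l - cis (-(delta a b l * (n * τ))) * dcoeff a b N (psi a b ε τ N u₀ u₁ n) l

lemma norm_err (n : ℕ) (l : ℤ) : ‖err a b ε τ N u₀ u₁ u v n l‖ =
    ‖psiHat a b u v (n * τ) l - dcoeff a b N (psi a b ε τ N u₀ u₁ n) l‖ := by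
  rw [err, phi, ← mul_sub, norm_mul, norm_cis, one_mul]

/-- The error in the energy norm. -/
noncomputable def energyErr (a b ε τ : ℝ) (N : ℕ) (u₀ u₁ : ℝ → ℝ) (u v : ℝ → ℝ → ℝ) (n : ℕ) : ℝ :=
  l2 (freqs N) fun l => ((delta a b l : ℝ) : ℂ) * err a b ε τ N u₀ u₁ u v n l

lemma l2_err_le (n : ℕ) : l2 (freqs N) (err a b ε τ N u₀ u₁ u v n) ≤
    energyErr a b ε τ N u₀ u₁ u v n :=
  l2_mono fun l _ => by
    rw [norm_mul, Complex.norm_of_nonneg (delta_pos a b l).le]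
    exact le_mul_of_one_le_left (norm_nonneg _) (one_le_delta a b l)

/-- The nonlinearity of the scheme in Fourier space. -/
noncomputable def nonlin (a b τ : ℝ) (N : ℕ) (ψ : Fin (N + 1) → ℂ) (l : ℤ) : ℂ :=
  dcoeff a b N (fun k => G (stage1 a b τ N ψ k)) l

lemma dcoeff_step (hab : a < b) (hN : 0 < N) (hN2 : Even N) (ψ : Fin (N + 1) → ℂ) {l : ℤ}
    (hl : l ∈ freqs N) : dcoeff a b N (step a b ε τ N ψ) l =
      cis (τ * delta a b l / 2) * (cis (τ * delta a b l / 2) * dcoeff a b N ψ l +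
        ε ^ 2 * τ * (Complex.I * (1 / ((delta a b l : ℝ) : ℂ) * nonlin a b τ N ψ l))) := by
  rw [step, dcoeff_gridMul hab hN hN2 _ _ hl, halfPhase_eq]
  congr 1
  have h : stage2 a b ε τ N ψ = fun j => stage1 a b τ N ψ j + ((ε ^ 2 * τ : ℝ) : ℂ) *
    (Complex.I * gridMul a b N (invDelta a b) (fun k => G (stage1 a b τ N ψ k)) j) := rfl
  rw [h, dcoeff_add, dcoeff_const_mul, dcoeff_const_mul, dcoeff_gridMul hab hN hN2 _ _ hl, stage1,
    dcoeff_gridMul hab hN hN2 _ _ hl, halfPhase_eq, invDelta, nonlin, stage1]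
  push_cast
  rfl

/-- Twisting removes the linear flow from the scheme too, and the two half steps place its
nonlinearity at the midpoint. The increment of the error splits into freezing error, quadrature
error, and difference of the nonlinearities. -/
lemma delta_mul_err_succ_sub (hab : a < b) (hN : 0 < N) (hN2 : Even N) (Λ : Finset ℤ) (n : ℕ)
    {l : ℤ} (hl : l ∈ freqs N) :
    ((delta a b l : ℝ) : ℂ) * err a b ε τ N u₀ u₁ u v (n + 1) l -
      ((delta a b l : ℝ) : ℂ) * err a b ε τ N u₀ u₁ u v n l =
    (((delta a b l : ℝ) : ℂ) * (phi a b u v (n * τ + τ) l - phi a b u v (n * τ) l) -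
      Complex.I * (ε : ℂ) ^ 2 * frozenInt a b u v Λ (n * τ) τ l) +
    Complex.I * (ε : ℂ) ^ 2 * (frozenInt a b u v Λ (n * τ) τ l -
      τ * (cis (-(delta a b l * (n * τ + τ / 2))) *
        fcoeff a b (fun x => frozen a b u v Λ (n * τ) (n * τ + τ / 2) x ^ 3) l)) +
    Complex.I * (ε : ℂ) ^ 2 * τ * (cis (-(delta a b l * (n * τ + τ / 2))) *
      (fcoeff a b (fun x => frozen a b u v Λ (n * τ) (n * τ + τ / 2) x ^ 3) l -
        nonlin a b τ N (psi a b ε τ N u₀ u₁ n) l)) := by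
  have hd := delta_ne_zero a b l
  have e1 : ((n + 1 : ℕ) : ℝ) * τ = n * τ + τ := by push_cast; ring
  have e2 : cis (-(delta a b l * (n * τ + τ))) * (cis (τ * delta a b l / 2) *
      cis (τ * delta a b l / 2)) = cis (-(delta a b l * (n * τ))) := by
    rw [← cis_add, ← cis_add]; congr 1; ring
  have e3 : cis (-(delta a b l * (n * τ + τ))) * cis (τ * delta a b l / 2) =
      cis (-(delta a b l * (n * τ + τ / 2))) := by
    rw [← cis_add]; congr 1; ring
  rw [err, err, e1, psi, dcoeff_step hab hN hN2 _ hl, ← e2, ← e3]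
  field_simp
  ring

lemma frozen_eq_half_add_conj {Λ : Finset ℤ} (hΛ : ∀ l ∈ Λ, -l ∈ Λ) (t r x : ℝ) :
    frozen a b u v Λ t r x = (1 / 2) *
      (∑ l ∈ Λ, cis (delta a b l * r) * phi a b u v t l * mode a b l x +
        (starRingEnd ℂ) (∑ l ∈ Λ, cis (delta a b l * r) * phi a b u v t l * mode a b l x)) := by
  have h : (starRingEnd ℂ) (∑ l ∈ Λ, cis (delta a b l * r) * phi a b u v t l * mode a b l x) =
      ∑ l ∈ Λ, cis (-(delta a b l * r)) * (starRingEnd ℂ) (phi a b u v t (-l)) *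
        mode a b l x := by
    rw [map_sum]
    refine Finset.sum_bij' (fun l _ => -l) (fun l _ => -l) hΛ hΛ (fun l _ => neg_neg l)
      (fun l _ => neg_neg l) fun l _ => ?_
    simp only [map_mul, conj_cis, conj_mode, delta_neg, neg_neg]
  rw [h, frozen_eq, ← Finset.sum_add_distrib, Finset.mul_sum]
  refine Finset.sum_congr rfl fun l _ => ?_
  rw [frozenCoeff]
  ring

/-- The bound for the numerical solution when its energy error is at most one. -/
noncomputable def supConst (a b M : ℝ) : ℝ := 2 * M * deltaSum a b + Real.sqrt (deltaSum a b)

/-- The sup norm is bounded by the sum of the coefficients: δ⁻² decay for the exact part,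
Cauchy-Schwarz against the energy norm for the error. -/
lemma norm_stage1_le (hab : a < b) (hm : 1 ≤ m) (hA : AssumptionA a b S m M u v) {n : ℕ}
    (ht : n * τ ∈ Set.Icc 0 S) (h1 : energyErr a b ε τ N u₀ u₁ u v n ≤ 1) (j : Fin (N + 1)) :
    ‖stage1 a b τ N (psi a b ε τ N u₀ u₁ n) j‖ ≤ supConst a b M := by
  have hM := hA.nonneg (ht.1.trans ht.2)
  rw [stage1, gridMul]
  refine (norm_sum_le _ _).trans ?_
  have h2 : ∀ l, ‖halfPhase a b τ l * dcoeff a b N (psi a b ε τ N u₀ u₁ n) l *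
      mode a b l (grid a b N j)‖ ≤ 2 * M * (delta a b l ^ 2)⁻¹ +
        ‖err a b ε τ N u₀ u₁ u v n l‖ := by
    intro l
    rw [norm_mul, norm_mul, norm_mode, mul_one, halfPhase_eq, norm_cis, one_mul, norm_err,
      norm_sub_rev]
    have h3 := norm_psiHat_le hm hA ht l
    have h4 := norm_sub_norm_le (dcoeff a b N (psi a b ε τ N u₀ u₁ n) l)
      (psiHat a b u v (n * τ) l)
    linarith
  refine (Finset.sum_le_sum fun l _ => h2 l).trans ?_
  rw [Finset.sum_add_distrib, ← Finset.mul_sum, supConst]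
  refine add_le_add (mul_le_mul_of_nonneg_left (sum_inv_delta_sq_le hab _) (by positivity)) ?_
  refine (sum_norm_le hab _ _).trans ?_
  exact mul_le_of_le_one_right (Real.sqrt_nonneg _) h1

lemma mem_freqs_of_abs_lt (hN2 : Even N) {l : ℤ} (h : 6 * |l| < N) : l ∈ freqs N := by
  obtain ⟨k, rfl⟩ := hN2
  rw [freqs, Finset.mem_Ico]
  have e1 := le_abs_self l
  have e2 := neg_abs_le l
  push_cast at h ⊢
  omega

/-- Stability of the nonlinear step. -/
lemma l2_nonlin_sub_le (hab : a < b) (hN : 0 < N) (hN2 : Even N) (hm : 1 ≤ m)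
    (hA : AssumptionA a b S m M u v) {n : ℕ} (ht : n * τ ∈ Set.Icc 0 S)
    (h1 : energyErr a b ε τ N u₀ u₁ u v n ≤ 1) {Λ : Finset ℤ} {ρ : ℝ} (hΛ : ∀ l ∈ Λ, -l ∈ Λ)
    (hΛN : ∀ l ∈ Λ, 6 * |l| < N) (hρ : ∀ l ∉ Λ, (delta a b l)⁻¹ ≤ ρ) (hρ0 : 0 ≤ ρ) :
    l2 (freqs N) (fun l =>
      fcoeff a b (fun x => frozen a b u v Λ (n * τ) (n * τ + τ / 2) x ^ 3) l -
        nonlin a b τ N (psi a b ε τ N u₀ u₁ n) l) ≤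
      3 * supConst a b M ^ 2 *
        (energyErr a b ε τ N u₀ u₁ u v n + ρ ^ (m + 1) * (2 * M)) := by
  have hM := hA.nonneg (ht.1.trans ht.2)
  have hD := deltaSum_nonneg a b
  set ψ := psi a b ε τ N u₀ u₁ n with hψ
  set W : Fin (N + 1) → ℂ := fun j => ∑ l ∈ Λ, cis (delta a b l * (n * τ + τ / 2)) *
    phi a b u v (n * τ) l * mode a b l (grid a b N j) with hW
  set F : Fin (N + 1) → ℂ := fun j =>
    frozen a b u v Λ (n * τ) (n * τ + τ / 2) (grid a b N j) with hF
  have hFW : ∀ j, F j = (1 / 2) * (W j + (starRingEnd ℂ) (W j)) := fun j =>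
    frozen_eq_half_add_conj hΛ _ _ _
  -- Frequencies in Λ lie below N/6, so the cube of the frozen solution is computed exactly on the
  -- grid.
  have hcube : ∀ l ∈ freqs N, fcoeff a b (fun x =>
      frozen a b u v Λ (n * τ) (n * τ + τ / 2) x ^ 3) l = dcoeff a b N (fun j => F j ^ 3) l :=
    fun l hl => (dcoeff_cube_sum_mode hab hN hN2 (waves Λ)
      (fun q => amp a b u v (n * τ) q * cis (waveFreq a b q * (n * τ + τ / 2))) (fun q => q.1)
      (fun q hq => hΛN _ (Finset.mem_product.1 hq).1) hl).symm
  have hdW : ∀ l ∈ freqs N, dcoeff a b N W l =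
      if l ∈ Λ then cis (delta a b l * (n * τ + τ / 2)) * phi a b u v (n * τ) l else 0 := by
    intro l hl
    rw [hW, dcoeff_sum_mode hab hN Λ
      (fun l => cis (delta a b l * (n * τ + τ / 2)) * phi a b u v (n * τ) l) (fun k => k) l]
    exact (Finset.sum_congr rfl fun k hk => if_congr
      (dvd_sub_iff_of_mem_freqs hN2 (mem_freqs_of_abs_lt hN2 (hΛN k hk)) hl) rfl rfl).trans
      (Finset.sum_ite_eq' Λ l _)
  have hpt : ∀ j, ‖F j ^ 3 - G (stage1 a b τ N ψ j)‖ ≤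
      3 * supConst a b M ^ 2 * ‖W j - stage1 a b τ N ψ j‖ := by
    intro j
    rw [G_eq]
    refine (norm_cube_sub_le (A := supConst a b M) ?_ ?_).trans ?_
    · refine (norm_frozen_le hab hm hA ht Λ _ _).trans ?_
      rw [supConst]
      linarith [Real.sqrt_nonneg (deltaSum a b)]
    · exact (norm_half_add_conj_le _).trans (norm_stage1_le hab hm hA ht h1 j)
    · refine mul_le_mul_of_nonneg_left ?_ (by positivity)
      have := norm_half_add_conj_le (W j - stage1 a b τ N ψ j)
      refine le_trans (le_of_eq ?_) this
      rw [hFW, map_sub]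
      congr 1
      ring
  -- Discrete Parseval is used in both directions: to the nodes, where the cube is Lipschitz, and
  -- back.
  have hgrid : l2 (freqs N) (fun l => dcoeff a b N (fun j => F j ^ 3 - G (stage1 a b τ N ψ j)) l) ≤
      3 * supConst a b M ^ 2 *
        l2 (freqs N) (fun l => dcoeff a b N (fun j => W j - stage1 a b τ N ψ j) l) := by
    refine l2_le_of_sq_le (mul_nonneg (by positivity) (l2_nonneg _ _)) ?_
    rw [mul_pow, l2_sq, sum_sq_dcoeff hab hN hN2, sum_sq_dcoeff hab hN hN2, mul_left_comm,
      Finset.mul_sum _ _ ((3 * supConst a b M ^ 2) ^ 2)]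
    refine mul_le_mul_of_nonneg_left (Finset.sum_le_sum fun j _ => ?_) (by positivity)
    rw [← mul_pow]
    exact pow_le_pow_left₀ (norm_nonneg _) (hpt _) 2
  -- On Λ the coefficients differ by `err`; off Λ the frozen part is absent, which adds the tail of
  -- ψ̂.
  have hdiff : l2 (freqs N) (fun l => dcoeff a b N (fun j => W j - stage1 a b τ N ψ j) l) ≤
      energyErr a b ε τ N u₀ u₁ u v n + ρ ^ (m + 1) * (2 * M) := by
    have h2 := l2_high_le hρ hρ0 (l2_psiHat_le hA ht (freqs N))
    have h3 := l2_add_le (freqs N)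
      (fun l => ((‖err a b ε τ N u₀ u₁ u v n l‖ : ℝ) : ℂ))
      (fun l => ((‖if l ∈ Λ then 0 else psiHat a b u v (n * τ) l‖ : ℝ) : ℂ))
    have h4 : ∀ f : ℤ → ℂ, l2 (freqs N) (fun l => ((‖f l‖ : ℝ) : ℂ)) = l2 (freqs N) f := fun f =>
      l2_congr fun l _ => by rw [Complex.norm_real, norm_norm]
    rw [h4, h4] at h3
    refine le_trans (l2_mono fun l hl => ?_) (h3.trans (add_le_add (l2_err_le n) h2))
    rw [← Complex.ofReal_add, Complex.norm_of_nonneg (by positivity), dcoeff_sub, hdW l hl, stage1,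
      dcoeff_gridMul hab hN hN2 _ _ hl, halfPhase_eq, norm_err]
    have e : cis (delta a b l * (n * τ + τ / 2)) * phi a b u v (n * τ) l =
        cis (τ * delta a b l / 2) * psiHat a b u v (n * τ) l := by
      rw [psiHat_eq, ← mul_assoc, ← cis_add]
      congr 2
      ring
    rw [e]
    split_ifs
    · rw [← mul_sub, norm_mul, norm_cis, one_mul, norm_zero, add_zero]
    · rw [zero_sub, norm_neg, norm_mul, norm_cis, one_mul]
      have := norm_sub_norm_le (dcoeff a b N ψ l) (psiHat a b u v (n * τ) l)
      rw [norm_sub_rev] at this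
      linarith
  refine le_trans (l2_congr fun l hl => ?_).le
    (hgrid.trans (mul_le_mul_of_nonneg_left hdiff (by positivity)))
  rw [hcube l hl, dcoeff_sub, nonlin]

end Scheme

/-! ### Recursion for the energy error and Gronwall. -/

section Energy
variable {a b ε S M τ : ℝ} {m N : ℕ} {u₀ u₁ : ℝ → ℝ} {u v : ℝ → ℝ → ℝ}

lemma energyErr_nonneg (n : ℕ) : 0 ≤ energyErr a b ε τ N u₀ u₁ u v n := l2_nonneg _ _

/-- The bound for the sum of all local errors that do not cancel. -/
noncomputable def localErr (a b ε M ρ : ℝ) (m : ℕ) (τ : ℝ) : ℝ :=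
  3 * supConst a b M ^ 2 * (frozenErr a b ε M ρ m τ + ρ ^ (m + 1) * (2 * M))

lemma energyErr_le_add_sum (hab : a < b) (hN : 0 < N) (hN2 : Even N) (hm : 1 ≤ m)
    (hsol : IsSolution a b ε S u₀ u₁ u v) (hA : AssumptionA a b S m M u v) {B : ℝ} {n : ℕ}
    (hτ : 0 ≤ τ) (hn : n * τ ≤ S) (hB0 : 0 ≤ B)
    (h1 : ∀ k < n, energyErr a b ε τ N u₀ u₁ u v k ≤ 1) {Λ : Finset ℤ} {ρ : ℝ}
    (hΛ : ∀ l ∈ Λ, -l ∈ Λ) (hΛN : ∀ l ∈ Λ, 6 * |l| < N) (hρ : ∀ l ∉ Λ, (delta a b l)⁻¹ ≤ ρ)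
    (hρ0 : 0 ≤ ρ)
    (hB : ∀ l, ∀ r ∈ waves Λ ×ˢ waves Λ ×ˢ waves Λ, r.1.1 + r.2.1.1 + r.2.2.1 = l → ∀ k ≤ n,
      ‖quadErr (resonance a b r l) τ‖ *
        ‖∑ j ∈ Finset.range k, cis (resonance a b r l * τ) ^ j‖ ≤ B * |resonance a b r l|) :
    energyErr a b ε τ N u₀ u₁ u v n ≤
      energyErr a b ε τ N u₀ u₁ u v 0 + ε ^ 2 * S * localErr a b ε M ρ m τ +
        ε ^ 2 * (B * quadConst a b M (ε ^ 2 * S) * Real.sqrt (deltaSum a b)) +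
        3 * supConst a b M ^ 2 * (ε ^ 2 * τ) *
          ∑ k ∈ Finset.range n, energyErr a b ε τ N u₀ u₁ u v k := by
  have hS : 0 ≤ S := (by positivity : (0 : ℝ) ≤ n * τ).trans hn
  have hM := hA.nonneg hS
  have hD := deltaSum_nonneg a b
  have hK := cubeConst_nonneg (a := a) (b := b) hM
  have hF : 0 ≤ frozenErr a b ε M ρ m τ := by rw [frozenErr]; positivity
  have hkS : ∀ k < n, (k : ℝ) * τ + τ ≤ S := fun k hk => by
    have : ((k : ℝ) + 1) ≤ n := by exact_mod_cast hk
    have : ((k : ℝ) + 1) * τ ≤ n * τ := by gcongr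
    linarith
  have hIε : ‖Complex.I * (ε : ℂ) ^ 2‖ = ε ^ 2 := by
    rw [norm_mul, Complex.norm_I, one_mul, norm_pow, Complex.norm_real, Real.norm_eq_abs, sq_abs]
  set X : ℕ → ℤ → ℂ := fun k l =>
    ((delta a b l : ℝ) : ℂ) * (phi a b u v (k * τ + τ) l - phi a b u v (k * τ) l) -
      Complex.I * (ε : ℂ) ^ 2 * frozenInt a b u v Λ (k * τ) τ l with hX
  set Q : ℕ → ℤ → ℂ := fun k l => frozenInt a b u v Λ (k * τ) τ l -
      τ * (cis (-(delta a b l * (k * τ + τ / 2))) *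
        fcoeff a b (fun x => frozen a b u v Λ (k * τ) (k * τ + τ / 2) x ^ 3) l) with hQ
  set Y : ℕ → ℤ → ℂ := fun k l => cis (-(delta a b l * (k * τ + τ / 2))) *
      (fcoeff a b (fun x => frozen a b u v Λ (k * τ) (k * τ + τ / 2) x ^ 3) l -
        nonlin a b τ N (psi a b ε τ N u₀ u₁ k) l) with hY
  -- The sums of X and Y are estimated term by term, but that of Q is kept whole, because its
  -- cancellation is visible only after summation over the steps.
  have hsum : ∀ l ∈ freqs N, ((delta a b l : ℝ) : ℂ) * err a b ε τ N u₀ u₁ u v n l =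
      ((((delta a b l : ℝ) : ℂ) * err a b ε τ N u₀ u₁ u v 0 l +
        ∑ k ∈ Finset.range n, X k l) +
        Complex.I * (ε : ℂ) ^ 2 * ∑ k ∈ Finset.range n, Q k l) +
        (Complex.I * (ε : ℂ) ^ 2 * τ) * ∑ k ∈ Finset.range n, Y k l := by
    intro l hl
    have h2 := Finset.sum_range_sub
      (fun k => ((delta a b l : ℝ) : ℂ) * err a b ε τ N u₀ u₁ u v k l) n
    rw [Finset.sum_congr rfl fun k _ => delta_mul_err_succ_sub hab hN hN2 Λ k hl,
      Finset.sum_add_distrib, Finset.sum_add_distrib, ← Finset.mul_sum, ← Finset.mul_sum] at h2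
    linear_combination -h2
  have hXle : l2 (freqs N) (fun l => ∑ k ∈ Finset.range n, X k l) ≤
      ε ^ 2 * S * (3 * supConst a b M ^ 2 * frozenErr a b ε M ρ m τ) := by
    refine (l2_sum_le _ _ _).trans ?_
    have hk : ∀ k ∈ Finset.range n, l2 (freqs N) (X k) ≤
        ε ^ 2 * (3 * supConst a b M ^ 2 * frozenErr a b ε M ρ m τ) * τ := fun k hk => by
      refine (l2_local_error_le hab hm hsol hA (t := k * τ) (by positivity) hτ
        (hkS k (Finset.mem_range.1 hk)) hρ hρ0 (freqs N)).trans ?_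
      have : 2 * M * deltaSum a b ≤ supConst a b M := by
        rw [supConst]; linarith [Real.sqrt_nonneg (deltaSum a b)]
      gcongr
    refine (Finset.sum_le_sum hk).trans ?_
    rw [Finset.sum_const, Finset.card_range, nsmul_eq_mul]
    calc _ = ε ^ 2 * (n * τ) * (3 * supConst a b M ^ 2 * frozenErr a b ε M ρ m τ) := by ring
      _ ≤ _ := by gcongr
  have hQle : l2 (freqs N) (fun l => ∑ k ∈ Finset.range n, Q k l) ≤
      B * quadConst a b M (ε ^ 2 * S) * Real.sqrt (deltaSum a b) :=
    l2_le_of_le_inv_delta hab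
      (mul_nonneg hB0 (quadConst_nonneg hM (by positivity)))
      fun l _ => norm_sum_quad_le hab hm hsol hA hτ hn hB0 Λ l (hB l)
  have hYle : l2 (freqs N) (fun l => ∑ k ∈ Finset.range n, Y k l) ≤
      3 * supConst a b M ^ 2 * (∑ k ∈ Finset.range n, energyErr a b ε τ N u₀ u₁ u v k) +
        n * (3 * supConst a b M ^ 2 * (ρ ^ (m + 1) * (2 * M))) := by
    refine (l2_sum_le _ _ _).trans ?_
    have hk : ∀ k ∈ Finset.range n, l2 (freqs N) (Y k) ≤ 3 * supConst a b M ^ 2 *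
        (energyErr a b ε τ N u₀ u₁ u v k + ρ ^ (m + 1) * (2 * M)) := fun k hk => by
      have hk' := Finset.mem_range.1 hk
      refine le_trans (l2_congr fun l _ => ?_).le (l2_nonlin_sub_le hab hN hN2 hm hA
        (n := k) ⟨by positivity, by linarith [hkS k hk']⟩ (h1 k hk') hΛ hΛN hρ hρ0)
      rw [hY, norm_mul, norm_cis, one_mul]
    refine (Finset.sum_le_sum hk).trans (le_of_eq ?_)
    rw [← Finset.mul_sum, Finset.sum_add_distrib, Finset.sum_const, Finset.card_range,
      nsmul_eq_mul]
    ring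
  have htri : energyErr a b ε τ N u₀ u₁ u v n ≤ energyErr a b ε τ N u₀ u₁ u v 0 +
      l2 (freqs N) (fun l => ∑ k ∈ Finset.range n, X k l) +
      ε ^ 2 * l2 (freqs N) (fun l => ∑ k ∈ Finset.range n, Q k l) +
      ε ^ 2 * τ * l2 (freqs N) (fun l => ∑ k ∈ Finset.range n, Y k l) := by
    have e1 : ‖Complex.I * (ε : ℂ) ^ 2 * τ‖ = ε ^ 2 * τ := by
      rw [norm_mul, hIε, Complex.norm_of_nonneg hτ]
    rw [← e1, ← l2_const_mul, ← hIε, ← l2_const_mul]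
    refine (l2_congr fun l hl => by rw [hsum l hl]).le.trans ((l2_add_le _ _ _).trans ?_)
    refine add_le_add ((l2_add_le _ _ _).trans ?_) le_rfl
    refine add_le_add ((l2_add_le _ _ _).trans ?_) le_rfl
    rfl
  have e2 : ε ^ 2 * τ * (n * (3 * supConst a b M ^ 2 * (ρ ^ (m + 1) * (2 * M)))) ≤
      ε ^ 2 * S * (3 * supConst a b M ^ 2 * (ρ ^ (m + 1) * (2 * M))) := by
    calc _ = ε ^ 2 * (n * τ) * (3 * supConst a b M ^ 2 * (ρ ^ (m + 1) * (2 * M))) := by ring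
      _ ≤ _ := by gcongr
  have e3 := mul_le_mul_of_nonneg_left hQle (sq_nonneg ε)
  have e4 := mul_le_mul_of_nonneg_left hYle (by positivity : 0 ≤ ε ^ 2 * τ)
  rw [localErr]
  linarith

/-- The discrete Gronwall inequality. -/
lemma gronwall_sum {y : ℕ → ℝ} {A K : ℝ} {n : ℕ} (hK : 0 ≤ K)
    (h : ∀ k ≤ n, y k ≤ A + K * ∑ j ∈ Finset.range k, y j) {k : ℕ} (hk : k ≤ n) :
    y k ≤ A * (1 + K) ^ k := by
  induction k using Nat.strong_induction_on with
  | _ k ih =>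
    refine (h k hk).trans ?_
    have h1 : ∑ j ∈ Finset.range k, y j ≤ ∑ j ∈ Finset.range k, A * (1 + K) ^ j :=
      Finset.sum_le_sum fun j hj => ih j (Finset.mem_range.1 hj)
        ((Finset.mem_range.1 hj).le.trans hk)
    have h2 := geom_sum_mul (1 + K) k
    rw [← Finset.mul_sum] at h1
    rw [add_sub_cancel_left] at h2
    have h3 := mul_le_mul_of_nonneg_left h1 hK
    have h4 : K * (A * ∑ j ∈ Finset.range k, (1 + K) ^ j) = A * ((1 + K) ^ k - 1) := by
      rw [← h2]; ring
    linarith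

lemma gronwall_sum_exp {y : ℕ → ℝ} {A K : ℝ} {n : ℕ} (hA : 0 ≤ A) (hK : 0 ≤ K)
    (h : ∀ k ≤ n, y k ≤ A + K * ∑ j ∈ Finset.range k, y j) {k : ℕ} (hk : k ≤ n) :
    y k ≤ A * Real.exp (K * n) := by
  refine (gronwall_sum hK h hk).trans (mul_le_mul_of_nonneg_left ?_ hA)
  have h1 : 1 + K ≤ Real.exp K := by linarith [Real.add_one_le_exp K]
  calc (1 + K) ^ k ≤ Real.exp K ^ k := by gcongr
    _ = Real.exp (K * k) := by rw [← Real.exp_nat_mul]; congr 1; ring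
    _ ≤ _ := Real.exp_le_exp.2 (by gcongr)

/-- A bound that is valid as long as the previous values are at most one, and forces the values to
be at most one, holds for ever. -/
lemma le_one_of_gronwall {y : ℕ → ℝ} {A K : ℝ} {n : ℕ} (hA : 0 ≤ A) (hK : 0 ≤ K)
    (h : ∀ k ≤ n, (∀ j < k, y j ≤ 1) → y k ≤ A + K * ∑ j ∈ Finset.range k, y j)
    (hs : A * Real.exp (K * n) ≤ 1) {k : ℕ} (hk : k ≤ n) : y k ≤ 1 := by
  induction k using Nat.strong_induction_on with
  | _ k ih =>
    have h1 : ∀ j < k, y j ≤ 1 := fun j hj => ih j hj (hj.le.trans hk)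
    have h2 : y k ≤ A * Real.exp (K * k) := gronwall_sum_exp (n := k) hA hK
      (fun i hi => h i (hi.trans hk) fun j hj => h1 j (hj.trans_le hi)) le_rfl
    refine h2.trans (le_trans ?_ hs)
    gcongr

end Energy

/-! ### The cut-off and the time step restriction. -/

section Parameters
variable {a b τ₀ : ℝ} {N : ℕ}

lemma mesh_pos (hab : a < b) (hN : 0 < N) : 0 < mesh a b N :=
  div_pos (sub_pos.2 hab) (by exact_mod_cast hN)

lemma abs_mu_eq (hab : a < b) (l : ℤ) : |mu a b l| = 2 * Real.pi * |(l : ℝ)| / (b - a) := by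
  rw [mu, abs_div, abs_mul, abs_of_pos (sub_pos.2 hab), abs_of_pos Real.two_pi_pos]

/-- From |l| ≥ N/6 follows |μ_l| ≥ (π/3) N/(b-a) ≥ h⁻¹. -/
lemma inv_delta_le_mesh (hab : a < b) (hN : 0 < N) {l : ℤ} (h : (N : ℤ) ≤ 6 * |l|) :
    (delta a b l)⁻¹ ≤ mesh a b N := by
  have hb : 0 < b - a := sub_pos.2 hab
  have hN' : (0 : ℝ) < N := by exact_mod_cast hN
  have h' : (N : ℝ) ≤ 6 * |(l : ℝ)| := by exact_mod_cast h
  rw [inv_le_comm₀ (delta_pos a b l) (mesh_pos hab hN), mesh, inv_div]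
  refine le_trans ?_ (abs_mu_le_delta a b l)
  rw [abs_mu_eq hab]
  have := Real.pi_gt_three
  gcongr
  nlinarith [abs_nonneg (l : ℝ)]

lemma inv_delta_le_of_lt (hab : a < b) (hτ₀ : 0 < τ₀) {l : ℤ} (h : 1 < 3 * |(l : ℝ)| * τ₀) :
    (delta a b l)⁻¹ ≤ (b - a) * τ₀ := by
  have hb : 0 < b - a := sub_pos.2 hab
  rw [inv_le_iff_one_le_mul₀ (delta_pos a b l)]
  have h1 := abs_mu_le_delta a b l
  rw [abs_mu_eq hab, div_le_iff₀ hb] at h1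
  have := Real.pi_gt_three
  have h2 : 3 * |(l : ℝ)| ≤ 2 * Real.pi * |(l : ℝ)| := by nlinarith [abs_nonneg (l : ℝ)]
  nlinarith

/-- The frequencies that are resolved both by the grid and by the cut-off `1/(3τ₀)`. -/
noncomputable def lowFreqs (N : ℕ) (τ₀ : ℝ) : Finset ℤ :=
  (freqs N).filter fun l => 6 * |l| < N ∧ 3 * |(l : ℝ)| * τ₀ ≤ 1

lemma neg_mem_lowFreqs (hN2 : Even N) {l : ℤ} (h : l ∈ lowFreqs N τ₀) : -l ∈ lowFreqs N τ₀ := by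
  rw [lowFreqs, Finset.mem_filter] at h ⊢
  have h1 : 6 * |(-l)| < (N : ℤ) := by rw [abs_neg]; exact h.2.1
  exact ⟨mem_freqs_of_abs_lt hN2 h1, h1, by push_cast; rw [abs_neg]; exact h.2.2⟩

lemma inv_delta_le_of_notMem_lowFreqs (hab : a < b) (hN : 0 < N) (hN2 : Even N) (hτ₀ : 0 < τ₀)
    {l : ℤ} (h : l ∉ lowFreqs N τ₀) : (delta a b l)⁻¹ ≤ mesh a b N + (b - a) * τ₀ := by
  have hb : 0 < b - a := sub_pos.2 hab
  have hh := mesh_pos hab hN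
  rcases lt_or_ge (6 * |l|) (N : ℤ) with h1 | h1
  · have h2 : 1 < 3 * |(l : ℝ)| * τ₀ := by
      by_contra h3
      exact h (Finset.mem_filter.2 ⟨mem_freqs_of_abs_lt hN2 h1, h1, not_lt.1 h3⟩)
    linarith [inv_delta_le_of_lt hab hτ₀ h2]
  · have : 0 < (b - a) * τ₀ := by positivity
    linarith [inv_delta_le_mesh hab hN h1]

lemma delta_mul_le_sqrt (hab : a < b) (hτ₀ : 0 < τ₀) {l : ℤ} (h : |(l : ℝ)| * τ₀ ≤ 1) :
    delta a b l * ((b - a) * τ₀) ≤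
      Real.sqrt (τ₀ ^ 2 * (b - a) ^ 2 + 4 * Real.pi ^ 2 * (1 + τ₀ ^ 2)) := by
  have hb : 0 < b - a := sub_pos.2 hab
  refine Real.le_sqrt_of_sq_le ?_
  have h1 : ((l : ℝ)) ^ 2 * τ₀ ^ 2 ≤ 1 := by
    rw [← sq_abs, ← mul_pow]
    exact pow_le_one₀ (by positivity) h
  have h2 : mu a b l ^ 2 * (b - a) ^ 2 = 4 * Real.pi ^ 2 * (l : ℝ) ^ 2 := by
    rw [mu]; field_simp; ring
  have h3 : (delta a b l * ((b - a) * τ₀)) ^ 2 =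
      τ₀ ^ 2 * (b - a) ^ 2 + 4 * Real.pi ^ 2 * ((l : ℝ) ^ 2 * τ₀ ^ 2) := by
    rw [mul_pow, delta_sq]
    linear_combination τ₀ ^ 2 * h2
  rw [h3]
  have h4 : 0 < 4 * Real.pi ^ 2 := by have := Real.pi_pos; positivity
  nlinarith [mul_le_mul_of_nonneg_left h1 h4.le, mul_nonneg h4.le (sq_nonneg τ₀)]

lemma abs_resonance_mul_le {α τ : ℝ} (hab : a < b) (hτ₀ : 0 < τ₀) (hτ : 0 < τ)
    (hα : τ < stepBound a b α τ₀) {r : (ℤ × Bool) × (ℤ × Bool) × (ℤ × Bool)}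
    (hr : r ∈ waves (lowFreqs N τ₀) ×ˢ waves (lowFreqs N τ₀) ×ˢ waves (lowFreqs N τ₀)) {l : ℤ}
    (hl : r.1.1 + r.2.1.1 + r.2.2.1 = l) :
    |resonance a b r l * τ / 2| ≤ α * Real.pi := by
  have hb : 0 < b - a := sub_pos.2 hab
  have hp := Real.pi_pos
  set R := Real.sqrt (τ₀ ^ 2 * (b - a) ^ 2 + 4 * Real.pi ^ 2 * (1 + τ₀ ^ 2)) with hR
  have hR0 : 0 < R := Real.sqrt_pos.2 (by positivity)
  have hlow : ∀ q ∈ waves (lowFreqs N τ₀), 3 * |(q.1 : ℝ)| * τ₀ ≤ 1 := fun q hq =>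
    (Finset.mem_filter.1 (Finset.mem_product.1 hq).1).2.2
  simp only [Finset.mem_product] at hr
  have h1 := hlow _ hr.1
  have h2 := hlow _ hr.2.1
  have h3 := hlow _ hr.2.2
  -- This is the purpose of the 3 in the cut-off: the sum of three retained frequencies still
  -- satisfies |l|τ₀ ≤ 1, so all four δ in the resonance obey the same bound. Together they give
  -- |Ω|(b-a)τ₀ ≤ 4R, which the step bound turns into |Ωτ/2| ≤ απ.
  have h4 : |(l : ℝ)| * τ₀ ≤ 1 := by
    have e : (l : ℝ) = r.1.1 + r.2.1.1 + r.2.2.1 := by rw [← hl]; push_cast; ring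
    have := abs_add_three (r.1.1 : ℝ) r.2.1.1 r.2.2.1
    rw [e]
    nlinarith
  have hn : ∀ x : ℝ, 0 ≤ |x| * τ₀ := fun x => by positivity
  have d1 := delta_mul_le_sqrt hab hτ₀ (l := r.1.1) (by linarith [hn r.1.1])
  have d2 := delta_mul_le_sqrt hab hτ₀ (l := r.2.1.1) (by linarith [hn r.2.1.1])
  have d3 := delta_mul_le_sqrt hab hτ₀ (l := r.2.2.1) (by linarith [hn r.2.2.1])
  have d4 := delta_mul_le_sqrt hab hτ₀ h4
  rw [← hR] at d1 d2 d3 d4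
  have h5 := abs_resonance_le (a := a) (b := b) r l
  have hc : 0 < (b - a) * τ₀ := by positivity
  have h6 : |resonance a b r l| * ((b - a) * τ₀) ≤ 4 * R := by
    have := mul_le_mul_of_nonneg_right h5 hc.le
    linarith
  rw [stepBound, ← hR, ← mul_div_assoc, lt_div_iff₀ (by positivity)] at hα
  rw [abs_div, abs_mul, abs_of_pos hτ, abs_two]
  refine le_of_mul_le_mul_right ?_ hc
  have h7 := mul_le_mul_of_nonneg_right h6 hτ.le
  linarith

/-- The square root is at least 2π. Hence a small τ₀ forces a small τ, independently of α. -/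
lemma stepBound_le {α : ℝ} (hab : a < b) (hτ₀ : 0 < τ₀) (hα1 : α < 1) :
    stepBound a b α τ₀ ≤ (b - a) * τ₀ := by
  have hb : 0 < b - a := sub_pos.2 hab
  have hp := Real.pi_pos
  have hR : 2 * Real.pi ≤ Real.sqrt (τ₀ ^ 2 * (b - a) ^ 2 + 4 * Real.pi ^ 2 * (1 + τ₀ ^ 2)) := by
    refine Real.le_sqrt_of_sq_le ?_
    have : 0 ≤ τ₀ ^ 2 * (b - a) ^ 2 + 4 * Real.pi ^ 2 * τ₀ ^ 2 := by positivity
    linarith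
  set R := Real.sqrt (τ₀ ^ 2 * (b - a) ^ 2 + 4 * Real.pi ^ 2 * (1 + τ₀ ^ 2))
  rw [stepBound, ← mul_div_assoc, div_le_iff₀ (by linarith)]
  have hc : 0 < (b - a) * τ₀ := by positivity
  calc α * (Real.pi * (b - a) * τ₀) ≤ 1 * (Real.pi * (b - a) * τ₀) := by gcongr
    _ = (b - a) * τ₀ * Real.pi := by ring
    _ ≤ _ := mul_le_mul_of_nonneg_left (by linarith) hc.le

end Parameters

/-! ### Aliasing and the interpolation error. -/

section Aliasing
variable {a b M : ℝ} {N s : ℕ}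

/-- The indicator of the aliases `k ≠ l` of the frequency `l`. -/
def aliasInd (N : ℕ) (k l : ℤ) : ℝ := if (N : ℤ) ∣ k - l ∧ k ≠ l then 1 else 0

lemma aliasInd_nonneg (N : ℕ) (k l : ℤ) : 0 ≤ aliasInd N k l := by rw [aliasInd]; split_ifs <;> norm_num

lemma aliasInd_sq (N : ℕ) (k l : ℤ) : aliasInd N k l ^ 2 = aliasInd N k l := by
  rw [aliasInd]; split_ifs <;> norm_num

/-- The sum `∑_{j ≠ 0} j⁻²`. -/
noncomputable def aliasConst : ℝ := ∑' j : ℤ, 1 / (j : ℝ) ^ 2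

lemma aliasConst_nonneg : 0 ≤ aliasConst := tsum_nonneg fun _ => by positivity

lemma le_six_mul_abs_of_notMem_freqs (hN2 : Even N) {l : ℤ} (h : l ∉ freqs N) :
    (N : ℤ) ≤ 6 * |l| := by
  by_contra h1
  exact h (mem_freqs_of_abs_lt hN2 (not_le.1 h1))

lemma abs_le_of_mem_freqs (hN2 : Even N) {l : ℤ} (h : l ∈ freqs N) : 2 * |l| ≤ N := by
  obtain ⟨k, rfl⟩ := hN2
  rw [freqs, Finset.mem_Ico] at h
  push_cast at h ⊢
  rcases abs_cases l with ⟨e, _⟩ | ⟨e, _⟩ <;> rw [e] <;> omega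

lemma sum_aliasInd_le_one (hN2 : Even N) (k : ℤ) : ∑ l ∈ freqs N, aliasInd N k l ≤ 1 := by
  simp only [aliasInd]
  rw [← Finset.sum_filter, Finset.sum_const, nsmul_eq_mul, mul_one]
  have : ((freqs N).filter fun l => (N : ℤ) ∣ k - l ∧ k ≠ l).card ≤ 1 := by
    refine Finset.card_le_one.2 fun x hx y hy => ?_
    simp only [Finset.mem_filter] at hx hy
    refine (dvd_sub_iff_of_mem_freqs hN2 hx.1 hy.1).1 ?_
    have := dvd_sub hy.2.1 hx.2.1
    rwa [show k - y - (k - x) = x - y by ring] at this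
  exact_mod_cast this

/-- As |l| ≤ N/2, the alias l + Nj has modulus at least N|j|/2, hence δ ≥ |j|/h. -/
lemma inv_delta_le_of_aliasInd (hab : a < b) (hN : 0 < N) (hN2 : Even N) {j l : ℤ} (hj : j ≠ 0)
    (hl : l ∈ freqs N) :
    (delta a b (l + N * j))⁻¹ ≤ mesh a b N * (1 / |(j : ℝ)|) ∧
      (delta a b (l + N * j))⁻¹ ≤ mesh a b N := by
  have hb : 0 < b - a := sub_pos.2 hab
  have hN' : (0 : ℝ) < N := by exact_mod_cast hN
  have h1 : (1 : ℝ) ≤ |(j : ℝ)| := by exact_mod_cast Int.one_le_abs hj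
  have h2 : 2 * |(l : ℝ)| ≤ N := by exact_mod_cast abs_le_of_mem_freqs hN2 hl
  have h3 : (N : ℝ) * |(j : ℝ)| ≤ 2 * |((l + N * j : ℤ) : ℝ)| := by
    have h4 := abs_sub_abs_le_abs_sub ((N : ℝ) * j) (-(l : ℝ))
    rw [abs_neg, abs_mul, abs_of_pos hN', sub_neg_eq_add, add_comm ((N : ℝ) * j)] at h4
    push_cast
    nlinarith
  have h5 : (delta a b (l + N * j))⁻¹ ≤ mesh a b N * (1 / |(j : ℝ)|) := by
    have h6 : 0 < mesh a b N * (1 / |(j : ℝ)|) :=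
      mul_pos (mesh_pos hab hN) (by positivity)
    rw [inv_le_comm₀ (delta_pos a b _) h6]
    refine le_trans ?_ (abs_mu_le_delta a b _)
    rw [abs_mu_eq hab, mesh, mul_one_div, div_div, inv_div]
    have := Real.pi_gt_three
    refine div_le_div_of_nonneg_right ?_ hb.le
    nlinarith [abs_nonneg ((l + N * j : ℤ) : ℝ)]
  refine ⟨h5, h5.trans ?_⟩
  refine mul_le_of_le_one_right (mesh_pos hab hN).le ?_
  rw [div_le_one (by linarith)]
  exact h1

/-- The aliases of l are l + Nj with j ≠ 0. One of the s factors δ⁻¹ is bounded by h/|j|, which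
makes the squares summable in j; the others are bounded by h. -/
lemma sum_aliasInd_mul_le (hab : a < b) (hN : 0 < N) (hN2 : Even N) (hs : 1 ≤ s) {l : ℤ}
    (hl : l ∈ freqs N) (T : Finset ℤ) :
    ∑ k ∈ T, (aliasInd N k l * (delta a b k ^ s)⁻¹) ^ 2 ≤ (mesh a b N ^ s) ^ 2 * aliasConst := by
  have hh := mesh_pos hab hN
  have hN' : (N : ℤ) ≠ 0 := by exact_mod_cast hN.ne'
  have hite : ∀ k, (aliasInd N k l * (delta a b k ^ s)⁻¹) ^ 2 =
      if (N : ℤ) ∣ k - l ∧ k ≠ l then ((delta a b k ^ s)⁻¹) ^ 2 else 0 := fun k => by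
    rw [mul_pow, aliasInd_sq, aliasInd]
    split_ifs <;> simp
  simp only [hite]
  rw [← Finset.sum_filter]
  set T' := T.filter fun k => (N : ℤ) ∣ k - l ∧ k ≠ l with hT'
  have hmem : ∀ k ∈ T', k = l + N * ((k - l) / N) ∧ (k - l) / N ≠ 0 := by
    intro k hk
    simp only [hT', Finset.mem_filter] at hk
    have h1 := Int.mul_ediv_cancel' hk.2.1
    refine ⟨by omega, fun h0 => hk.2.2 ?_⟩
    rw [h0, mul_zero] at h1
    omega
  have hinj : Set.InjOn (fun k => (k - l) / (N : ℤ)) T' := by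
    intro x hx y hy hxy
    have hx' := (hmem x hx).1
    have hy' := (hmem y hy).1
    simp only at hxy
    rw [hxy] at hx'
    exact hx'.trans hy'.symm
  calc ∑ k ∈ T', ((delta a b k ^ s)⁻¹) ^ 2
      ≤ ∑ k ∈ T', (mesh a b N ^ s) ^ 2 * (1 / (((k - l) / (N : ℤ) : ℤ) : ℝ) ^ 2) := by
        refine Finset.sum_le_sum fun k hk => ?_
        obtain ⟨h1, h2⟩ := hmem k hk
        obtain ⟨h3, h4⟩ := inv_delta_le_of_aliasInd hab hN hN2 h2 hl
        rw [← h1] at h3 h4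
        have hd := inv_pos.2 (delta_pos a b k)
        have h5 : (delta a b k ^ s)⁻¹ ≤ mesh a b N ^ s * (1 / |(((k - l) / (N : ℤ) : ℤ) : ℝ)|) := by
          obtain ⟨p, rfl⟩ := Nat.exists_eq_add_of_le' hs
          rw [← inv_pow, pow_succ, pow_succ, mul_assoc]
          gcongr
        calc _ ≤ (mesh a b N ^ s * (1 / |(((k - l) / (N : ℤ) : ℤ) : ℝ)|)) ^ 2 := by
              have := delta_pos a b k
              gcongr
          _ = _ := by rw [mul_pow, div_pow, one_pow, sq_abs]
    _ = ∑ j ∈ T'.image (fun k => (k - l) / (N : ℤ)),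
          (mesh a b N ^ s) ^ 2 * (1 / (j : ℝ) ^ 2) := by
        rw [Finset.sum_image hinj]
    _ ≤ _ := by
        rw [← Finset.mul_sum]
        exact mul_le_mul_of_nonneg_left
          ((Real.summable_one_div_int_pow.2 one_lt_two).sum_le_tsum _ fun _ _ => by positivity)
          (by positivity)

lemma grid_mem_Icc (hab : a < b) (hN : 0 < N) (j : Fin (N + 1)) :
    grid a b N j ∈ Set.Icc a b := by
  have hN' : (0 : ℝ) < N := by exact_mod_cast hN
  have h1 : ((j : ℕ) : ℝ) ≤ N := by exact_mod_cast Nat.le_of_lt_succ j.2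
  have hh := mesh_pos hab hN
  have h2 : (N : ℝ) * mesh a b N = b - a := by rw [mesh]; field_simp
  have h3 : 0 ≤ ((j : ℕ) : ℝ) * mesh a b N := by positivity
  have h4 := mul_le_mul_of_nonneg_right h1 hh.le
  exact ⟨by rw [grid]; linarith, by rw [grid]; linarith⟩

lemma hasSum_of_eq {f g : ℤ → ℂ} {c : ℂ} (h : HasSum f c) (e : ∀ k, g k = f k) : HasSum g c := by
  rwa [funext e]

/-- The Fourier series is evaluated at the nodes, where exactly the modes with k ≡ l mod N coincide.
Subtracting the term k = l leaves the aliases. -/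
lemma hasSum_dcoeff_sub (hab : a < b) (hN : 0 < N) {f : ℝ → ℂ}
    (hf : ContinuousOn f (Set.Icc a b)) (hs : Summable fun l => ‖fcoeff a b f l‖) (l : ℤ) :
    HasSum (fun k => (aliasInd N k l : ℂ) * fcoeff a b f k)
      (dcoeff a b N (fun j => f (grid a b N j)) l - fcoeff a b f l) := by
  have h1 : HasSum (fun k => fcoeff a b f k * (if (N : ℤ) ∣ k - l then (1 : ℂ) else 0))
      (dcoeff a b N (fun j => f (grid a b N j)) l) := by
    have h2 : ∀ j : Fin N, HasSum (fun k => fcoeff a b f k * mode a b k (grid a b N j.castSucc) *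
        mode a b (-l) (grid a b N j.castSucc))
        (f (grid a b N j.castSucc) * mode a b (-l) (grid a b N j.castSucc)) :=
      fun j => (hasSum_fourier hab hf hs (grid_mem_Icc hab hN _)).mul_right _
    have h3 := (hasSum_sum (s := Finset.univ) fun j _ => h2 j).mul_left (1 / (N : ℂ))
    rw [← dcoeff_eq a b N (fun j => f (grid a b N j))] at h3
    refine hasSum_of_eq h3 fun k => ?_
    rw [← dcoeff_mode hab hN, dcoeff_eq, Finset.mul_sum, Finset.mul_sum, Finset.mul_sum]
    refine Finset.sum_congr rfl fun j _ => ?_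
    ring
  have h4 : HasSum (fun k => if k = l then fcoeff a b f l else 0) (fcoeff a b f l) :=
    hasSum_ite_eq l _
  refine hasSum_of_eq (h1.sub h4) fun k => ?_
  rw [aliasInd]
  by_cases hk : k = l
  · simp [hk]
  · by_cases hd : (N : ℤ) ∣ k - l <;> simp [hk, hd]

/-- The interpolation error on the grid frequencies. -/
lemma l2_fcoeff_sub_dcoeff_le (hab : a < b) (hN : 0 < N) (hN2 : Even N) (hs : 1 ≤ s) {f : ℝ → ℂ}
    (hf : ContinuousOn f (Set.Icc a b)) (h : MemH a b s f) (hM : normH a b s f ≤ M) :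
    l2 (freqs N) (fun l => fcoeff a b f l - dcoeff a b N (fun j => f (grid a b N j)) l) ≤
      Real.sqrt aliasConst * M * mesh a b N ^ s := by
  have hh := mesh_pos hab hN
  have hM0 : 0 ≤ M := (normH_nonneg _ _).trans hM
  have hlim : Filter.Tendsto (fun T : Finset ℤ =>
      ∑ l ∈ freqs N, ‖∑ k ∈ T, (aliasInd N k l : ℂ) * fcoeff a b f k‖ ^ 2) Filter.atTop
      (nhds (∑ l ∈ freqs N, ‖dcoeff a b N (fun j => f (grid a b N j)) l - fcoeff a b f l‖ ^ 2)) :=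
    tendsto_finsetSum _ fun l _ =>
      ((hasSum_dcoeff_sub hab hN hf (summable_norm_fcoeff hab hs h) l).norm).pow 2
  refine l2_le_of_sq_le (by positivity) ?_
  simp only [norm_sub_rev (fcoeff a b f _)]
  refine le_of_tendsto' hlim fun T => ?_
  have h1 : ∀ l ∈ freqs N, ‖∑ k ∈ T, (aliasInd N k l : ℂ) * fcoeff a b f k‖ ^ 2 ≤
      (mesh a b N ^ s) ^ 2 * aliasConst *
        ∑ k ∈ T, aliasInd N k l * ‖((delta a b k ^ s : ℝ) : ℂ) * fcoeff a b f k‖ ^ 2 := by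
    intro l hl
    have h2 : ‖∑ k ∈ T, (aliasInd N k l : ℂ) * fcoeff a b f k‖ ≤
        ∑ k ∈ T, (aliasInd N k l * (delta a b k ^ s)⁻¹) *
          (aliasInd N k l * ‖((delta a b k ^ s : ℝ) : ℂ) * fcoeff a b f k‖) := by
      refine (norm_sum_le _ _).trans (le_of_eq (Finset.sum_congr rfl fun k _ => ?_))
      have hd := delta_pos a b k
      rw [norm_mul, norm_mul, Complex.norm_of_nonneg (aliasInd_nonneg N k l),
        Complex.norm_of_nonneg (pow_nonneg hd.le s)]
      nth_rewrite 1 [← aliasInd_sq]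
      field_simp
    have h3 := Finset.sum_mul_sq_le_sq_mul_sq T (fun k => aliasInd N k l * (delta a b k ^ s)⁻¹)
      (fun k => aliasInd N k l * ‖((delta a b k ^ s : ℝ) : ℂ) * fcoeff a b f k‖)
    refine (pow_le_pow_left₀ (norm_nonneg _) h2 2).trans (h3.trans ?_)
    simp only [mul_pow (aliasInd N _ l) ‖_‖, aliasInd_sq]
    refine mul_le_mul_of_nonneg_right (sum_aliasInd_mul_le hab hN hN2 hs hl T) ?_
    exact Finset.sum_nonneg fun k _ => mul_nonneg (aliasInd_nonneg N k l) (sq_nonneg _)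
  refine (Finset.sum_le_sum h1).trans ?_
  -- After exchanging the sums, each k is an alias of at most one grid frequency, so the Sobolev
  -- norm of f is counted at most once.
  rw [← Finset.mul_sum, Finset.sum_comm]
  simp only [← Finset.sum_mul]
  calc _ ≤ (mesh a b N ^ s) ^ 2 * aliasConst * M ^ 2 := by
        refine mul_le_mul_of_nonneg_left ?_ (mul_nonneg (by positivity) aliasConst_nonneg)
        have h2 := pow_le_pow_left₀ (l2_nonneg _ _) (l2_fcoeff_le h hM T) 2
        rw [l2_sq] at h2
        refine le_trans (Finset.sum_le_sum fun k _ => ?_) h2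
        exact mul_le_of_le_one_left (sq_nonneg _) (sum_aliasInd_le_one hN2 k)
    _ = _ := by rw [mul_pow, mul_pow, Real.sq_sqrt aliasConst_nonneg]; ring

end Aliasing

/-! ### Initial error, and passage from the energy error to the error of u and ∂ₜu. -/

section Final
variable {a b ε S M τ : ℝ} {m N : ℕ} {u₀ u₁ : ℝ → ℝ} {u v : ℝ → ℝ → ℝ}

/-- An inverse inequality: on the grid frequencies |μ_l| ≤ π/h and δ_l ≤ 1 + |μ_l|. -/
lemma delta_mul_mesh_le (hab : a < b) (hN : 0 < N) (hN2 : Even N) (hh1 : mesh a b N ≤ 1) {l : ℤ}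
    (hl : l ∈ freqs N) : delta a b l * mesh a b N ≤ 1 + Real.pi := by
  have hb : 0 < b - a := sub_pos.2 hab
  have hN' : (0 : ℝ) < N := by exact_mod_cast hN
  have hp := Real.pi_pos
  have hh := mesh_pos hab hN
  have h1 : 2 * |(l : ℝ)| ≤ N := by exact_mod_cast abs_le_of_mem_freqs hN2 hl
  have h2 : delta a b l ≤ 1 + |mu a b l| := by
    refine Real.sqrt_le_iff.2 ⟨by positivity, ?_⟩
    nlinarith [abs_nonneg (mu a b l), sq_abs (mu a b l)]
  have h3 : |mu a b l| * mesh a b N ≤ Real.pi := by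
    rw [abs_mu_eq hab, mesh, div_mul_div_cancel₀ hb.ne', div_le_iff₀ hN']
    nlinarith
  nlinarith

/-- The constant in the bound for the initial error. -/
noncomputable def initConst (M : ℝ) : ℝ := (1 + Real.pi) * (Real.sqrt aliasConst * M)

lemma initConst_nonneg (hM : 0 ≤ M) : 0 ≤ initConst M := by
  have := Real.pi_pos
  rw [initConst]; positivity

/-- Regularity m+1 gives an L² interpolation error h^{m+1}; the inverse inequality pays h⁻¹ for the
H¹ weight. -/
lemma l2_initial_u_le (hab : a < b) (hN : 0 < N) (hN2 : Even N) (hh1 : mesh a b N ≤ 1)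
    (hsol : IsSolution a b ε S u₀ u₁ u v) (hA : AssumptionA a b S m M u v) (hS : 0 ≤ S) :
    l2 (freqs N) (fun l => ((delta a b l : ℝ) : ℂ) *
      (rfc a b (u 0) l - dcoeff a b N (fun j => (u₀ (grid a b N j) : ℂ)) l)) ≤
      initConst M * mesh a b N ^ m := by
  have h0 : (0 : ℝ) ∈ Set.Icc 0 S := ⟨le_rfl, hS⟩
  have hh := mesh_pos hab hN
  have hp := Real.pi_pos
  have hg : (fun j => (u₀ (grid a b N j) : ℂ)) = fun j => (u 0 (grid a b N j) : ℂ) := by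
    ext j
    rw [hsol.initial_u _ (grid_mem_Icc hab hN j)]
  have h1 := l2_fcoeff_sub_dcoeff_le hab hN hN2 (by omega)
    (continuousOn_ofReal (hsol.continuous_u 0 h0)) (hA 0 h0).1.1 (hA 0 h0).1.2
  have h2 := l2_const_mul (freqs N) (((1 + Real.pi) / mesh a b N : ℝ) : ℂ)
    (fun l => rfc a b (u 0) l - dcoeff a b N (fun j => (u 0 (grid a b N j) : ℂ)) l)
  rw [Complex.norm_of_nonneg (by positivity)] at h2
  rw [hg]
  refine (l2_mono fun l hl => ?_).trans (h2.le.trans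
    ((mul_le_mul_of_nonneg_left h1 (by positivity)).trans (le_of_eq ?_)))
  · rw [norm_mul, norm_mul, Complex.norm_of_nonneg (delta_pos a b l).le,
      Complex.norm_of_nonneg (by positivity)]
    refine mul_le_mul_of_nonneg_right ?_ (norm_nonneg _)
    rw [le_div_iff₀ hh]
    exact delta_mul_mesh_le hab hN hN2 hh1 hl
  · rw [initConst, pow_succ]
    field_simp

lemma l2_initial_v_le (hab : a < b) (hN : 0 < N) (hN2 : Even N) (hm : 1 ≤ m)
    (hsol : IsSolution a b ε S u₀ u₁ u v) (hA : AssumptionA a b S m M u v) (hS : 0 ≤ S) :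
    l2 (freqs N) (fun l =>
      (rfc a b (v 0) l - dcoeff a b N (fun j => (u₁ (grid a b N j) : ℂ)) l)) ≤
      initConst M * mesh a b N ^ m := by
  have h0 : (0 : ℝ) ∈ Set.Icc 0 S := ⟨le_rfl, hS⟩
  have hh := mesh_pos hab hN
  have hp := Real.pi_pos
  have hM := hA.nonneg hS
  have hg : (fun j => (u₁ (grid a b N j) : ℂ)) = fun j => (v 0 (grid a b N j) : ℂ) := by
    ext j
    rw [hsol.initial_v _ (grid_mem_Icc hab hN j)]
  have h1 := l2_fcoeff_sub_dcoeff_le hab hN hN2 hm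
    (continuousOn_ofReal (hsol.continuous_v 0 h0)) (hA 0 h0).2.1 (hA 0 h0).2.2
  rw [hg]
  refine h1.trans (mul_le_mul_of_nonneg_right ?_ (by positivity))
  rw [initConst]
  exact le_mul_of_one_le_left (by positivity) (by linarith)

lemma energyErr_zero_le (hab : a < b) (hN : 0 < N) (hN2 : Even N) (hm : 1 ≤ m)
    (hh1 : mesh a b N ≤ 1) (hsol : IsSolution a b ε S u₀ u₁ u v)
    (hA : AssumptionA a b S m M u v) (hS : 0 ≤ S) :
    energyErr a b ε τ N u₀ u₁ u v 0 ≤ 2 * initConst M * mesh a b N ^ m := by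
  have h1 := l2_initial_u_le hab hN hN2 hh1 hsol hA hS
  have h2 := l2_initial_v_le hab hN hN2 hm hsol hA hS
  have h3 := l2_const_mul (freqs N) (-Complex.I)
    (fun l => (rfc a b (v 0) l - dcoeff a b N (fun j => (u₁ (grid a b N j) : ℂ)) l))
  rw [norm_neg, Complex.norm_I, one_mul] at h3
  have h4 := l2_add_le (freqs N) (fun l => ((delta a b l : ℝ) : ℂ) *
      (rfc a b (u 0) l - dcoeff a b N (fun j => (u₀ (grid a b N j) : ℂ)) l))
    (fun l => -Complex.I *
      (rfc a b (v 0) l - dcoeff a b N (fun j => (u₁ (grid a b N j) : ℂ)) l))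
  refine le_trans (l2_congr fun l hl => ?_).le (h4.trans (by rw [h3]; linarith))
  have hd := delta_ne_zero a b l
  have hpsi : dcoeff a b N (psi a b ε τ N u₀ u₁ 0) l =
      dcoeff a b N (fun j => (u₀ (grid a b N j) : ℂ)) l - Complex.I * (invDelta a b l *
        dcoeff a b N (fun j => (u₁ (grid a b N j) : ℂ)) l) := by
    rw [psi, dcoeff_sub, dcoeff_const_mul, dcoeff_gridMul hab hN hN2 _ _ hl]
  rw [norm_mul, norm_err, ← norm_mul, hpsi, Nat.cast_zero, zero_mul, psiHat, invDelta]
  congr 1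
  field_simp
  ring

lemma l2_neg (s : Finset ℤ) (f : ℤ → ℂ) :
    l2 s (fun l => f (-l)) = l2 (s.image fun l => -l) f := by
  rw [l2, l2, Finset.sum_image fun x _ y _ h => neg_injective h]

lemma l2_ite_le (s t : Finset ℤ) (f : ℤ → ℂ) :
    l2 t (fun l => if l ∈ s then f l else 0) ≤ l2 s f := by
  refine Real.sqrt_le_sqrt ?_
  calc ∑ l ∈ t, ‖if l ∈ s then f l else 0‖ ^ 2 = ∑ l ∈ t, if l ∈ s then ‖f l‖ ^ 2 else 0 :=
        Finset.sum_congr rfl fun l _ => by split_ifs <;> simp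
    _ = ∑ l ∈ t with l ∈ s, ‖f l‖ ^ 2 := (Finset.sum_filter _ _).symm
    _ ≤ _ := Finset.sum_le_sum_of_subset_of_nonneg
        (fun l hl => (Finset.mem_filter.1 hl).2) fun _ _ _ => sq_nonneg _

lemma continuous_interp (w : Fin (N + 1) → ℂ) : Continuous (interp a b N w) :=
  continuous_finsetSum _ fun l _ => continuous_const.mul (continuous_mode a b l)

/-- The Sobolev norm of the difference of a function and an interpolant. -/
lemma normH_sub_interp_le (hab : a < b) (hN : 0 < N) (hN2 : Even N) {s k : ℕ} {f : ℝ → ℂ}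
    (hf : ContinuousOn f (Set.Icc a b)) (h : MemH a b (s + k) f) (hM : normH a b (s + k) f ≤ M)
    {w : Fin (N + 1) → ℂ} {X : ℝ} (hX : l2 (freqs N) (fun l => ((delta a b l ^ s : ℝ) : ℂ) *
      (fcoeff a b f l - dcoeff a b N w l)) ≤ X) :
    MemH a b s (fun x => f x - interp a b N w x) ∧
      normH a b s (fun x => f x - interp a b N w x) ≤ X + mesh a b N ^ k * M := by
  have hh := mesh_pos hab hN
  have hM0 : 0 ≤ M := (normH_nonneg _ _).trans hM
  have hX0 : 0 ≤ X := (l2_nonneg _ _).trans hX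
  have hc := (continuous_interp (a := a) (b := b) w).continuousOn (s := Set.Icc a b)
  have hcoef : ∀ l, fcoeff a b (fun x => f x - interp a b N w x) l =
      fcoeff a b f l - if l ∈ freqs N then dcoeff a b N w l else 0 := by
    intro l
    have h1 : fcoeff a b (interp a b N w) l = if l ∈ freqs N then dcoeff a b N w l else 0 :=
      (fcoeff_sum_mode hab (freqs N) (dcoeff a b N w) (fun k => k) l).trans
        (Finset.sum_ite_eq' (freqs N) l _)
    rw [fcoeff_sub hab hf hc, h1]
  have hfin : ∀ T : Finset ℤ, ∑ l ∈ T, (1 + mu a b l ^ 2) ^ s *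
      ‖fcoeff a b (fun x => f x - interp a b N w x) l‖ ^ 2 ≤ (X + mesh a b N ^ k * M) ^ 2 := by
    intro T
    simp only [sobolev_term_eq]
    rw [← l2_sq]
    refine pow_le_pow_left₀ (l2_nonneg _ _) ?_ 2
    have h2 : l2 T (fun l => if l ∈ freqs N then 0 else
        ((delta a b l ^ s : ℝ) : ℂ) * fcoeff a b f l) ≤ mesh a b N ^ k * M := by
      refine l2_high_le (fun l hl => inv_delta_le_mesh hab hN
        (le_six_mul_abs_of_notMem_freqs hN2 hl)) hh.le ?_
      refine le_trans (l2_congr fun l _ => ?_).le (l2_fcoeff_le h hM T)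
      congr 1
      push_cast
      ring
    refine le_trans (l2_congr fun l _ => ?_).le ((l2_add_le T _ _).trans
      (add_le_add ((l2_ite_le (freqs N) T _).trans hX) h2))
    rw [hcoef]
    split_ifs <;> simp
  have hsum := summable_of_sum_le (fun l => by positivity) hfin
  exact ⟨⟨memLp_Ioo_of_continuousOn (hf.sub hc), hsum⟩,
    Real.sqrt_le_iff.2 ⟨by positivity, hsum.tsum_le_of_sum_le hfin⟩⟩

/-- Taking real parts needs the error at -l. Reflection preserves the grid frequencies except l =
-N/2. There the numerical coefficients at l and -l agree by periodicity, so the error at -l is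
bounded by the error at l and the two exact coefficients at ±N/2, which lie in the tail O(h^m). -/
lemma l2_err_neg_le (hab : a < b) (hN : 0 < N) (hN2 : Even N)
    (hA : AssumptionA a b S m M u v) {n : ℕ} (ht : n * τ ∈ Set.Icc 0 S) :
    l2 (freqs N) (fun l => ((delta a b l : ℝ) : ℂ) * err a b ε τ N u₀ u₁ u v n (-l)) ≤
      2 * energyErr a b ε τ N u₀ u₁ u v n + 4 * M * mesh a b N ^ m := by
  have hh := mesh_pos hab hN
  set g : ℤ → ℂ := fun l => ((delta a b l : ℝ) : ℂ) * err a b ε τ N u₀ u₁ u v n l with hg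
  set q : ℤ → ℂ := fun l => ((delta a b l : ℝ) : ℂ) * psiHat a b u v (n * τ) l with hq
  have h1 : l2 (freqs N) (fun l => if -l ∈ freqs N then g (-l) else 0) ≤
      energyErr a b ε τ N u₀ u₁ u v n := by
    rw [l2_neg (freqs N) fun l => if l ∈ freqs N then g l else 0]
    exact l2_ite_le _ _ _
  have hhigh : ∀ (Λ : Finset ℤ), (∀ l ∉ Λ, (N : ℤ) ≤ 6 * |l|) → ∀ T : Finset ℤ,
      l2 T (fun l => if l ∈ Λ then 0 else q l) ≤ mesh a b N ^ m * (2 * M) := by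
    intro Λ hΛ T
    refine l2_high_le (fun l hl => inv_delta_le_mesh hab hN (hΛ l hl)) hh.le ?_
    refine le_trans (l2_congr fun l _ => ?_).le (l2_psiHat_le hA ht T)
    congr 1
    rw [hq]
    push_cast
    ring
  have h2 : l2 (freqs N) (fun l => if -l ∈ freqs N then 0 else q (-l)) ≤
      mesh a b N ^ m * (2 * M) := by
    rw [l2_neg (freqs N) fun l => if l ∈ freqs N then 0 else q l]
    exact hhigh _ (fun l hl => le_six_mul_abs_of_notMem_freqs hN2 hl) _
  have h3 : l2 (freqs N) (fun l => if l ∈ (freqs N).image (fun l => -l) then 0 else q l) ≤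
      mesh a b N ^ m * (2 * M) := by
    refine hhigh _ (fun l hl => ?_) _
    rw [← abs_neg]
    refine le_six_mul_abs_of_notMem_freqs hN2 fun h => hl ?_
    exact Finset.mem_image.2 ⟨-l, h, neg_neg l⟩
  have hn : ∀ f : ℤ → ℂ, l2 (freqs N) (fun l => ((‖f l‖ : ℝ) : ℂ)) = l2 (freqs N) f := fun f =>
    l2_congr fun l _ => by rw [Complex.norm_real, norm_norm]
  rw [← hn] at h1 h2 h3
  have h4 : l2 (freqs N) (fun l => ((‖g l‖ : ℝ) : ℂ)) = energyErr a b ε τ N u₀ u₁ u v n := hn g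
  have h5 := l2_add_le (freqs N)
    (fun l => ((‖if -l ∈ freqs N then g (-l) else 0‖ : ℝ) : ℂ)) (fun l => ((‖g l‖ : ℝ) : ℂ))
  have h6 := l2_add_le (freqs N)
    (fun l => ((‖if -l ∈ freqs N then 0 else q (-l)‖ : ℝ) : ℂ))
    (fun l => ((‖if l ∈ (freqs N).image (fun l => -l) then 0 else q l‖ : ℝ) : ℂ))
  refine (l2_mono fun l hl => ?_).trans ((l2_add_le (freqs N) _ _).trans
    ((add_le_add h5 h6).trans (by linarith)))
  simp only [← Complex.ofReal_add]
  rw [Complex.norm_of_nonneg (by positivity)]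
  have hgl : ((delta a b l : ℝ) : ℂ) * err a b ε τ N u₀ u₁ u v n (-l) = g (-l) := by
    simp only [hg, delta_neg]
  rw [hgl]
  by_cases hneg : -l ∈ freqs N
  · rw [if_pos hneg]
    have := norm_nonneg (g l)
    have := norm_nonneg (if -l ∈ freqs N then 0 else q (-l))
    have := norm_nonneg (if l ∈ (freqs N).image (fun l => -l) then 0 else q l)
    linarith
  · have hl' : l ∉ (freqs N).image fun l => -l := by
      intro h
      obtain ⟨k, hk, rfl⟩ := Finset.mem_image.1 h
      exact hneg (by rwa [neg_neg])
    rw [if_neg hneg, if_neg hneg, if_neg hl', norm_zero, zero_add]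
    have hdvd : (N : ℤ) ∣ -l - l := by
      obtain ⟨k, rfl⟩ := hN2
      rw [freqs, Finset.mem_Ico] at hl hneg
      refine ⟨1, ?_⟩
      push_cast at hl hneg ⊢
      omega
    have hp := dcoeff_eq_of_dvd hab hN (psi a b ε τ N u₀ u₁ n) hdvd
    simp only [hg, hq, norm_mul, norm_err, delta_neg, hp]
    rw [← mul_add, ← mul_add]
    refine mul_le_mul_of_nonneg_left ?_ (norm_nonneg _)
    set p := dcoeff a b N (psi a b ε τ N u₀ u₁ n) l
    have e1 := norm_sub_le (psiHat a b u v (n * τ) (-l)) p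
    have e2 := norm_sub_norm_le p (psiHat a b u v (n * τ) l)
    rw [norm_sub_rev] at e2
    linarith

/-- The error of the scheme is bounded by the energy error. -/
lemma errorLE_of_energyErr_le (hab : a < b) (hN : 0 < N) (hN2 : Even N) (hm : 1 ≤ m)
    (hh1 : mesh a b N ≤ 1) (hsol : IsSolution a b ε S u₀ u₁ u v)
    (hA : AssumptionA a b S m M u v) {n : ℕ} (ht : n * τ ∈ Set.Icc 0 S) :
    ErrorLE a b ε τ N u₀ u₁ u v n (3 * energyErr a b ε τ N u₀ u₁ u v n +
      (2 * initConst M + 6 * M) * mesh a b N ^ m) := by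
  have hS : 0 ≤ S := ht.1.trans ht.2
  have hM := hA.nonneg hS
  have hh := mesh_pos hab hN
  have hI := initConst_nonneg hM
  set X := 3 / 2 * energyErr a b ε τ N u₀ u₁ u v n + (initConst M + 2 * M) * mesh a b N ^ m with hX
  have hy := energyErr_nonneg (a := a) (b := b) (ε := ε) (τ := τ) (N := N) (u₀ := u₀) (u₁ := u₁)
    (u := u) (v := v) n
  have hgen : ∀ f : ℤ → ℂ, (∀ l ∈ freqs N, ‖f l‖ ≤ (1 / 2) * (delta a b l *
      (‖err a b ε τ N u₀ u₁ u v n l‖ + ‖err a b ε τ N u₀ u₁ u v n (-l)‖))) →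
      l2 (freqs N) f ≤ X := by
    intro f hf
    have h1 := l2_err_neg_le (ε := ε) (u₀ := u₀) (u₁ := u₁) hab hN hN2 hA ht
    have hn : ∀ f : ℤ → ℂ, l2 (freqs N) (fun l => ((‖f l‖ : ℝ) : ℂ)) = l2 (freqs N) f := fun f =>
      l2_congr fun l _ => by rw [Complex.norm_real, norm_norm]
    have h2 := l2_add_le (freqs N)
      (fun l => ((‖((delta a b l : ℝ) : ℂ) * err a b ε τ N u₀ u₁ u v n l‖ : ℝ) : ℂ))
      (fun l => ((‖((delta a b l : ℝ) : ℂ) * err a b ε τ N u₀ u₁ u v n (-l)‖ : ℝ) : ℂ))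
    rw [hn, hn] at h2
    have h3 := l2_const_mul (freqs N) (1 / 2 : ℂ) (fun l =>
      ((‖((delta a b l : ℝ) : ℂ) * err a b ε τ N u₀ u₁ u v n l‖ : ℝ) : ℂ) +
      ((‖((delta a b l : ℝ) : ℂ) * err a b ε τ N u₀ u₁ u v n (-l)‖ : ℝ) : ℂ))
    have h4 : ‖(1 / 2 : ℂ)‖ = 1 / 2 := by norm_num
    rw [h4] at h3
    refine (l2_mono fun l hl => ?_).trans (h3.le.trans (?_ : _ ≤ X))
    · refine (hf l hl).trans (le_of_eq ?_)
      rw [norm_mul, h4, ← Complex.ofReal_add, Complex.norm_of_nonneg (by positivity), norm_mul,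
        norm_mul, Complex.norm_of_nonneg (delta_pos a b l).le]
      ring
    · have h5 : l2 (freqs N) (fun l => ((delta a b l : ℝ) : ℂ) * err a b ε τ N u₀ u₁ u v n l) =
        energyErr a b ε τ N u₀ u₁ u v n := rfl
      have h6 : 0 ≤ initConst M * mesh a b N ^ m := by positivity
      rw [hX]
      linarith
  have hp : ∀ l, ‖psiHat a b u v (n * τ) l - dcoeff a b N (psi a b ε τ N u₀ u₁ n) l‖ =
    ‖err a b ε τ N u₀ u₁ u v n l‖ := fun l => (norm_err n l).symm
  have hU : l2 (freqs N) (fun l => ((delta a b l ^ 1 : ℝ) : ℂ) *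
      (rfc a b (u (n * τ)) l - dcoeff a b N (uNum a b ε τ N u₀ u₁ n) l)) ≤ X := by
    -- At n = 0 the scheme outputs the sampled data rather than the real part of ψ⁰, so the
    -- interpolation error is used directly.
    cases n with
    | zero =>
      simp only [pow_one, Nat.cast_zero, zero_mul]
      refine (l2_initial_u_le hab hN hN2 hh1 hsol hA hS).trans ?_
      have : 0 ≤ 2 * M * mesh a b N ^ m := by positivity
      rw [hX]
      linarith
    | succ n =>
      refine hgen _ fun l hl => ?_
      have hnum : dcoeff a b N (uNum a b ε τ N u₀ u₁ (n + 1)) l = (1 / 2) *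
          (dcoeff a b N (psi a b ε τ N u₀ u₁ (n + 1)) l +
            (starRingEnd ℂ) (dcoeff a b N (psi a b ε τ N u₀ u₁ (n + 1)) (-l))) := by
        rw [uNum, dcoeff_const_mul, dcoeff_add, dcoeff_conj]
      have e : rfc a b (u ((n + 1 : ℕ) * τ)) l - dcoeff a b N (uNum a b ε τ N u₀ u₁ (n + 1)) l =
          (1 / 2) * ((psiHat a b u v ((n + 1 : ℕ) * τ) l -
            dcoeff a b N (psi a b ε τ N u₀ u₁ (n + 1)) l) +
            (starRingEnd ℂ) (psiHat a b u v ((n + 1 : ℕ) * τ) (-l) -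
              dcoeff a b N (psi a b ε τ N u₀ u₁ (n + 1)) (-l))) := by
        rw [rfc_u_eq_psiHat (v := v), hnum, map_sub]
        ring
      have e2 := norm_add_le (psiHat a b u v ((n + 1 : ℕ) * τ) l -
            dcoeff a b N (psi a b ε τ N u₀ u₁ (n + 1)) l) ((starRingEnd ℂ)
            (psiHat a b u v ((n + 1 : ℕ) * τ) (-l) -
              dcoeff a b N (psi a b ε τ N u₀ u₁ (n + 1)) (-l)))
      rw [Complex.norm_conj, hp, hp] at e2
      have hd := delta_pos a b l
      rw [e, norm_mul, norm_mul, pow_one, Complex.norm_of_nonneg hd.le, mul_left_comm,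
        show ‖(1 / 2 : ℂ)‖ = 1 / 2 by norm_num]
      gcongr
  have hV : l2 (freqs N) (fun l => ((delta a b l ^ 0 : ℝ) : ℂ) *
      (rfc a b (v (n * τ)) l - dcoeff a b N (vNum a b ε τ N u₀ u₁ n) l)) ≤ X := by
    simp only [pow_zero, Complex.ofReal_one, one_mul]
    cases n with
    | zero =>
      simp only [Nat.cast_zero, zero_mul]
      refine (l2_initial_v_le hab hN hN2 hm hsol hA hS).trans ?_
      have : 0 ≤ 2 * M * mesh a b N ^ m := by positivity
      rw [hX]
      linarith
    | succ n =>
      refine hgen _ fun l hl => ?_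
      have hnum : dcoeff a b N (vNum a b ε τ N u₀ u₁ (n + 1)) l = (Complex.I / 2) *
          (((delta a b l : ℝ) : ℂ) * (dcoeff a b N (psi a b ε τ N u₀ u₁ (n + 1)) l -
            (starRingEnd ℂ) (dcoeff a b N (psi a b ε τ N u₀ u₁ (n + 1)) (-l)))) := by
        rw [vNum, dcoeff_const_mul, dcoeff_sum_freqs hab hN hN2 _ hl, dcoeff_conj]
      have e : rfc a b (v ((n + 1 : ℕ) * τ)) l - dcoeff a b N (vNum a b ε τ N u₀ u₁ (n + 1)) l =
          (Complex.I / 2) * (((delta a b l : ℝ) : ℂ) * ((psiHat a b u v ((n + 1 : ℕ) * τ) l -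
            dcoeff a b N (psi a b ε τ N u₀ u₁ (n + 1)) l) -
            (starRingEnd ℂ) (psiHat a b u v ((n + 1 : ℕ) * τ) (-l) -
              dcoeff a b N (psi a b ε τ N u₀ u₁ (n + 1)) (-l)))) := by
        rw [rfc_v_eq_psiHat (u := u), hnum, map_sub]
        ring
      have e2 := norm_sub_le (psiHat a b u v ((n + 1 : ℕ) * τ) l -
            dcoeff a b N (psi a b ε τ N u₀ u₁ (n + 1)) l) ((starRingEnd ℂ)
            (psiHat a b u v ((n + 1 : ℕ) * τ) (-l) -
              dcoeff a b N (psi a b ε τ N u₀ u₁ (n + 1)) (-l)))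
      rw [Complex.norm_conj, hp, hp] at e2
      have hd := delta_pos a b l
      rw [e, norm_mul, norm_mul, Complex.norm_of_nonneg hd.le,
        show ‖(Complex.I / 2 : ℂ)‖ = 1 / 2 by simp]
      gcongr
  have hu := (hA _ ht).1
  have hv := (hA _ ht).2
  obtain ⟨hu1, hu2⟩ := normH_sub_interp_le hab hN hN2 (s := 1) (k := m)
    (M := M) (continuousOn_ofReal (hsol.continuous_u _ ht)) (by rw [add_comm]; exact hu.1)
    (by rw [add_comm]; exact hu.2) hU
  obtain ⟨hv1, hv2⟩ := normH_sub_interp_le hab hN hN2 (s := 0) (k := m)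
    (M := M) (continuousOn_ofReal (hsol.continuous_v _ ht)) (by rw [zero_add]; exact hv.1)
    (by rw [zero_add]; exact hv.2) hV
  refine ⟨hu1, hv1, (add_le_add hu2 hv2).trans (le_of_eq ?_)⟩
  rw [hX]
  ring

lemma ErrorLE.mono {n : ℕ} {B C : ℝ} (h : ErrorLE a b ε τ N u₀ u₁ u v n B) (hBC : B ≤ C) :
    ErrorLE a b ε τ N u₀ u₁ u v n C := ⟨h.1, h.2.1, h.2.2.trans hBC⟩

end Final

/-! ### Bootstrap and convergence of the energy error. -/

section Convergence
variable {a b T ε M τ τ₀ : ℝ} {m N : ℕ} {u₀ u₁ : ℝ → ℝ} {u v : ℝ → ℝ → ℝ}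

/-- The constant in the recursion for the energy error. -/
noncomputable def recConst (a b T M : ℝ) : ℝ :=
  2 * initConst M + T * (3 * supConst a b M ^ 2) *
    (cubeConst a b M * Real.sqrt (deltaSum a b) + 3 * M) +
    quadConst a b M T * Real.sqrt (deltaSum a b)

lemma recConst_nonneg (hT : 0 ≤ T) (hM : 0 ≤ M) : 0 ≤ recConst a b T M := by
  have h1 := initConst_nonneg hM
  have h2 := cubeConst_nonneg (a := a) (b := b) hM
  have h3 := quadConst_nonneg (a := a) (b := b) hM hT
  rw [recConst]
  positivity

lemma energyErr_le_recConst (hab : a < b) (hT : 0 < T) (hN : 0 < N) (hN2 : Even N) (hm : 1 ≤ m)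
    (hε : 0 < ε) (hsol : IsSolution a b ε (T / ε ^ 2) u₀ u₁ u v)
    (hA : AssumptionA a b (T / ε ^ 2) m M u v) (hh1 : mesh a b N ≤ 1) (hτ₀ : 0 < τ₀) (hτ : 0 < τ)
    {B : ℝ} (hB0 : 0 ≤ B) {n : ℕ} (hn : n * τ ≤ T / ε ^ 2)
    (hB : ∀ l, ∀ r ∈ waves (lowFreqs N τ₀) ×ˢ waves (lowFreqs N τ₀) ×ˢ waves (lowFreqs N τ₀),
      r.1.1 + r.2.1.1 + r.2.2.1 = l → ∀ k ≤ n,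
      ‖quadErr (resonance a b r l) τ‖ *
        ‖∑ j ∈ Finset.range k, cis (resonance a b r l * τ) ^ j‖ ≤ B * |resonance a b r l|)
    {k : ℕ} (hk : k ≤ n) (h1 : ∀ j < k, energyErr a b ε τ N u₀ u₁ u v j ≤ 1) :
    energyErr a b ε τ N u₀ u₁ u v k ≤
      recConst a b T M * (mesh a b N ^ m + ε ^ 2 * τ ^ 2 +
        (mesh a b N + (b - a) * τ₀) ^ (m + 1) + ε ^ 2 * B) +
        3 * supConst a b M ^ 2 * (ε ^ 2 * τ) *
          ∑ j ∈ Finset.range k, energyErr a b ε τ N u₀ u₁ u v j := by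
  have hS : 0 ≤ T / ε ^ 2 := by positivity
  have hST : ε ^ 2 * (T / ε ^ 2) = T := by field_simp
  have hM := hA.nonneg hS
  have hb : 0 < b - a := sub_pos.2 hab
  have hh := mesh_pos hab hN
  have hI := initConst_nonneg hM
  have hK := cubeConst_nonneg (a := a) (b := b) hM
  have hQ := quadConst_nonneg (a := a) (b := b) hM hT.le
  have hkn : (k : ℝ) * τ ≤ T / ε ^ 2 := le_trans (by gcongr) hn
  set ρ := mesh a b N + (b - a) * τ₀ with hρ
  have hρ0 : 0 ≤ ρ := by positivity
  have h2 := energyErr_le_add_sum hab hN hN2 hm hsol hA (n := k) hτ.le hkn hB0 h1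
    (Λ := lowFreqs N τ₀) (ρ := ρ) (fun l hl => neg_mem_lowFreqs hN2 hl)
    (fun l hl => (Finset.mem_filter.1 hl).2.1)
    (fun l hl => inv_delta_le_of_notMem_lowFreqs hab hN hN2 hτ₀ hl) hρ0
    (fun l r hr hl i hi => hB l r hr hl i (hi.trans hk))
  have h3 := energyErr_zero_le (τ := τ) hab hN hN2 hm hh1 hsol hA hS
  rw [hST, localErr, frozenErr] at h2
  refine h2.trans (add_le_add ?_ le_rfl)
  set D := Real.sqrt (deltaSum a b)
  set c := T * (3 * supConst a b M ^ 2)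
  have hc : 0 ≤ c := by positivity
  have hD : 0 ≤ D := Real.sqrt_nonneg _
  have e1 : 0 ≤ ε ^ 2 * τ ^ 2 := by positivity
  have e2 : 0 ≤ ε ^ 2 * B := by positivity
  have e3 : 0 ≤ ρ ^ (m + 1) := by positivity
  have e4 : 0 ≤ mesh a b N ^ m := by positivity
  set X := mesh a b N ^ m + ε ^ 2 * τ ^ 2 + ρ ^ (m + 1) + ε ^ 2 * B with hX
  have f1 : 2 * initConst M * mesh a b N ^ m ≤ 2 * initConst M * X :=
    mul_le_mul_of_nonneg_left (by linarith) (by positivity)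
  have f2 : c * (cubeConst a b M * D) * (ε ^ 2 * τ ^ 2) ≤ c * (cubeConst a b M * D) * X :=
    mul_le_mul_of_nonneg_left (by linarith) (by positivity)
  have f3 : c * (3 * M) * ρ ^ (m + 1) ≤ c * (3 * M) * X :=
    mul_le_mul_of_nonneg_left (by linarith) (by positivity)
  have f4 : quadConst a b M T * D * (ε ^ 2 * B) ≤ quadConst a b M T * D * X :=
    mul_le_mul_of_nonneg_left (by linarith) (by positivity)
  have f5 : T * (3 * supConst a b M ^ 2 * (ε ^ 2 * cubeConst a b M * τ ^ 2 * D +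
      ρ ^ (m + 1) * M + ρ ^ (m + 1) * (2 * M))) =
      c * (cubeConst a b M * D) * (ε ^ 2 * τ ^ 2) + c * (3 * M) * ρ ^ (m + 1) := by
    simp only [c]; ring
  rw [f5, recConst]
  linarith

/-- Every error is at most one if the mesh and the time step are small. -/
lemma energyErr_le_one (hab : a < b) (hT : 0 < T) (hN : 0 < N) (hN2 : Even N) (hm : 1 ≤ m)
    (hε : 0 < ε) (hε1 : ε ≤ 1) (hsol : IsSolution a b ε (T / ε ^ 2) u₀ u₁ u v)
    (hA : AssumptionA a b (T / ε ^ 2) m M u v) {η : ℝ} (hη : η ≤ 1 / 2)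
    (hsmall : recConst a b T M * ((4 + T) * η) * Real.exp (3 * supConst a b M ^ 2 * T) ≤ 1)
    (hh : mesh a b N ≤ η) (hτ₀ : 0 < τ₀) (hτ₀η : (b - a) * τ₀ ≤ η) (hτ : 0 < τ)
    (hττ₀ : τ ≤ (b - a) * τ₀) {n : ℕ} (hn : n * τ ≤ T / ε ^ 2) {k : ℕ} (hk : k ≤ n) :
    energyErr a b ε τ N u₀ u₁ u v k ≤ 1 := by
  have hM := hA.nonneg (by positivity)
  have hC := recConst_nonneg (a := a) (b := b) hT.le hM
  have hb : 0 < b - a := sub_pos.2 hab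
  have hh0 := mesh_pos hab hN
  have hε2 : 0 < ε ^ 2 := by positivity
  have hε21 : ε ^ 2 ≤ 1 := pow_le_one₀ hε.le hε1
  have hnT : ε ^ 2 * (n * τ) ≤ T := by rwa [le_div_iff₀' hε2] at hn
  have hτη : τ ≤ η := hττ₀.trans hτ₀η
  -- The crude value B = nτ² costs only ε²nτ² ≤ Tτ, which is small enough for the bootstrap and
  -- involves no α.
  refine le_one_of_gronwall (K := 3 * supConst a b M ^ 2 * (ε ^ 2 * τ)) (n := n)
    (A := recConst a b T M * (mesh a b N ^ m + ε ^ 2 * τ ^ 2 +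
        (mesh a b N + (b - a) * τ₀) ^ (m + 1) + ε ^ 2 * (n * τ ^ 2)))
    (by positivity) (by positivity) (fun i hi h1 => energyErr_le_recConst hab hT hN hN2 hm hε hsol
      hA (by linarith) hτ₀ hτ (by positivity) hn
      (fun l r _ _ j hj => quadErr_mul_geom_le_crude _ hτ.le hj) hi h1) ?_ hk
  refine le_trans (mul_le_mul ?_ ?_ (Real.exp_pos _).le (by have := hτ.trans_le hτη; positivity))
    hsmall
  · refine mul_le_mul_of_nonneg_left ?_ hC
    -- The four terms contribute η, η, 2η and Tη, which is the factor 4 + T in `hsmall`.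
    have e1 : mesh a b N ^ m ≤ η := (pow_le_of_le_one hh0.le (by linarith) (by omega)).trans hh
    have e2 : ε ^ 2 * τ ^ 2 ≤ η := by nlinarith
    have e3 : (mesh a b N + (b - a) * τ₀) ^ (m + 1) ≤ mesh a b N + (b - a) * τ₀ :=
      pow_le_of_le_one (by positivity) (by linarith) (by omega)
    have e4 : ε ^ 2 * (n * τ ^ 2) ≤ T * η := by
      calc ε ^ 2 * (n * τ ^ 2) = ε ^ 2 * (n * τ) * τ := by ring
        _ ≤ T * η := by gcongr
    linarith
  · refine Real.exp_le_exp.2 ?_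
    calc _ = 3 * supConst a b M ^ 2 * (ε ^ 2 * (n * τ)) := by ring
      _ ≤ _ := by gcongr

/-- With the bootstrap available, the recursion is run again with B = κ⁻¹τ², the bound that uses
cancellation. -/
lemma energyErr_le (hab : a < b) (hT : 0 < T) (hN : 0 < N) (hN2 : Even N) (hm : 1 ≤ m)
    (hε : 0 < ε) (hsol : IsSolution a b ε (T / ε ^ 2) u₀ u₁ u v)
    (hA : AssumptionA a b (T / ε ^ 2) m M u v) (hh1 : mesh a b N ≤ 1) (hτ₀ : 0 < τ₀) (hτ : 0 < τ)
    {α κ : ℝ} (hα : τ < stepBound a b α τ₀) (hκ : 0 < κ)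
    (hsin : ∀ θ : ℝ, |θ| ≤ α * Real.pi → κ * |θ| ≤ |Real.sin θ|)
    {n : ℕ} (hn : n * τ ≤ T / ε ^ 2) (h1 : ∀ k ≤ n, energyErr a b ε τ N u₀ u₁ u v k ≤ 1) :
    energyErr a b ε τ N u₀ u₁ u v n ≤ recConst a b T M *
      (1 + κ⁻¹ + 2 ^ m * (1 + (b - a) ^ (m + 1))) * Real.exp (3 * supConst a b M ^ 2 * T) *
        (mesh a b N ^ m + ε ^ 2 * τ ^ 2 + τ₀ ^ (m + 1)) := by
  have hM := hA.nonneg (by positivity)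
  have hC := recConst_nonneg (a := a) (b := b) hT.le hM
  have hb : 0 < b - a := sub_pos.2 hab
  have hh0 := mesh_pos hab hN
  have hε2 : 0 < ε ^ 2 := by positivity
  have hnT : ε ^ 2 * (n * τ) ≤ T := by rwa [le_div_iff₀' hε2] at hn
  have h2 := gronwall_sum_exp (y := energyErr a b ε τ N u₀ u₁ u v)
    (K := 3 * supConst a b M ^ 2 * (ε ^ 2 * τ)) (n := n)
    (A := recConst a b T M * (mesh a b N ^ m + ε ^ 2 * τ ^ 2 +
        (mesh a b N + (b - a) * τ₀) ^ (m + 1) + ε ^ 2 * (κ⁻¹ * τ ^ 2)))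
    (by positivity) (by positivity) (fun i hi => energyErr_le_recConst hab hT hN hN2 hm hε hsol
      hA hh1 hτ₀ hτ (by positivity) hn (fun l r hr hl j _ => quadErr_mul_geom_le hκ _ hτ.le
        (hsin _ (abs_resonance_mul_le hab hτ₀ hτ hα hr hl)) j) hi
      fun j hj => h1 j (hj.le.trans hi)) le_rfl
  have hexp : Real.exp (3 * supConst a b M ^ 2 * (ε ^ 2 * τ) * n) ≤
      Real.exp (3 * supConst a b M ^ 2 * T) := by
    refine Real.exp_le_exp.2 ?_
    calc _ = 3 * supConst a b M ^ 2 * (ε ^ 2 * (n * τ)) := by ring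
      _ ≤ _ := by gcongr
  have hρ : (mesh a b N + (b - a) * τ₀) ^ (m + 1) ≤
      2 ^ m * (mesh a b N ^ m + (b - a) ^ (m + 1) * τ₀ ^ (m + 1)) := by
    have h3 := add_pow_le hh0.le (by positivity : 0 ≤ (b - a) * τ₀) (m + 1)
    rw [Nat.add_sub_cancel, mul_pow] at h3
    refine h3.trans ?_
    have : mesh a b N ^ (m + 1) ≤ mesh a b N ^ m :=
      pow_le_pow_of_le_one hh0.le hh1 (Nat.le_succ m)
    gcongr
  have e1 : 0 ≤ ε ^ 2 * τ ^ 2 := by positivity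
  have e2 : 0 ≤ mesh a b N ^ m := by positivity
  have e3 : 0 ≤ τ₀ ^ (m + 1) := by positivity
  set Y := mesh a b N ^ m + ε ^ 2 * τ ^ 2 + τ₀ ^ (m + 1) with hY
  have hsum : mesh a b N ^ m + ε ^ 2 * τ ^ 2 + (mesh a b N + (b - a) * τ₀) ^ (m + 1) +
      ε ^ 2 * (κ⁻¹ * τ ^ 2) ≤ (1 + κ⁻¹ + 2 ^ m * (1 + (b - a) ^ (m + 1))) * Y := by
    have f1 : κ⁻¹ * (ε ^ 2 * τ ^ 2) ≤ κ⁻¹ * Y :=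
      mul_le_mul_of_nonneg_left (by linarith) (by positivity)
    have f2 : 2 ^ m * mesh a b N ^ m ≤ 2 ^ m * Y :=
      mul_le_mul_of_nonneg_left (by linarith) (by positivity)
    have f3 : 2 ^ m * (b - a) ^ (m + 1) * τ₀ ^ (m + 1) ≤ 2 ^ m * (b - a) ^ (m + 1) * Y :=
      mul_le_mul_of_nonneg_left (by linarith) (by positivity)
    linarith
  refine h2.trans ((mul_le_mul (mul_le_mul_of_nonneg_left hsum hC) hexp (Real.exp_pos _).le
    (by positivity)).trans (le_of_eq ?_))
  ring

end Convergence

/-- The error bound under assumption (A). -/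
theorem exists_errorLE {a b T : ℝ} (hab : a < b) (hT : 0 < T) {m : ℕ} (hm : 1 ≤ m) (M : ℝ) :
    ∃ h₀ > 0, h₀ ≤ 1 ∧ ∃ τbar > 0, τbar < 1 ∧ ∀ α : ℝ, 0 < α → α < 1 → ∃ C > 0,
      ∀ τ₀ : ℝ, 0 < τ₀ → τ₀ ≤ τbar → ∀ ε : ℝ, 0 < ε → ε ≤ 1 →
      ∀ (u₀ u₁ : ℝ → ℝ) (u v : ℝ → ℝ → ℝ),
        IsSolution a b ε (T / ε ^ 2) u₀ u₁ u v →
        AssumptionA a b (T / ε ^ 2) m M u v →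
      ∀ N : ℕ, 0 < N → Even N → mesh a b N ≤ h₀ →
      ∀ τ : ℝ, 0 < τ → τ < stepBound a b α τ₀ →
      ∀ n : ℕ, n * τ ≤ T / ε ^ 2 →
        ErrorLE a b ε τ N u₀ u₁ u v n
          (C * (mesh a b N ^ m + ε ^ 2 * τ ^ 2 + τ₀ ^ (m + 1))) := by
  -- No solution satisfies the assumption with a negative bound.
  rcases lt_or_ge M 0 with hM | hM
  · refine ⟨1, one_pos, le_rfl, 1 / 2, by norm_num, by norm_num, fun α _ _ => ⟨1, one_pos, ?_⟩⟩
    intro τ₀ _ _ ε hε _ u₀ u₁ u v _ hA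
    exact absurd (hA.nonneg (by positivity)) hM.not_ge
  have hb : 0 < b - a := sub_pos.2 hab
  have hC := recConst_nonneg (a := a) (b := b) hT.le hM
  have hI := initConst_nonneg hM
  set L := recConst a b T M * (4 + T) * Real.exp (3 * supConst a b M ^ 2 * T) with hL
  have hL0 : 0 ≤ L := by positivity
  -- This choice gives both η ≤ 1/2 and Lη ≤ 1, the two smallness conditions of the bootstrap.
  set η := 1 / (2 + L) with hη
  have hη0 : 0 < η := by positivity
  have hη2 : η ≤ 1 / 2 := by
    rw [hη]
    exact one_div_le_one_div_of_le two_pos (by linarith)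
  have hLη : recConst a b T M * ((4 + T) * η) * Real.exp (3 * supConst a b M ^ 2 * T) ≤ 1 := by
    calc _ = L / (2 + L) := by rw [hL, hη]; ring
      _ ≤ 1 := (div_le_one (by positivity)).2 (by linarith)
  refine ⟨η, hη0, by linarith, min (1 / 2) (η / (b - a)), lt_min (by norm_num) (by positivity),
    (min_le_left _ _).trans_lt (by norm_num), fun α hα0 hα1 => ?_⟩
  obtain ⟨κ, hκ, hsin⟩ := exists_mul_abs_le_abs_sin hα0 hα1
  set C := recConst a b T M * (1 + κ⁻¹ + 2 ^ m * (1 + (b - a) ^ (m + 1))) *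
    Real.exp (3 * supConst a b M ^ 2 * T) with hC'
  have hC0 : 0 ≤ C := by positivity
  refine ⟨3 * C + (2 * initConst M + 6 * M) + 1, by positivity, ?_⟩
  intro τ₀ hτ₀ hτ₀' ε hε hε1 u₀ u₁ u v hsol hA N hN hN2 hh τ hτ hτα n hn
  have hh0 := mesh_pos hab hN
  have hτ₀η : (b - a) * τ₀ ≤ η := by
    rw [← le_div_iff₀' hb]
    exact hτ₀'.trans (min_le_right _ _)
  have hττ₀ : τ ≤ (b - a) * τ₀ := hτα.le.trans (stepBound_le hab hτ₀ hα1)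
  have h1 := energyErr_le hab hT hN hN2 hm hε hsol hA (by linarith) hτ₀ hτ hτα hκ hsin hn
    fun k hk => energyErr_le_one hab hT hN hN2 hm hε hε1 hsol hA hη2 hLη hh hτ₀ hτ₀η hτ hττ₀ hn hk
  refine (errorLE_of_energyErr_le hab hN hN2 hm (by linarith) hsol hA
    ⟨by positivity, hn⟩).mono ?_
  have e1 : 0 ≤ ε ^ 2 * τ ^ 2 := by positivity
  have e2 : 0 ≤ mesh a b N ^ m := by positivity
  have e3 : 0 ≤ τ₀ ^ (m + 1) := by positivity
  have e4 := mul_le_mul_of_nonneg_left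
    (by linarith : mesh a b N ^ m ≤ mesh a b N ^ m + ε ^ 2 * τ ^ 2 + τ₀ ^ (m + 1))
    (by positivity : 0 ≤ 2 * initConst M + 6 * M)
  rw [← hC'] at h1
  linarith

/-- The error bound for smooth solutions, with an arbitrary power of `τ₀`. -/
theorem exists_errorLE_smooth {a b T : ℝ} (hab : a < b) (hT : 0 < T) {m : ℕ} (hm : 1 ≤ m)
    (M : ℕ → ℝ) (p : ℕ) :
    ∃ h₀ > 0, ∃ τbar > 0, τbar < 1 ∧ ∀ α : ℝ, 0 < α → α < 1 → ∃ C > 0,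
      ∀ τ₀ : ℝ, 0 < τ₀ → τ₀ ≤ τbar → ∀ ε : ℝ, 0 < ε → ε ≤ 1 →
      ∀ (u₀ u₁ : ℝ → ℝ) (u v : ℝ → ℝ → ℝ),
        IsSolution a b ε (T / ε ^ 2) u₀ u₁ u v →
        (∀ k : ℕ, AssumptionA a b (T / ε ^ 2) k (M k) u v) →
      ∀ N : ℕ, 0 < N → Even N → mesh a b N ≤ h₀ →
      ∀ τ : ℝ, 0 < τ → τ < stepBound a b α τ₀ →
      ∀ n : ℕ, n * τ ≤ T / ε ^ 2 →
        ErrorLE a b ε τ N u₀ u₁ u v n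
          (C * (mesh a b N ^ m + ε ^ 2 * τ ^ 2 + τ₀ ^ p)) := by
  -- Order max(m, p) serves both powers at once: since h ≤ 1 and τ₀ < 1, the larger exponents only
  -- help.
  obtain ⟨h₀, hh₀, hh₀1, τbar, hτbar, hτbar1, H⟩ :=
    exists_errorLE hab hT (hm.trans (le_max_left m p)) (M (max m p))
  refine ⟨h₀, hh₀, τbar, hτbar, hτbar1, fun α hα0 hα1 => ?_⟩
  obtain ⟨C, hC, H⟩ := H α hα0 hα1
  refine ⟨C, hC, ?_⟩
  intro τ₀ hτ₀ hτ₀' ε hε hε1 u₀ u₁ u v hsol hA N hN hN2 hh τ hτ hτα n hn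
  refine (H τ₀ hτ₀ hτ₀' ε hε hε1 u₀ u₁ u v hsol (hA _) N hN hN2 hh τ hτ hτα n hn).mono ?_
  have e1 : mesh a b N ^ max m p ≤ mesh a b N ^ m :=
    pow_le_pow_of_le_one (mesh_pos hab hN).le (hh.trans hh₀1) (le_max_left m p)
  have e2 : τ₀ ^ (max m p + 1) ≤ τ₀ ^ p :=
    pow_le_pow_of_le_one hτ₀.le (hτ₀'.trans hτbar1.le) ((le_max_right m p).trans (Nat.le_succ _))
  gcongr

lemma le_stepBound {a b α τ₀ : ℝ} (hab : a < b) (hα : 0 ≤ α) (hτ₀ : 0 < τ₀) (hτ₀1 : τ₀ ≤ 1) :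
    α * (Real.pi * (b - a)) / (2 * Real.sqrt ((b - a) ^ 2 + 8 * Real.pi ^ 2)) * τ₀ ≤
      stepBound a b α τ₀ := by
  have hb : 0 < b - a := sub_pos.2 hab
  have hp := Real.pi_pos
  have h1 : τ₀ ^ 2 ≤ 1 := pow_le_one₀ hτ₀.le hτ₀1
  have h2 : τ₀ ^ 2 * (b - a) ^ 2 + 4 * Real.pi ^ 2 * (1 + τ₀ ^ 2) ≤
      (b - a) ^ 2 + 8 * Real.pi ^ 2 := by
    nlinarith [mul_le_mul_of_nonneg_right h1 (sq_nonneg (b - a)),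
      mul_le_mul_of_nonneg_right h1 (sq_nonneg Real.pi)]
  calc _ = α * (Real.pi * (b - a) * τ₀ /
        (2 * Real.sqrt ((b - a) ^ 2 + 8 * Real.pi ^ 2))) := by ring
    _ ≤ _ := by
      rw [stepBound]
      gcongr

/-- The error bound for smooth solutions and small time steps. -/
theorem exists_errorLE_smooth_small {a b T : ℝ} (hab : a < b) (hT : 0 < T) {m : ℕ} (hm : 1 ≤ m)
    (M : ℕ → ℝ) {κ : ℝ} (hκ : 0 < κ) :
    ∃ h₀ > 0, ∃ τc > 0, ∃ C > 0, ∀ ε : ℝ, 0 < ε → ε ≤ 1 →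
      ∀ (u₀ u₁ : ℝ → ℝ) (u v : ℝ → ℝ → ℝ),
        IsSolution a b ε (T / ε ^ 2) u₀ u₁ u v →
        (∀ k : ℕ, AssumptionA a b (T / ε ^ 2) k (M k) u v) →
      ∀ N : ℕ, 0 < N → Even N → mesh a b N ≤ h₀ →
      ∀ τ : ℝ, 0 < τ → τ ≤ τc * ε ^ κ →
      ∀ n : ℕ, n * τ ≤ T / ε ^ 2 →
        ErrorLE a b ε τ N u₀ u₁ u v n (C * (mesh a b N ^ m + ε ^ 2 * τ ^ 2)) := by
  have hb : 0 < b - a := sub_pos.2 hab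
  have hp := Real.pi_pos
  -- With κq ≥ 2 and τ ≤ ε^κ one has τ^q ≤ ε², so a power q + 2 of a multiple of τ is absorbed by
  -- ε²τ².
  obtain ⟨q, hq⟩ := exists_nat_ge (2 / κ)
  obtain ⟨h₀, hh₀, τbar, hτbar, hτbar1, H⟩ := exists_errorLE_smooth hab hT hm M (q + 2)
  obtain ⟨C, hC, H⟩ := H (1 / 2) (by norm_num) (by norm_num)
  set c := 1 / 2 * (Real.pi * (b - a)) / (2 * Real.sqrt ((b - a) ^ 2 + 8 * Real.pi ^ 2)) with hc
  have hc0 : 0 < c := by positivity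
  -- The choice τ₀ = Kτ makes the lower bound cτ₀ of the step bound equal to 2τ, so the strict
  -- restriction on τ holds.
  set K := 2 / c with hK
  have hK0 : 0 < K := by positivity
  refine ⟨h₀, hh₀, min 1 (τbar / K), lt_min one_pos (by positivity), C * (1 + K ^ (q + 2)),
    by positivity, ?_⟩
  intro ε hε hε1 u₀ u₁ u v hsol hA N hN hN2 hh τ hτ hτc n hn
  have hεκ : ε ^ κ ≤ 1 := Real.rpow_le_one hε.le hε1 hκ.le
  have hεκ0 : 0 < ε ^ κ := Real.rpow_pos_of_pos hε κ
  have hτ1 : τ ≤ ε ^ κ :=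
    hτc.trans (mul_le_of_le_one_left hεκ0.le (min_le_left _ _))
  have hτ2 : K * τ ≤ τbar := by
    rw [← le_div_iff₀' hK0]
    exact hτc.trans ((mul_le_of_le_one_right (lt_min one_pos (by positivity)).le hεκ).trans
      (min_le_right _ _))
  have hKτ : 0 < K * τ := by positivity
  have hτα : τ < stepBound a b (1 / 2) (K * τ) := by
    refine lt_of_lt_of_le ?_ (le_stepBound hab (by norm_num) hKτ (hτ2.trans hτbar1.le))
    rw [← hc]
    have : c * (K * τ) = 2 * τ := by rw [hK]; field_simp
    linarith
  refine (H (K * τ) hKτ hτ2 ε hε hε1 u₀ u₁ u v hsol hA N hN hN2 hh τ hτ hτα n hn).mono ?_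
  have hτq : τ ^ q ≤ ε ^ 2 := by
    calc τ ^ q ≤ (ε ^ κ) ^ q := by gcongr
      _ = ε ^ (κ * q) := by rw [Real.rpow_mul hε.le, Real.rpow_natCast]
      _ ≤ ε ^ (2 : ℝ) := by
        refine Real.rpow_le_rpow_of_exponent_ge hε hε1 ?_
        rwa [div_le_iff₀' hκ] at hq
      _ = ε ^ 2 := Real.rpow_two ε
  have e1 : (K * τ) ^ (q + 2) ≤ K ^ (q + 2) * (ε ^ 2 * τ ^ 2) := by
    rw [mul_pow, pow_add τ]
    gcongr
  have e2 : 0 ≤ K ^ (q + 2) * mesh a b N ^ m := by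
    have := mesh_pos hab hN
    positivity
  rw [mul_assoc]
  refine mul_le_mul_of_nonneg_left ?_ hC.le
  linarith

end NKGE

theorem theorem3p1 (a b T : ℝ) (hab : a < b) (hT : 0 < T) (m : ℕ) (hm : 1 ≤ m) :
    -- solutions satisfying assumption (A)
    (∀ M : ℝ, ∃ h₀ > 0, ∃ τbar > 0, τbar < 1 ∧ ∀ α : ℝ, 0 < α → α < 1 → ∃ C > 0,
      ∀ τ₀ : ℝ, 0 < τ₀ → τ₀ ≤ τbar → ∀ ε : ℝ, 0 < ε → ε ≤ 1 →
      ∀ (u₀ u₁ : ℝ → ℝ) (u v : ℝ → ℝ → ℝ),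
        NKGE.IsSolution a b ε (T / ε ^ 2) u₀ u₁ u v →
        NKGE.AssumptionA a b (T / ε ^ 2) m M u v →
      ∀ N : ℕ, 0 < N → Even N → NKGE.mesh a b N ≤ h₀ →
      ∀ τ : ℝ, 0 < τ → τ < NKGE.stepBound a b α τ₀ →
      ∀ n : ℕ, n * τ ≤ T / ε ^ 2 →
        NKGE.ErrorLE a b ε τ N u₀ u₁ u v n
          (C * (NKGE.mesh a b N ^ m + ε ^ 2 * τ ^ 2 + τ₀ ^ (m + 1)))) ∧
    -- smooth solutions: the last term may be replaced by any power of `τ₀`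
    (∀ (M : ℕ → ℝ) (p : ℕ), ∃ h₀ > 0, ∃ τbar > 0, τbar < 1 ∧ ∀ α : ℝ, 0 < α → α < 1 → ∃ C > 0,
      ∀ τ₀ : ℝ, 0 < τ₀ → τ₀ ≤ τbar → ∀ ε : ℝ, 0 < ε → ε ≤ 1 →
      ∀ (u₀ u₁ : ℝ → ℝ) (u v : ℝ → ℝ → ℝ),
        NKGE.IsSolution a b ε (T / ε ^ 2) u₀ u₁ u v →
        (∀ k : ℕ, NKGE.AssumptionA a b (T / ε ^ 2) k (M k) u v) →
      ∀ N : ℕ, 0 < N → Even N → NKGE.mesh a b N ≤ h₀ →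
      ∀ τ : ℝ, 0 < τ → τ < NKGE.stepBound a b α τ₀ →
      ∀ n : ℕ, n * τ ≤ T / ε ^ 2 →
        NKGE.ErrorLE a b ε τ N u₀ u₁ u v n
          (C * (NKGE.mesh a b N ^ m + ε ^ 2 * τ ^ 2 + τ₀ ^ p))) ∧
    -- smooth solutions: the last term may be dropped for sufficiently small `τ`
    (∀ (M : ℕ → ℝ) (κ : ℝ), 0 < κ → ∃ h₀ > 0, ∃ τc > 0, ∃ C > 0,
      ∀ ε : ℝ, 0 < ε → ε ≤ 1 →
      ∀ (u₀ u₁ : ℝ → ℝ) (u v : ℝ → ℝ → ℝ),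
        NKGE.IsSolution a b ε (T / ε ^ 2) u₀ u₁ u v →
        (∀ k : ℕ, NKGE.AssumptionA a b (T / ε ^ 2) k (M k) u v) →
      ∀ N : ℕ, 0 < N → Even N → NKGE.mesh a b N ≤ h₀ →
      ∀ τ : ℝ, 0 < τ → τ ≤ τc * ε ^ κ →
      ∀ n : ℕ, n * τ ≤ T / ε ^ 2 →
        NKGE.ErrorLE a b ε τ N u₀ u₁ u v n
          (C * (NKGE.mesh a b N ^ m + ε ^ 2 * τ ^ 2))) := by
  refine ⟨fun M => ?_, NKGE.exists_errorLE_smooth hab hT hm,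
    fun M κ hκ => NKGE.exists_errorLE_smooth_small hab hT hm M hκ⟩
  obtain ⟨h₀, hh₀, _, H⟩ := NKGE.exists_errorLE hab hT hm M
  exact ⟨h₀, hh₀, H⟩
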